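/- **Setting.** Let $\alpha\in(0,2)\setminus\{1\}$, $\rho\in[1-1/\alpha,1/\alpha]\cap(0,1)$, $T>0$, $\kappa\in(0,1)$. On a probability space let $E_i,\eta_+,\eta_-$ be exponential with mean $1$, $U_i$ uniform on $(0,1)$ and $V_i$ uniform on $(-\frac\pi2,\frac\pi2)$ ($i\ge1$), all independent. Put $\omega=\pi(\rho-\frac12)$, $$\ell_i=T(1-U_i)\prod_{j=1}^{i-1}U_j,\qquad g(v)=\frac{\sin(\alpha(v+\omega))}{\cos^{1/\alpha}(v)\cos^{1-1/\alpha}((1-\alpha)v-\alpha\omega)},\qquad G_i=g(V_i),\qquad S_i=E_i^{1-1/\alpha}G_i,$$ and, with $[x]^+=\max\{x,0\}$, $[x]^-=\max\{-x,0\}$, $$X_\pm=\sum_{i=1}^\infty \ell_i^{1/\alpha}[S_i]^\pm,\qquad X_{\pm,n}=\sum_{i=1}^n\ell_i^{1/\alpha}[S_i]^\pm+T^{1/\alpha}\kappa^n\eta_\pm^{1-1/\alpha}\quad(n\ge1),$$ $\chi=(X_+,X_-)$, $\chi_n=(X_{+,n},X_{-,n})$. *Smooth random variables.* $\Phi\in\mathbb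 S_m(\Omega)$ means that almost surely $\Phi=\phi(E_1,\dots,E_m,U_1,\dots,U_m,V_1,\dots,V_m,\eta_+,\eta_-,\vartheta)$, where $\vartheta$ is a random element of a metric space $S$, independent of the other arguments, and $\phi:D_m\times S\to\mathbb R$, with $D_m=(0,\infty)^m\times(0,1)^m\times(-\frac\pi2,\frac\pi2)^m\times(0,\infty)^2$, is continuous, $\phi(\cdot,s)\in C^\infty(D_m)$ for every $s\in S$, and for every $j\ge0$ there is a measurable $C_j:S\to\mathbb R$ with $\sup_{D_m}\|D^j\phi(\cdot,s)\|\le C_j(s)$ for all $s\in S$ and $\mathbb E[C_j(\vartheta)]<\infty$ (for instance, $\phi$ and all its derivatives in the first variables are bounded). *Weights.* For $m\ge n\ge1$ and $\Phi$ a function of the above variables let $$\mathcal D_m^\pm=\eta_\pm\partial_{\eta_\pm}+\sum_{i=1}^mE_i\mathbf 1_{\{[G_i]^\pm>0\}}\partial_{E_i},$$ $$H_{n,m}^\pm(\Phi)=\frac1{X_{\pm,n}}\frac{\alpha}{\alpha-1}\Big(\Big(\eta_\pm-\frac1\alpha+\sum_{i=1}^m(E_i-1)\mathbf 1_{\{[G_i]^\pm>0\}}\Big)\Phi-\mathcal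 D_m^\pm[\Phi]\Big),$$ where the partial derivatives are those of a representing function with $\vartheta$ fixed, and let $H^{\pm,k}_{n,m}$ be the $k$-th iterate of $H^\pm_{n,m}$. **Theorem.** Let $\Phi\in\mathbb S_m(\Omega)$ for all $m\ge1$, with an arbitrary choice, for each $m$, of a representation of level $m$, which is used in all weights with second index $m$. Let $n\ge1$, $k_+,k_-\ge0$, $\varepsilon>0$, and let $f:\mathbb R^2\to\mathbb R$ be of class $C^{k_++k_-}$, bounded together with its derivatives of order at most $k_++k_-$, and zero outside $[\varepsilon,\infty)^2$. Write $\Theta_{i,m}=f(\chi_i)H_{i,m}^{+,k_+}\big(H_{i,m}^{-,k_-}(\Phi)\big)$. Then: 1. The series for $X_+$ and $X_-$ converge almost surely, and $\partial_+^{k_+}\partial_-^{k_-}f(\chi)\Phi$ and all $\Theta_{i,m}$ ($m\ge i\ge1$) are integrable. 2. $\displaystyle \mathbb E\big[\partial_+^{k_+}\partial_-^{k_-}f(\chi)\Phi\big]=\mathbb E[\Theta_{n,n}]+\sum_{i=n}^\infty\mathbb E\big[\Theta_{i+1,i+1}-\Theta_{i,i+1}\big],$ the series being convergent. 3. If, for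 every $j$, the $C_j=C_{j,m}$ of the chosen representations can be taken with $\sup_{m\ge1}\mathbb E[C_{j,m}(\vartheta_m)]<\infty$, or if $\sum_{i\ge n}\mathbb E|\Theta_{i+1,i+1}-\Theta_{i,i+1}|<\infty$, then the series $$\langle f,\Phi\rangle_n^{k_+,k_-}=\Theta_{n,n}+\sum_{i=n}^\infty\big(\Theta_{i+1,i+1}-\Theta_{i,i+1}\big)$$ converges almost surely, its sum is integrable, and $\mathbb E\big[\partial_+^{k_+}\partial_-^{k_-}f(\chi)\Phi\big]=\mathbb E\big[\langle f,\Phi\rangle_n^{k_+,k_-}\big]$. -/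

import Mathlib

open MeasureTheory ProbabilityTheory Filter Set
open scoped Topology

noncomputable section

namespace StableIBP

/-- The two signs `+` and `-`. -/
inductive PM where
  | plus : PM
  | minus : PM

/-- Labels of the independent driving variables. The sequences are indexed from `0`, so that
`E i`, `U i`, `V i` stand for the variables usually written `E_{i+1}`, `U_{i+1}`, `V_{i+1}`. -/
inductive NoiseIdx where
  | E (i : ℕ) : NoiseIdx
  | U (i : ℕ) : NoiseIdx
  | V (i : ℕ) : NoiseIdx
  | eta (σ : PM) : NoiseIdx

/-- A realisation of all driving variables. -/
abbrev Noise := NoiseIdx → ℝ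

/-- The driving variables are independent, with `E i` and `eta σ` exponential of mean one,
`U i` uniform on `(0,1)` and `V i` uniform on `(-π/2, π/2)`. -/
structure IsDrivingNoise {Ω : Type*} [MeasurableSpace Ω] (P : Measure Ω) (N : Ω → Noise) :
    Prop where
  measurable : ∀ k, Measurable (fun ω => N ω k)
  law_E : ∀ i, P.map (fun ω => N ω (.E i)) = expMeasure 1
  law_U : ∀ i, pdf.IsUniform (fun ω => N ω (.U i)) (Ioo (0 : ℝ) 1) P volume
  law_V : ∀ i,
    pdf.IsUniform (fun ω => N ω (.V i)) (Ioo (-(Real.pi / 2)) (Real.pi / 2)) P volume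
  law_eta : ∀ σ, P.map (fun ω => N ω (.eta σ)) = expMeasure 1
  indep : iIndepFun (fun k ω => N ω k) P

/-- Positive part `[y]^+ = max y 0` and negative part `[y]^- = max (-y) 0`. -/
def part : PM → ℝ → ℝ
  | .plus, y => max y 0
  | .minus, y => max (-y) 0

/-- The stick lengths `ℓ_{i+1} = T (1 - U_{i+1}) U_1 ⋯ U_i`. -/
def stick (T : ℝ) (x : Noise) (i : ℕ) : ℝ :=
  T * (1 - x (.U i)) * ∏ j ∈ Finset.range i, x (.U j)

/-- The Chambers-Mallows-Stuck function `g`, with `ω = π (ρ - 1/2)`. -/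
def cms (α ρ v : ℝ) : ℝ :=
  Real.sin (α * (v + Real.pi * (ρ - 1 / 2))) /
    (Real.cos v ^ (1 / α) *
      Real.cos ((1 - α) * v - α * (Real.pi * (ρ - 1 / 2))) ^ (1 - 1 / α))

/-- `G_{i+1} = g(V_{i+1})`. -/
def angular (α ρ : ℝ) (x : Noise) (i : ℕ) : ℝ := cms α ρ (x (.V i))

/-- The stable variable `S_{i+1} = E_{i+1}^{1-1/α} G_{i+1}`. -/
def stable (α ρ : ℝ) (x : Noise) (i : ℕ) : ℝ := x (.E i) ^ (1 - 1 / α) * angular α ρ x i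

/-- The terms `ℓ_{i+1}^{1/α} [S_{i+1}]^±` of the series for `X_±`. -/
def jumpTerm (α ρ T : ℝ) (σ : PM) (x : Noise) (i : ℕ) : ℝ :=
  stick T x i ^ (1 / α) * part σ (stable α ρ x i)

/-- `X_±`. -/
def limX (α ρ T : ℝ) (σ : PM) (x : Noise) : ℝ := ∑' i, jumpTerm α ρ T σ x i

/-- The approximation `X_{±,n}`, for `n ≥ 1`, with `a_n = T^{1/α} κ^n`. -/
def approxX (α ρ T κ : ℝ) (n : ℕ) (σ : PM) (x : Noise) : ℝ :=
  ∑ i ∈ Finset.range n, jumpTerm α ρ T σ x i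
    + T ^ (1 / α) * κ ^ n * x (.eta σ) ^ (1 - 1 / α)

/-- `χ = (X_+, X_-)`. -/
def limChi (α ρ T : ℝ) (x : Noise) : ℝ × ℝ := (limX α ρ T .plus x, limX α ρ T .minus x)

/-- `χ_n = (X_{+,n}, X_{-,n})`. -/
def approxChi (α ρ T κ : ℝ) (n : ℕ) (x : Noise) : ℝ × ℝ :=
  (approxX α ρ T κ n .plus x, approxX α ρ T κ n .minus x)

/-- The indicator of `[G_{i+1}]^± > 0`. -/
def sgnInd (α ρ : ℝ) (σ : PM) (x : Noise) (i : ℕ) : ℝ :=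
  open Classical in if 0 < part σ (angular α ρ x i) then 1 else 0

/-- Partial derivative with respect to one driving variable, the others being frozen. -/
def pderiv (k : NoiseIdx) (ψ : Noise → ℝ) (x : Noise) : ℝ :=
  open Classical in deriv (fun t => ψ (Function.update x k t)) (x k)

/-- The operator `𝓓^±_m = η_± ∂_{η_±} + ∑_{i=1}^m E_i 1_{[G_i]^± > 0} ∂_{E_i}`. -/
def opD (α ρ : ℝ) (m : ℕ) (σ : PM) (ψ : Noise → ℝ) (x : Noise) : ℝ :=
  x (.eta σ) * pderiv (.eta σ) ψ x
    + ∑ i ∈ Finset.range m, x (.E i) * sgnInd α ρ σ x i * pderiv (.E i) ψ x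

/-- The integration-by-parts weight `H^±_{n,m}`, as an operator on functions of the noise. -/
def opH (α ρ T κ : ℝ) (n m : ℕ) (σ : PM) (ψ : Noise → ℝ) (x : Noise) : ℝ :=
  1 / approxX α ρ T κ n σ x * (α / (α - 1)) *
    ((x (.eta σ) - 1 / α + ∑ i ∈ Finset.range m, (x (.E i) - 1) * sgnInd α ρ σ x i) * ψ x
      - opD α ρ m σ ψ x)

/-- Values of `(E_1,…,E_m), (U_1,…,U_m), (V_1,…,V_m), η_+, η_-`. -/
abbrev Coord (m : ℕ) := (Fin m → ℝ) × (Fin m → ℝ) × (Fin m → ℝ) × ℝ × ℝ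

/-- The coordinates of level `m` of a realisation of the noise. -/
def trunc (m : ℕ) (x : Noise) : Coord m :=
  (fun i => x (.E i), fun i => x (.U i), fun i => x (.V i), x (.eta .plus), x (.eta .minus))

/-- The open set in which the coordinates of level `m` take their values. -/
def coordDomain (m : ℕ) : Set (Coord m) :=
  {c | (∀ i, 0 < c.1 i) ∧ (∀ i, c.2.1 i ∈ Ioo (0 : ℝ) 1) ∧
    (∀ i, c.2.2.1 i ∈ Ioo (-(Real.pi / 2)) (Real.pi / 2)) ∧ 0 < c.2.2.2.1 ∧ 0 < c.2.2.2.2}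

/-- The `j`-th derivative of `φ(·, s)` is bounded on the domain by some `C s`, with `C`
measurable and `E[C(ϑ)] ≤ K`. -/
def DerivBoundedInMean {Ω S : Type*} [MeasurableSpace Ω] [MeasurableSpace S]
    (P : Measure Ω) (m : ℕ) (φ : Coord m → S → ℝ) (ϑ : Ω → S) (j : ℕ) (K : ℝ) : Prop :=
  ∃ C : S → ℝ, Measurable C ∧
    (∀ c ∈ coordDomain m, ∀ s, ‖iteratedFDeriv ℝ j (fun c' => φ c' s) c‖ ≤ C s) ∧
    Integrable (fun ω => C (ϑ ω)) P ∧ ∫ ω, C (ϑ ω) ∂P ≤ K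

/-- `Φ` is a smooth random variable of level `m`, represented as
`Φ = φ(E_1,…,E_m, U_1,…,U_m, V_1,…,V_m, η_+, η_-, ϑ)` with `ϑ` independent of the other
arguments and `φ` continuous, and infinitely differentiable with bounded derivatives in all
arguments but the last. -/
structure IsSmoothRep {Ω S : Type*} [MeasurableSpace Ω] (P : Measure Ω) (N : Ω → Noise)
    [MetricSpace S] [MeasurableSpace S] (m : ℕ) (φ : Coord m → S → ℝ) (ϑ : Ω → S)
    (Φ : Ω → ℝ) : Prop where
  measurable : Measurable ϑ
  indep : IndepFun (fun ω => trunc m (N ω)) ϑ P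
  continuousOn : ContinuousOn (fun p : Coord m × S => φ p.1 p.2) (coordDomain m ×ˢ univ)
  contDiffOn : ∀ s, ContDiffOn ℝ (⊤ : ℕ∞) (fun c => φ c s) (coordDomain m)
  bounded : ∀ j, ∃ K, DerivBoundedInMean P m φ ϑ j K
  eq_rep : Φ =ᵐ[P] fun ω => φ (trunc m (N ω)) (ϑ ω)

/-- Functions on the plane that are `k` times continuously differentiable, bounded with all
derivatives of order at most `k`, and vanish outside `[ε,∞)²`. -/
structure IsTestFunction (k : ℕ) (ε : ℝ) (f : ℝ × ℝ → ℝ) : Prop where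
  contDiff : ContDiff ℝ k f
  bounded : ∀ j ≤ k, ∃ C, ∀ p, ‖iteratedFDeriv ℝ j f p‖ ≤ C
  support_subset : Function.support f ⊆ Ici ε ×ˢ Ici ε

/-- The mixed partial derivative `∂_+^{kp} ∂_-^{km} f`. -/
def mixedDeriv (kp km : ℕ) (f : ℝ × ℝ → ℝ) (p : ℝ × ℝ) : ℝ :=
  iteratedDeriv kp (fun a => iteratedDeriv km (fun b => f (a, b)) p.2) p.1

/-- `Θ_{n,m} = f(χ_n) H_{n,m}^{+,kp}(H_{n,m}^{-,km}(Φ))` for `Φ = φ(trunc m ·, ϑ)`. -/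
def Theta {Ω S : Type*} (α ρ T κ : ℝ) (N : Ω → Noise) (f : ℝ × ℝ → ℝ) (kp km n m : ℕ)
    (φ : Coord m → S → ℝ) (ϑ : Ω → S) (ω : Ω) : ℝ :=
  f (approxChi α ρ T κ n (N ω)) *
    (opH α ρ T κ n m .plus)^[kp]
      ((opH α ρ T κ n m .minus)^[km] (fun x => φ (trunc m x) (ϑ ω))) (N ω)

/-- The level difference `Θ_{i+1,i+1} - Θ_{i,i+1}`. -/
def levelDiff {Ω : Type*} {S : ℕ → Type*} (α ρ T κ : ℝ) (N : Ω → Noise) (f : ℝ × ℝ → ℝ)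
    (kp km : ℕ) (φ : ∀ m, Coord m → S m → ℝ) (ϑ : ∀ m, Ω → S m) (i : ℕ) (ω : Ω) : ℝ :=
  Theta α ρ T κ N f kp km (i + 1) (i + 1) (φ (i + 1)) (ϑ (i + 1)) ω
    - Theta α ρ T κ N f kp km i (i + 1) (φ (i + 1)) (ϑ (i + 1)) ω

end StableIBP

end

open StableIBP

/-
`𝒟^±` multiplies `X_{±,n}` by the constant `1 - 1/α` and annihilates `X_{∓,n}`, so integration by
parts in the exponential variables turns `∂_± f(χ_n)` into `f(χ_n)` times a weight: the mean
`E[Θ_{i,m}] = E[∂_+^{k_+} ∂_-^{k_-} f(χ_i) Φ]` does not depend on `m`. The series of expectations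
therefore telescopes, and `χ_i → χ`.

For almost sure convergence, `Θ_{i,m}` is `f(χ_i) X_{+,i}^{-k_+} X_{-,i}^{-k_-}` times a factor that
is free of `i`. As `f` vanishes near the axes, the first factor is a bounded Lipschitz function of
`χ_i`, so `|Θ_{i+1,i+1} - Θ_{i,i+1}|` is at most `min(1, ‖χ_{i+1} - χ_i‖)` times a polynomial in the
noise. Small moments of the increment decay geometrically in `i`, while the moments of the
polynomial grow only polynomially, and the level differences are summable in mean.
-/

noncomputable section

namespace StableIBP

section ExponentialLaw

variable {r : ℝ}

lemma expMeasure_eq_withDensity (r : ℝ) :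
    expMeasure r = (volume.restrict (Ioi (0 : ℝ))).withDensity
      (fun t => ENNReal.ofReal (r * Real.exp (-(r * t)))) := by
  rw [show expMeasure r = volume.withDensity (exponentialPDF r) from rfl,
    ← withDensity_indicator measurableSet_Ioi]
  refine withDensity_congr_ae ?_
  filter_upwards [Measure.ae_ne volume (0 : ℝ)] with t ht
  rcases lt_or_gt_of_ne ht with h | h
  · rw [exponentialPDF_of_neg h, indicator_of_notMem (by simpa using h.le)]
  · rw [exponentialPDF_of_nonneg h.le, indicator_of_mem (by simpa using h)]

instance : IsProbabilityMeasure (expMeasure 1) := isProbabilityMeasure_expMeasure one_pos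

lemma ae_pos_expMeasure (r : ℝ) : ∀ᵐ t ∂(expMeasure r), 0 < t := by
  rw [expMeasure_eq_withDensity]
  exact (withDensity_absolutelyContinuous _ _).ae_le (ae_restrict_mem measurableSet_Ioi)

lemma integral_expMeasure (hr : 0 ≤ r) (g : ℝ → ℝ) :
    ∫ t, g t ∂(expMeasure r) = ∫ t in Ioi 0, r * Real.exp (-(r * t)) * g t := by
  rw [expMeasure_eq_withDensity,
    integral_withDensity_eq_integral_toReal_smul (by fun_prop) (by simp)]
  refine integral_congr_ae (Eventually.of_forall fun t => ?_)
  simp only [ENNReal.toReal_ofReal (mul_nonneg hr (Real.exp_pos _).le), smul_eq_mul]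

lemma integrable_expMeasure_iff (hr : 0 < r) {g : ℝ → ℝ} :
    Integrable g (expMeasure r) ↔ IntegrableOn (fun t => Real.exp (-(r * t)) * g t) (Ioi 0) := by
  rw [expMeasure_eq_withDensity,
    integrable_withDensity_iff_integrable_smul' (by fun_prop) (by simp)]
  simp only [ENNReal.toReal_ofReal (mul_pos hr (Real.exp_pos _)).le, smul_eq_mul, mul_assoc]
  exact integrable_const_mul_iff (IsUnit.mk0 r hr.ne') _

lemma integrable_rpow_expMeasure (hr : 0 < r) {s : ℝ} (hs : -1 < s) :
    Integrable (fun t => t ^ s) (expMeasure r) := by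
  rw [integrable_expMeasure_iff hr]
  simpa only [Real.rpow_one, neg_mul, mul_comm (_ ^ s)] using
    integrableOn_rpow_mul_exp_neg_mul_rpow hs one_pos hr

lemma integrable_add_pow_expMeasure (hr : 0 < r) (c : ℝ) (k : ℕ) :
    Integrable (fun t => (c + t) ^ k) (expMeasure r) := by
  simp_rw [add_pow]
  refine integrable_finsetSum _ fun j _ => (Integrable.const_mul ?_ _).mul_const _
  exact_mod_cast integrable_rpow_expMeasure hr (s := (k - j : ℕ)) (neg_one_lt_zero.trans_le
    (Nat.cast_nonneg _))

lemma integrable_expMeasure_of_le_pow (hr : 0 < r) {g : ℝ → ℝ} {K c : ℝ} {k : ℕ}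
    (hg : AEStronglyMeasurable g (expMeasure r)) (h : ∀ t, 0 < t → |g t| ≤ K * (c + t) ^ k) :
    Integrable g (expMeasure r) :=
  ((integrable_add_pow_expMeasure hr c k).const_mul K).mono' hg
    ((ae_pos_expMeasure r).mono fun t ht => h t ht)

lemma aestronglyMeasurable_expMeasure_of_continuousOn {g : ℝ → ℝ} (hg : ContinuousOn g (Ioi 0)) :
    AEStronglyMeasurable g (expMeasure r) := by
  rw [expMeasure_eq_withDensity]
  exact (hg.aestronglyMeasurable measurableSet_Ioi).mono_ac (withDensity_absolutelyContinuous _ _)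

/- The boundary term `t e^{-rt} F t` vanishes at infinity because it is integrable together with its
derivative. -/
lemma integral_mul_deriv_expMeasure (hr : 0 < r) {F : ℝ → ℝ}
    (hF : ∀ t, 0 < t → DifferentiableAt ℝ F t)
    (hF₀ : Tendsto (fun t => t * F t) (𝓝[>] 0) (𝓝 0))
    (hi : Integrable F (expMeasure r)) (hi₁ : Integrable (fun t => t * F t) (expMeasure r))
    (hi' : Integrable (fun t => t * deriv F t) (expMeasure r)) :
    ∫ t, t * deriv F t ∂(expMeasure r) = ∫ t, (r * t - 1) * F t ∂(expMeasure r) := by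
  have hi₂ : Integrable (fun t => (r * t - 1) * F t) (expMeasure r) :=
    ((hi₁.const_mul r).sub hi).congr (Eventually.of_forall fun t => by
      simp only [Pi.sub_apply]; ring)
  have hderiv : ∀ t ∈ Ioi (0 : ℝ), HasDerivAt (fun t => Real.exp (-(r * t)) * (t * F t))
      (Real.exp (-(r * t)) * (t * deriv F t - (r * t - 1) * F t)) t := fun t ht =>
    ((((hasDerivAt_id' t).const_mul r).fun_neg.exp).mul
      ((hasDerivAt_id' t).mul (hF t ht).hasDerivAt)).congr_deriv (by
        simp only [Pi.mul_apply]; ring)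
  have hint := (integrable_expMeasure_iff hr).1 (hi'.sub hi₂)
  have hzero : Tendsto (fun t => Real.exp (-(r * t)) * (t * F t)) (𝓝[>] 0) (𝓝 0) := by
    have hexp : Tendsto (fun t => Real.exp (-(r * t))) (𝓝[>] 0) (𝓝 1) := by
      have hcont : Continuous fun t : ℝ => Real.exp (-(r * t)) := by fun_prop
      simpa using (hcont.tendsto 0).mono_left nhdsWithin_le_nhds
    simpa using hexp.mul hF₀
  have hcont : ContinuousWithinAt (fun t => Real.exp (-(r * t)) * (t * F t)) (Ici 0) 0 := by
    rw [← continuousWithinAt_Ioi_iff_Ici, ContinuousWithinAt]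
    simpa using hzero
  rw [← sub_eq_zero, ← integral_sub hi' hi₂, integral_expMeasure hr.le]
  simp_rw [mul_assoc, integral_const_mul]
  have hftc := integral_Ioi_of_hasDerivAt_of_tendsto hcont hderiv hint
    (tendsto_zero_of_hasDerivAt_of_integrableOn_Ioi hderiv hint
      ((integrable_expMeasure_iff hr).1 hi₁))
  rw [hftc]
  simp

lemma integral_mul_deriv_expMeasure_of_le_pow (hr : 0 < r) {F : ℝ → ℝ} {K c : ℝ} {k : ℕ}
    (hF : ∀ t, 0 < t → DifferentiableAt ℝ F t)
    (hb : ∀ t, 0 < t → |F t| ≤ K * (c + t) ^ k)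
    (hb' : ∀ t, 0 < t → |t * deriv F t| ≤ K * (c + t) ^ k) :
    ∫ t, t * deriv F t ∂(expMeasure r) = ∫ t, (r * t - 1) * F t ∂(expMeasure r) := by
  have hcont : ContinuousOn F (Ioi 0) := fun t ht => (hF t ht).continuousAt.continuousWithinAt
  have hi : Integrable F (expMeasure r) := integrable_expMeasure_of_le_pow hr
    (aestronglyMeasurable_expMeasure_of_continuousOn hcont) hb
  have hb₁ : ∀ t, 0 < t → |t * F t| ≤ t * (K * (c + t) ^ k) := fun t ht => by
    rw [abs_mul, abs_of_pos ht]
    exact mul_le_mul_of_nonneg_left (hb t ht) ht.le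
  have hi₁ : Integrable (fun t => t * F t) (expMeasure r) := by
    refine ((((integrable_add_pow_expMeasure hr c (k + 1)).sub
      ((integrable_add_pow_expMeasure hr c k).const_mul c)).const_mul K).mono'
      (aestronglyMeasurable_expMeasure_of_continuousOn (continuousOn_id.mul hcont)))
      ((ae_pos_expMeasure r).mono fun t ht => (hb₁ t ht).trans_eq ?_)
    simp only [Pi.sub_apply]
    ring
  have hi' : Integrable (fun t => t * deriv F t) (expMeasure r) :=
    integrable_expMeasure_of_le_pow hr
      (measurable_id.mul (measurable_deriv F)).aestronglyMeasurable hb'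
  refine integral_mul_deriv_expMeasure hr hF ?_ hi hi₁ hi'
  refine squeeze_zero_norm' (eventually_mem_nhdsWithin.mono fun t ht => hb₁ t ht) ?_
  have hlim : Continuous fun t : ℝ => t * (K * (c + t) ^ k) := by fun_prop
  simpa using (hlim.tendsto 0).mono_left nhdsWithin_le_nhds

end ExponentialLaw

section NoiseDomain

instance : DecidableEq PM := Classical.decEq _

instance : DecidableEq NoiseIdx := Classical.decEq _

lemma pderiv_eq (l : NoiseIdx) (ψ : Noise → ℝ) (x : Noise) :
    pderiv l ψ x = deriv (fun t => ψ (Function.update x l t)) (x l) := rfl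

/-- The labels of the exponential variables of level `m`, the two `η_±` included. -/
def expIdx (m : ℕ) : Finset NoiseIdx :=
  (Finset.range m).image NoiseIdx.E ∪ {.eta .plus, .eta .minus}

/-- The labels of all variables of level `m`. -/
def levelIdx (m : ℕ) : Finset NoiseIdx :=
  expIdx m ∪ (Finset.range m).image NoiseIdx.U ∪ (Finset.range m).image NoiseIdx.V

@[simp] lemma E_mem_expIdx {m i : ℕ} : NoiseIdx.E i ∈ expIdx m ↔ i < m := by simp [expIdx]

@[simp] lemma eta_mem_expIdx {m : ℕ} {σ : PM} : NoiseIdx.eta σ ∈ expIdx m := by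
  cases σ <;> simp [expIdx]

@[simp] lemma U_notMem_expIdx {m i : ℕ} : NoiseIdx.U i ∉ expIdx m := by simp [expIdx]

@[simp] lemma V_notMem_expIdx {m i : ℕ} : NoiseIdx.V i ∉ expIdx m := by simp [expIdx]

@[simp] lemma E_mem_levelIdx {m i : ℕ} : NoiseIdx.E i ∈ levelIdx m ↔ i < m := by simp [levelIdx]

@[simp] lemma U_mem_levelIdx {m i : ℕ} : NoiseIdx.U i ∈ levelIdx m ↔ i < m := by simp [levelIdx]

@[simp] lemma V_mem_levelIdx {m i : ℕ} : NoiseIdx.V i ∈ levelIdx m ↔ i < m := by simp [levelIdx]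

@[simp] lemma eta_mem_levelIdx {m : ℕ} {σ : PM} : NoiseIdx.eta σ ∈ levelIdx m := by simp [levelIdx]

lemma expIdx_subset_levelIdx (m : ℕ) : expIdx m ⊆ levelIdx m :=
  Finset.subset_union_left.trans Finset.subset_union_left

lemma sum_expIdx {M : Type*} [AddCommMonoid M] (m : ℕ) (h : NoiseIdx → M) :
    ∑ l ∈ expIdx m, h l = h (.eta .plus) + h (.eta .minus) + ∑ i ∈ Finset.range m, h (.E i) := by
  rw [expIdx, Finset.sum_union, Finset.sum_image, Finset.sum_pair, add_comm]
  · simp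
  · simp
  · simp [Finset.disjoint_left]

lemma card_expIdx (m : ℕ) : (expIdx m).card = m + 2 := by
  rw [Finset.card_eq_sum_ones, sum_expIdx]
  simp [add_comm]

lemma dependsOn_trunc (m : ℕ) : DependsOn (trunc m) (levelIdx m) := by
  intro x y h
  have hE : ∀ i : Fin m, x (.E i) = y (.E i) := fun i => h _ (by simp)
  have hU : ∀ i : Fin m, x (.U i) = y (.U i) := fun i => h _ (by simp)
  have hV : ∀ i : Fin m, x (.V i) = y (.V i) := fun i => h _ (by simp)
  have hη : ∀ σ, x (.eta σ) = y (.eta σ) := fun σ => h _ (by simp)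
  simp only [trunc, hE, hU, hV, hη]

lemma measurable_trunc (m : ℕ) : Measurable (trunc m) := by
  unfold trunc
  fun_prop

lemma isOpen_coordDomain (m : ℕ) : IsOpen (coordDomain m) := by
  simp only [coordDomain, ofPred_and, ofPred_forall]
  refine .inter (isOpen_iInter_of_finite fun i => isOpen_lt continuous_const (by fun_prop))
    (.inter (isOpen_iInter_of_finite fun i => ?_) (.inter (isOpen_iInter_of_finite fun i => ?_)
      (.inter (isOpen_lt continuous_const (by fun_prop))
        (isOpen_lt continuous_const (by fun_prop)))))
  · exact isOpen_Ioo.preimage (f := fun c : Coord m => c.2.1 i) (by fun_prop)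
  · exact isOpen_Ioo.preimage (f := fun c : Coord m => c.2.2.1 i) (by fun_prop)

/-- The realisations of the noise whose coordinates of level `m` lie in their natural range. -/
def noiseDomain (m : ℕ) : Set Noise := trunc m ⁻¹' coordDomain m

lemma measurableSet_noiseDomain (m : ℕ) : MeasurableSet (noiseDomain m) :=
  measurable_trunc m (isOpen_coordDomain m).measurableSet

lemma mem_noiseDomain_iff {m : ℕ} {x : Noise} :
    x ∈ noiseDomain m ↔ (∀ i < m, 0 < x (.E i)) ∧ (∀ i < m, x (.U i) ∈ Ioo (0 : ℝ) 1) ∧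
      (∀ i < m, x (.V i) ∈ Ioo (-(Real.pi / 2)) (Real.pi / 2)) ∧ ∀ σ, 0 < x (.eta σ) := by
  have hσ : (∀ σ, 0 < x (.eta σ)) ↔ 0 < x (.eta .plus) ∧ 0 < x (.eta .minus) :=
    ⟨fun h => ⟨h _, h _⟩, fun h σ => by cases σ; exacts [h.1, h.2]⟩
  simp only [noiseDomain, trunc, coordDomain, mem_preimage, mem_ofPred_eq, Fin.forall_iff, hσ]

lemma mem_noiseDomain_congr {m : ℕ} {x y : Noise} (h : ∀ k ∈ levelIdx m, x k = y k) :
    x ∈ noiseDomain m ↔ y ∈ noiseDomain m := by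
  rw [noiseDomain, mem_preimage, mem_preimage, dependsOn_trunc m h]

lemma pos_of_mem_noiseDomain {m : ℕ} {x : Noise} (hx : x ∈ noiseDomain m) {l : NoiseIdx}
    (hl : l ∈ expIdx m) : 0 < x l := by
  rw [mem_noiseDomain_iff] at hx
  cases l <;> simp_all

lemma update_mem_noiseDomain {m : ℕ} {x : Noise} (hx : x ∈ noiseDomain m) {l : NoiseIdx}
    (hl : l ∈ expIdx m) {t : ℝ} (ht : 0 < t) : Function.update x l t ∈ noiseDomain m := by
  have hpos : ∀ k, 0 < x k → 0 < Function.update x l t k := fun k hk => by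
    rcases eq_or_ne k l with rfl | h
    · simpa
    · rwa [Function.update_of_ne h]
  rw [mem_noiseDomain_iff] at hx ⊢
  refine ⟨fun i hi => hpos _ (hx.1 i hi), fun i hi => ?_, fun i hi => ?_,
    fun σ => hpos _ (hx.2.2.2 σ)⟩
  · rw [Function.update_of_ne (by rintro rfl; simp at hl)]
    exact hx.2.1 i hi
  · rw [Function.update_of_ne (by rintro rfl; simp at hl)]
    exact hx.2.2.1 i hi

lemma eventually_update_mem_noiseDomain {m : ℕ} {x : Noise} (hx : x ∈ noiseDomain m)
    {l : NoiseIdx} (hl : l ∈ expIdx m) :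
    ∀ᶠ t in 𝓝 (x l), Function.update x l t ∈ noiseDomain m :=
  (lt_mem_nhds (pos_of_mem_noiseDomain hx hl)).mono fun _ ht => update_mem_noiseDomain hx hl ht

lemma pderiv_congr {m : ℕ} {x : Noise} (hx : x ∈ noiseDomain m) {l : NoiseIdx}
    (hl : l ∈ expIdx m) {ψ ψ' : Noise → ℝ} (h : ∀ y ∈ noiseDomain m, ψ y = ψ' y) :
    pderiv l ψ x = pderiv l ψ' x :=
  EventuallyEq.deriv_eq ((eventually_update_mem_noiseDomain hx hl).mono fun _ ht => h _ ht)

lemma update_congr {s : Set NoiseIdx} {x y : Noise} (h : ∀ k ∈ s, x k = y k) (l : NoiseIdx)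
    (t : ℝ) : ∀ k ∈ s, Function.update x l t k = Function.update y l t k := fun k hk => by
  rcases eq_or_ne k l with rfl | hkl
  · simp
  · rw [Function.update_of_ne hkl, Function.update_of_ne hkl, h k hk]

lemma measurable_update_prod (l : NoiseIdx) :
    Measurable (fun p : Noise × ℝ => Function.update p.1 l p.2) := by
  refine measurable_pi_iff.2 fun k => ?_
  rcases eq_or_ne k l with rfl | h
  · simpa using measurable_snd
  · simp only [Function.update_of_ne h]
    fun_prop

/-- The total size of the exponential variables of level `m`, in which growth is measured. -/
def noiseGauge (m : ℕ) (x : Noise) : ℝ := ∑ l ∈ expIdx m, (1 + x l)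

lemma measurable_noiseGauge (m : ℕ) : Measurable (noiseGauge m) := by
  unfold noiseGauge
  fun_prop

lemma dependsOn_noiseGauge (m : ℕ) : DependsOn (noiseGauge m) (levelIdx m) := fun _ _ h =>
  Finset.sum_congr rfl fun l hl => by rw [h l (expIdx_subset_levelIdx m hl)]

lemma add_two_le_noiseGauge {m : ℕ} {x : Noise} (hx : x ∈ noiseDomain m) :
    (m : ℝ) + 2 ≤ noiseGauge m x := by
  have hcard : ∑ _l ∈ expIdx m, (1 : ℝ) ≤ noiseGauge m x :=
    Finset.sum_le_sum fun l hl => by linarith [pos_of_mem_noiseDomain hx hl]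
  simpa [card_expIdx] using hcard

lemma one_le_noiseGauge {m : ℕ} {x : Noise} (hx : x ∈ noiseDomain m) : 1 ≤ noiseGauge m x := by
  linarith [add_two_le_noiseGauge hx, m.cast_nonneg (α := ℝ)]

lemma one_add_le_noiseGauge {m : ℕ} {x : Noise} (hx : x ∈ noiseDomain m) {l : NoiseIdx}
    (hl : l ∈ expIdx m) : 1 + x l ≤ noiseGauge m x :=
  Finset.single_le_sum (f := fun l => 1 + x l)
    (fun l hl => by linarith [pos_of_mem_noiseDomain hx hl]) hl

lemma noiseGauge_update {m : ℕ} (x : Noise) {l : NoiseIdx} (hl : l ∈ expIdx m) (t : ℝ) :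
    noiseGauge m (Function.update x l t) = noiseGauge m x - x l + t := by
  unfold noiseGauge
  rw [← Finset.add_sum_erase _ _ hl, ← Finset.add_sum_erase _ _ hl, Function.update_self,
    Finset.sum_congr rfl fun k hk => by rw [Function.update_of_ne (Finset.ne_of_mem_erase hk)]]
  ring

lemma noiseGauge_pow_le {m : ℕ} {x : Noise} (hx : x ∈ noiseDomain m) (r : ℕ) :
    noiseGauge m x ^ r ≤ ((m : ℝ) + 2) ^ r * ∑ l ∈ expIdx m, (1 + x l) ^ r := by
  have hm : (1 : ℝ) ≤ (m : ℝ) + 2 := by linarith [m.cast_nonneg (α := ℝ)]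
  cases r with
  | zero =>
    simp only [pow_zero, Finset.sum_const, card_expIdx, nsmul_eq_mul, mul_one, one_mul]
    exact_mod_cast hm
  | succ r =>
    have hpos : ∀ l ∈ expIdx m, 0 ≤ 1 + x l := fun l hl => by
      linarith [pos_of_mem_noiseDomain hx hl]
    have hpow := pow_sum_le_card_mul_sum_pow hpos r
    rw [card_expIdx] at hpow
    push_cast at hpow
    exact hpow.trans (mul_le_mul_of_nonneg_right (pow_le_pow_right₀ hm (by lia))
      (Finset.sum_nonneg fun l hl => pow_nonneg (hpos l hl) _))

end NoiseDomain

section Independence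

variable {Ω S : Type*} [MeasurableSpace Ω] {P : Measure Ω} {N : Ω → Noise}

lemma IsDrivingNoise.measurable_noise (hN : IsDrivingNoise P N) : Measurable N :=
  measurable_pi_iff.2 hN.measurable

lemma IsDrivingNoise.map_eq_expMeasure (hN : IsDrivingNoise P N) {m : ℕ} {l : NoiseIdx}
    (hl : l ∈ expIdx m) : P.map (fun ω => N ω l) = expMeasure 1 := by
  cases l
  · exact hN.law_E _
  · simp at hl
  · simp at hl
  · exact hN.law_eta _

lemma IsDrivingNoise.ae_pos (hN : IsDrivingNoise P N) {m : ℕ} {l : NoiseIdx} (hl : l ∈ expIdx m) :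
    ∀ᵐ ω ∂P, 0 < N ω l := by
  have hpos := ae_pos_expMeasure 1
  rw [← hN.map_eq_expMeasure hl] at hpos
  exact ae_of_ae_map (hN.measurable l).aemeasurable hpos

lemma ae_mem_of_isUniform {X : Ω → ℝ} (hX : Measurable X) {s : Set ℝ} (hs : MeasurableSet s)
    (h : pdf.IsUniform X s P volume) : ∀ᵐ ω ∂P, X ω ∈ s := by
  have hmap : ∀ᵐ y ∂(P.map X), y ∈ s := by
    rw [show P.map X = ProbabilityTheory.cond volume s from h]
    exact ae_cond_mem hs
  exact ae_of_ae_map hX.aemeasurable hmap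

lemma IsDrivingNoise.ae_mem_noiseDomain (hN : IsDrivingNoise P N) (m : ℕ) :
    ∀ᵐ ω ∂P, N ω ∈ noiseDomain m := by
  have hE : ∀ᵐ ω ∂P, ∀ i, 0 < N ω (.E i) :=
    ae_all_iff.2 fun i => hN.ae_pos (m := i + 1) (by simp)
  have hU : ∀ᵐ ω ∂P, ∀ i, N ω (.U i) ∈ Ioo (0 : ℝ) 1 :=
    ae_all_iff.2 fun i => ae_mem_of_isUniform (hN.measurable _) measurableSet_Ioo (hN.law_U i)
  have hV : ∀ᵐ ω ∂P, ∀ i, N ω (.V i) ∈ Ioo (-(Real.pi / 2)) (Real.pi / 2) :=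
    ae_all_iff.2 fun i => ae_mem_of_isUniform (hN.measurable _) measurableSet_Ioo (hN.law_V i)
  have hη := fun σ => hN.ae_pos (l := .eta σ) (m := 0) (by simp)
  filter_upwards [hE, hU, hV, hη .plus, hη .minus] with ω hE hU hV hplus hminus
  exact mem_noiseDomain_iff.2 ⟨fun i _ => hE i, fun i _ => hU i, fun i _ => hV i,
    fun σ => by cases σ; exacts [hplus, hminus]⟩

/-- The realisation of the noise with prescribed coordinates of level `m`, all others being zero:
a right inverse of `trunc m`. -/
def liftCoord (m : ℕ) (c : Coord m) : Noise
  | .E i => if h : i < m then c.1 ⟨i, h⟩ else 0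
  | .U i => if h : i < m then c.2.1 ⟨i, h⟩ else 0
  | .V i => if h : i < m then c.2.2.1 ⟨i, h⟩ else 0
  | .eta .plus => c.2.2.2.1
  | .eta .minus => c.2.2.2.2

lemma measurable_liftCoord (m : ℕ) : Measurable (liftCoord m) := by
  refine measurable_pi_iff.2 fun k => ?_
  rcases k with i | i | i | σ
  · by_cases h : i < m <;> simp only [liftCoord, h, dite_true, dite_false] <;> fun_prop
  · by_cases h : i < m <;> simp only [liftCoord, h, dite_true, dite_false] <;> fun_prop
  · by_cases h : i < m <;> simp only [liftCoord, h, dite_true, dite_false] <;> fun_prop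
  · cases σ <;> simp only [liftCoord] <;> fun_prop

lemma liftCoord_trunc_apply {m : ℕ} (x : Noise) {k : NoiseIdx} (hk : k ∈ levelIdx m) :
    liftCoord m (trunc m x) k = x k := by
  rcases k with i | i | i | σ
  · simp [liftCoord, trunc, E_mem_levelIdx.1 hk]
  · simp [liftCoord, trunc, U_mem_levelIdx.1 hk]
  · simp [liftCoord, trunc, V_mem_levelIdx.1 hk]
  · cases σ <;> simp [liftCoord, trunc]

lemma indepFun_of_dependsOn [MeasurableSpace S] {β γ : Type*} [MeasurableSpace β]
    [MeasurableSpace γ] {m : ℕ} {ϑ : Ω → S}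
    (hind : IndepFun (fun ω => trunc m (N ω)) ϑ P) {F : Noise → β} (hF : Measurable F)
    (hdep : DependsOn F (levelIdx m)) {C : S → γ} (hC : Measurable C) :
    IndepFun (fun ω => F (N ω)) (fun ω => C (ϑ ω)) P :=
  (hind.comp (hF.comp (measurable_liftCoord m)) hC).congr
    (Eventually.of_forall fun ω => hdep fun _ hk => liftCoord_trunc_apply (N ω) hk) (by rfl)

/-- The noise with only the coordinates of level `m` other than `l` kept, the rest being set to
zero. -/
def eraseCoord (m : ℕ) (l : NoiseIdx) (x : Noise) : Noise :=
  fun k => if k ∈ (levelIdx m).erase l then x k else 0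

lemma measurable_eraseCoord (m : ℕ) (l : NoiseIdx) : Measurable (eraseCoord m l) := by
  refine measurable_pi_iff.2 fun k => ?_
  by_cases h : k ∈ (levelIdx m).erase l <;> simp only [eraseCoord, h, if_true, if_false] <;>
    fun_prop

lemma dependsOn_eraseCoord (m : ℕ) (l : NoiseIdx) : DependsOn (eraseCoord m l) (levelIdx m) := by
  intro x y h
  funext k
  by_cases hk : k ∈ (levelIdx m).erase l
  · simp only [eraseCoord, hk, if_true]
    exact h k (Finset.mem_of_mem_erase hk)
  · simp only [eraseCoord, hk, if_false]

lemma update_eraseCoord {m : ℕ} {l : NoiseIdx} (x : Noise) (t : ℝ) :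
    ∀ k ∈ levelIdx m, Function.update (eraseCoord m l x) l t k = Function.update x l t k := by
  intro k hk
  rcases eq_or_ne k l with rfl | h
  · simp
  · rw [Function.update_of_ne h, Function.update_of_ne h]
    exact if_pos (Finset.mem_erase.2 ⟨h, hk⟩)

lemma indepFun_prodMk_right_of_indepFun {β γ δ : Type*} [MeasurableSpace β] [MeasurableSpace γ]
    [MeasurableSpace δ] [IsProbabilityMeasure P] {X : Ω → β} {Y : Ω → γ} {Z : Ω → δ}
    (hX : Measurable X) (hY : Measurable Y) (hZ : Measurable Z) (hXY : IndepFun X Y P)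
    (hXYZ : IndepFun (fun ω => (X ω, Y ω)) Z P) : IndepFun X (fun ω => (Y ω, Z ω)) P := by
  have := Measure.isProbabilityMeasure_map (μ := P) hX.aemeasurable
  have := Measure.isProbabilityMeasure_map (μ := P) hY.aemeasurable
  have := Measure.isProbabilityMeasure_map (μ := P) hZ.aemeasurable
  have hYZ : IndepFun Y Z P := hXYZ.comp measurable_snd measurable_id
  rw [indepFun_iff_map_prod_eq_prod_map_map (by fun_prop) (by fun_prop)] at hXY hXYZ hYZ ⊢
  rw [hYZ, ← Measure.prodAssoc_prod, ← hXY, ← hXYZ, Measure.map_map (by fun_prop) (by fun_prop)]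
  rfl

variable [MeasurableSpace S]

lemma IsDrivingNoise.indepFun_eraseCoord (hN : IsDrivingNoise P N) (m : ℕ) (l : NoiseIdx) :
    IndepFun (fun ω => N ω l) (fun ω => eraseCoord m l (N ω)) P := by
  have hfin := hN.indep.indepFun_finset {l} ((levelIdx m).erase l) (by simp) hN.measurable
  have hl : Measurable (fun y : ({l} : Finset NoiseIdx) → ℝ => y ⟨l, by simp⟩) := by fun_prop
  have hrest : Measurable (fun (y : ((levelIdx m).erase l : Finset NoiseIdx) → ℝ) (k : NoiseIdx) =>
      if h : k ∈ (levelIdx m).erase l then y ⟨k, h⟩ else 0) := measurable_pi_iff.2 fun k => by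
    by_cases h : k ∈ (levelIdx m).erase l <;> simp only [h, dite_true, dite_false] <;> fun_prop
  refine (hfin.comp hl hrest).congr (by rfl) (Eventually.of_forall fun ω => ?_)
  funext k
  simp [eraseCoord]

lemma IsDrivingNoise.indepFun_eraseCoord_prodMk [IsProbabilityMeasure P] (hN : IsDrivingNoise P N)
    {m : ℕ} {ϑ : Ω → S} (hϑ : Measurable ϑ) (hind : IndepFun (fun ω => trunc m (N ω)) ϑ P)
    {l : NoiseIdx} (hl : l ∈ levelIdx m) :
    IndepFun (fun ω => N ω l) (fun ω => (eraseCoord m l (N ω), ϑ ω)) P :=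
  indepFun_prodMk_right_of_indepFun (hN.measurable l)
    ((measurable_eraseCoord m l).comp hN.measurable_noise) hϑ (hN.indepFun_eraseCoord m l)
    (indepFun_of_dependsOn hind (F := fun x => (x l, eraseCoord m l x))
      ((measurable_pi_apply l).prodMk (measurable_eraseCoord m l))
      (fun _ _ h => Prod.ext (h l hl) (dependsOn_eraseCoord m l h)) measurable_id)

/- Both sides are the integral of `F (update x l t, s)` against the product of the law of the
coordinate `l` and the joint law of the other coordinates and the parameter. -/
lemma IsDrivingNoise.integral_resample [IsProbabilityMeasure P] (hN : IsDrivingNoise P N) {m : ℕ}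
    {ϑ : Ω → S} (hϑ : Measurable ϑ) (hind : IndepFun (fun ω => trunc m (N ω)) ϑ P)
    {l : NoiseIdx} (hl : l ∈ expIdx m) {F : Noise × S → ℝ} (hF : Measurable F)
    (hdep : ∀ s, DependsOn (fun x => F (x, s)) (levelIdx m))
    (hint : Integrable (fun ω => F (N ω, ϑ ω)) P) :
    ∫ ω, F (N ω, ϑ ω) ∂P
      = ∫ ω, ∫ t, F (Function.update (N ω) l t, ϑ ω) ∂(expMeasure 1) ∂P := by
  set R : Ω → Noise × S := fun ω => (eraseCoord m l (N ω), ϑ ω)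
  set G : ℝ × (Noise × S) → ℝ := fun p => F (Function.update p.2.1 l p.1, p.2.2)
  have hR : Measurable R := ((measurable_eraseCoord m l).comp hN.measurable_noise).prodMk hϑ
  have hlR : Measurable (fun ω => (N ω l, R ω)) := (hN.measurable l).prodMk hR
  have hG : Measurable G := hF.comp (((measurable_update_prod l).comp
    (by fun_prop : Measurable fun p : ℝ × (Noise × S) => (p.2.1, p.1))).prodMk (by fun_prop))
  have hGF : ∀ t ω, G (t, R ω) = F (Function.update (N ω) l t, ϑ ω) := fun t ω =>
    hdep _ (update_eraseCoord _ _)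
  have hGN : ∀ ω, G (N ω l, R ω) = F (N ω, ϑ ω) := fun ω => by
    rw [hGF, Function.update_eq_self]
  have := Measure.isProbabilityMeasure_map (μ := P) hR.aemeasurable
  have hlaw : P.map (fun ω => (N ω l, R ω)) = (expMeasure 1).prod (P.map R) := by
    rw [← hN.map_eq_expMeasure hl]
    exact (indepFun_iff_map_prod_eq_prod_map_map (hN.measurable l).aemeasurable
      hR.aemeasurable).1 (hN.indepFun_eraseCoord_prodMk hϑ hind (expIdx_subset_levelIdx m hl))
  have hGint : Integrable G ((expMeasure 1).prod (P.map R)) := by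
    rw [← hlaw, integrable_map_measure hG.aestronglyMeasurable hlR.aemeasurable]
    exact hint.congr (Eventually.of_forall fun ω => (hGN ω).symm)
  calc ∫ ω, F (N ω, ϑ ω) ∂P = ∫ ω, G (N ω l, R ω) ∂P := by simp only [hGN]
    _ = ∫ p, G p ∂(P.map fun ω => (N ω l, R ω)) :=
        (integral_map hlR.aemeasurable hG.aestronglyMeasurable).symm
    _ = ∫ q, ∫ t, G (t, q) ∂(expMeasure 1) ∂(P.map R) := by
        rw [hlaw, integral_prod_symm _ hGint]
    _ = ∫ ω, ∫ t, G (t, R ω) ∂(expMeasure 1) ∂P :=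
        integral_map hR.aemeasurable
          hG.stronglyMeasurable.integral_prod_left'.aestronglyMeasurable
    _ = _ := by simp only [hGF]

/-- The moment `E[(1 + E)^r]` of an exponential variable of mean one. -/
def expMoment (r : ℕ) : ℝ := ∫ t, (1 + t) ^ r ∂(expMeasure 1)

lemma IsDrivingNoise.integrable_one_add_pow (hN : IsDrivingNoise P N) {m : ℕ} {l : NoiseIdx}
    (hl : l ∈ expIdx m) (r : ℕ) : Integrable (fun ω => (1 + N ω l) ^ r) P := by
  have h := integrable_add_pow_expMeasure one_pos 1 r
  rw [← hN.map_eq_expMeasure hl] at h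
  exact h.comp_measurable (hN.measurable l)

lemma IsDrivingNoise.integral_one_add_pow (hN : IsDrivingNoise P N) {m : ℕ} {l : NoiseIdx}
    (hl : l ∈ expIdx m) (r : ℕ) : ∫ ω, (1 + N ω l) ^ r ∂P = expMoment r := by
  rw [expMoment, ← hN.map_eq_expMeasure hl, integral_map (hN.measurable l).aemeasurable
    (by fun_prop)]

lemma IsDrivingNoise.integrable_noiseGauge_pow (hN : IsDrivingNoise P N) (m r : ℕ) :
    Integrable (fun ω => noiseGauge m (N ω) ^ r) P := by
  refine (((integrable_finsetSum (expIdx m) fun l hl => hN.integrable_one_add_pow hl r).const_mul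
    (((m : ℝ) + 2) ^ r))).mono'
    ((measurable_noiseGauge m).comp hN.measurable_noise |>.pow_const r).aestronglyMeasurable ?_
  filter_upwards [hN.ae_mem_noiseDomain m] with ω hω
  rw [Real.norm_of_nonneg (pow_nonneg (zero_le_one.trans (one_le_noiseGauge hω)) _)]
  exact noiseGauge_pow_le hω r

lemma IsDrivingNoise.integral_noiseGauge_pow_le (hN : IsDrivingNoise P N) (m r : ℕ) :
    ∫ ω, noiseGauge m (N ω) ^ r ∂P ≤ ((m : ℝ) + 2) ^ (r + 1) * expMoment r := by
  have hint := fun l (hl : l ∈ expIdx m) => hN.integrable_one_add_pow hl r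
  calc ∫ ω, noiseGauge m (N ω) ^ r ∂P
      ≤ ∫ ω, ((m : ℝ) + 2) ^ r * ∑ l ∈ expIdx m, (1 + N ω l) ^ r ∂P := by
        refine integral_mono_ae (hN.integrable_noiseGauge_pow m r)
          ((integrable_finsetSum _ hint).const_mul _) ?_
        filter_upwards [hN.ae_mem_noiseDomain m] with ω hω using noiseGauge_pow_le hω r
    _ = ((m : ℝ) + 2) ^ (r + 1) * expMoment r := by
        rw [integral_const_mul, integral_finsetSum _ hint,
          Finset.sum_congr rfl fun l hl => hN.integral_one_add_pow hl r]
        simp only [Finset.sum_const, card_expIdx, nsmul_eq_mul, Nat.cast_add, Nat.cast_ofNat]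
        ring

end Independence

section Adapted

variable {Ω S : Type*} [MeasurableSpace Ω] {P : Measure Ω} {N : Ω → Noise} {m : ℕ}
  {F G : Noise → S → ℝ}

/-- The function of the noise and of a parameter which agrees with `F` on the natural domain of
level `m` and vanishes elsewhere. -/
def zeroExtend (m : ℕ) (F : Noise → S → ℝ) : Noise × S → ℝ :=
  (noiseDomain m ×ˢ univ).indicator fun p => F p.1 p.2

lemma zeroExtend_of_mem {x : Noise} (hx : x ∈ noiseDomain m) (F : Noise → S → ℝ) (s : S) :
    zeroExtend m F (x, s) = F x s :=
  indicator_of_mem (s := noiseDomain m ×ˢ univ) ⟨hx, mem_univ s⟩ _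

lemma zeroExtend_of_notMem {x : Noise} (hx : x ∉ noiseDomain m) (F : Noise → S → ℝ) (s : S) :
    zeroExtend m F (x, s) = 0 :=
  indicator_of_notMem (s := noiseDomain m ×ˢ univ) (fun h => hx h.1) _

lemma zeroExtend_ae_eq (hN : IsDrivingNoise P N) (m : ℕ) (F : Noise → S → ℝ)
    (ϑ : Ω → S) : (fun ω => zeroExtend m F (N ω, ϑ ω)) =ᵐ[P] fun ω => F (N ω) (ϑ ω) := by
  filter_upwards [hN.ae_mem_noiseDomain m] with ω hω using zeroExtend_of_mem hω F _

variable [MeasurableSpace S]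

lemma measurableSet_noiseDomain_prod (m : ℕ) :
    MeasurableSet (noiseDomain m ×ˢ (univ : Set S)) :=
  (measurableSet_noiseDomain m).prod MeasurableSet.univ

/-- Functions of the noise of level `m` and of a parameter, jointly measurable. Nothing is asked
outside the natural domain, where the functions of interest take junk values. -/
structure IsAdapted (m : ℕ) (F : Noise → S → ℝ) : Prop where
  measurable : Measurable (zeroExtend m F)
  eq_of_level_eq : ∀ x ∈ noiseDomain m, ∀ y s, (∀ k ∈ levelIdx m, x k = y k) → F x s = F y s

namespace IsAdapted

lemma of_measurable (hF : Measurable fun p : Noise × S => F p.1 p.2)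
    (hdep : ∀ x ∈ noiseDomain m, ∀ y s, (∀ k ∈ levelIdx m, x k = y k) → F x s = F y s) :
    IsAdapted m F :=
  ⟨hF.indicator (measurableSet_noiseDomain_prod m), hdep⟩

lemma add (hF : IsAdapted m F) (hG : IsAdapted m G) : IsAdapted m (fun x s => F x s + G x s) where
  measurable := by
    rw [zeroExtend, indicator_add]
    exact hF.measurable.add hG.measurable
  eq_of_level_eq x hx y s h := by rw [hF.eq_of_level_eq x hx y s h, hG.eq_of_level_eq x hx y s h]

lemma mul (hF : IsAdapted m F) (hG : IsAdapted m G) : IsAdapted m (fun x s => F x s * G x s) where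
  measurable := by
    rw [zeroExtend, indicator_mul]
    exact hF.measurable.mul hG.measurable
  eq_of_level_eq x hx y s h := by rw [hF.eq_of_level_eq x hx y s h, hG.eq_of_level_eq x hx y s h]

lemma const (m : ℕ) (c : ℝ) : IsAdapted m (fun _ (_ : S) => c) :=
  .of_measurable measurable_const fun _ _ _ _ _ => rfl

lemma sum {ι : Type*} {s : Finset ι} {F : ι → Noise → S → ℝ}
    (hF : ∀ i ∈ s, IsAdapted m (F i)) : IsAdapted m (fun x t => ∑ i ∈ s, F i x t) := by
  classical
  induction s using Finset.induction_on with
  | empty => simpa using IsAdapted.const m 0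
  | insert a s ha ih =>
    simp only [Finset.sum_insert ha]
    exact (hF a (by simp)).add (ih fun i hi => hF i (by simp [hi]))

lemma congr (hF : IsAdapted m F) (h : ∀ x ∈ noiseDomain m, ∀ s, F x s = G x s) :
    IsAdapted m G where
  measurable := by
    have hext : zeroExtend m G = zeroExtend m F :=
      indicator_congr fun p hp => (h p.1 hp.1 p.2).symm
    exact hext ▸ hF.measurable
  eq_of_level_eq x hx y s hxy := by
    rw [← h x hx, ← h y ((mem_noiseDomain_congr hxy).1 hx), hF.eq_of_level_eq x hx y s hxy]

lemma coord {l : NoiseIdx} (hl : l ∈ levelIdx m) : IsAdapted m (fun x (_ : S) => x l) :=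
  .of_measurable (by fun_prop) fun _ _ _ _ h => h l hl

lemma dependsOn_zeroExtend (hF : IsAdapted m F) (s : S) :
    DependsOn (fun x => zeroExtend m F (x, s)) (levelIdx m) := by
  intro x y h
  by_cases hx : x ∈ noiseDomain m
  · simp only [zeroExtend_of_mem hx, zeroExtend_of_mem ((mem_noiseDomain_congr h).1 hx)]
    exact hF.eq_of_level_eq x hx y s h
  · simp only [zeroExtend_of_notMem hx,
      zeroExtend_of_notMem fun hy => hx ((mem_noiseDomain_congr h).2 hy)]

/- The partial derivative is the limit of the difference quotients with increments `1 / (n + 1)`;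
positive increments keep the point in the natural domain. -/
lemma measurable_zeroExtend_pderiv (hF : IsAdapted m F) {l : NoiseIdx} (hl : l ∈ expIdx m)
    (hd : ∀ x ∈ noiseDomain m, ∀ s,
      DifferentiableAt ℝ (fun t => F (Function.update x l t) s) (x l)) :
    Measurable (zeroExtend m fun x s => pderiv l (fun y => F y s) x) := by
  have hshift : ∀ n : ℕ, Measurable fun p : Noise × S =>
      (Function.update p.1 l (p.1 l + ((n : ℝ) + 1)⁻¹), p.2) := fun n =>
    ((measurable_update_prod l).comp (by fun_prop : Measurable fun p : Noise × S =>
      (p.1, p.1 l + ((n : ℝ) + 1)⁻¹))).prodMk measurable_snd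
  have hincr : Tendsto (fun n : ℕ => ((n : ℝ) + 1)⁻¹) atTop (𝓝[≠] 0) := by
    refine tendsto_nhdsWithin_iff.2 ⟨?_, Eventually.of_forall fun n => ?_⟩
    · simpa using tendsto_one_div_add_atTop_nhds_zero_nat (𝕜 := ℝ)
    · simp only [mem_compl_iff, mem_singleton_iff]
      positivity
  refine measurable_of_tendsto_metrizable (f := fun (n : ℕ) =>
    (noiseDomain m ×ˢ univ).indicator fun p : Noise × S => (((n : ℝ) + 1)⁻¹)⁻¹ *
      (zeroExtend m F (Function.update p.1 l (p.1 l + ((n : ℝ) + 1)⁻¹), p.2) - zeroExtend m F p))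
    (fun n => (((hF.measurable.comp (hshift n)).sub hF.measurable).const_mul _).indicator
      (measurableSet_noiseDomain_prod m)) (tendsto_pi_nhds.2 ?_)
  rintro ⟨x, s⟩
  by_cases hx : x ∈ noiseDomain m
  · have hxs : (x, s) ∈ noiseDomain m ×ˢ (univ : Set S) := ⟨hx, mem_univ _⟩
    rw [zeroExtend_of_mem hx]
    refine (((hd x hx s).hasDerivAt.tendsto_slope_zero).comp hincr).congr fun n => ?_
    have hx' : Function.update x l (x l + ((n : ℝ) + 1)⁻¹) ∈ noiseDomain m :=
      update_mem_noiseDomain hx hl (add_pos (pos_of_mem_noiseDomain hx hl) (by positivity))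
    simp only [Function.comp_apply, indicator_of_mem hxs, zeroExtend_of_mem hx,
      zeroExtend_of_mem hx', smul_eq_mul, Function.update_eq_self]
  · have hxs : (x, s) ∉ noiseDomain m ×ˢ (univ : Set S) := fun h => hx h.1
    simp only [zeroExtend_of_notMem hx, indicator_of_notMem hxs]
    exact tendsto_const_nhds

lemma pderiv (hF : IsAdapted m F) {l : NoiseIdx} (hl : l ∈ expIdx m)
    (hd : ∀ x ∈ noiseDomain m, ∀ s,
      DifferentiableAt ℝ (fun t => F (Function.update x l t) s) (x l)) :
    IsAdapted m (fun x s => pderiv l (fun y => F y s) x) where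
  measurable := hF.measurable_zeroExtend_pderiv hl hd
  eq_of_level_eq x hx y s h := by
    rw [pderiv_eq, pderiv_eq, ← h l (expIdx_subset_levelIdx m hl)]
    exact EventuallyEq.deriv_eq ((eventually_update_mem_noiseDomain hx hl).mono fun t ht =>
      hF.eq_of_level_eq _ ht _ _ (update_congr h l t))

end IsAdapted

/-- The standing assumptions on an extra source of randomness `ϑ`: it is independent of the noise
of level `m`, and `C` is a nonnegative function of it, used to bound functions of `ϑ`, with finite
expectation. -/
structure IsControlledParam (P : Measure Ω) (N : Ω → Noise) (m : ℕ) (ϑ : Ω → S) (C : S → ℝ) :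
    Prop where
  measurable : Measurable ϑ
  indep : IndepFun (fun ω => trunc m (N ω)) ϑ P
  measurable_bound : Measurable C
  bound_nonneg : ∀ s, 0 ≤ C s
  integrable_bound : Integrable (fun ω => C (ϑ ω)) P

variable {ϑ : Ω → S} {C : S → ℝ}

lemma IsAdapted.aestronglyMeasurable (hF : IsAdapted m F) (hN : IsDrivingNoise P N)
    (hϑ : Measurable ϑ) : AEStronglyMeasurable (fun ω => F (N ω) (ϑ ω)) P :=
  (hF.measurable.comp (hN.measurable_noise.prodMk hϑ)).aestronglyMeasurable.congr
    (zeroExtend_ae_eq hN m F ϑ)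

lemma IsControlledParam.integrable_noiseGauge_pow_mul (hϑ : IsControlledParam P N m ϑ C)
    (hN : IsDrivingNoise P N) (r : ℕ) :
    Integrable (fun ω => noiseGauge m (N ω) ^ r * C (ϑ ω)) P :=
  (indepFun_of_dependsOn hϑ.indep ((measurable_noiseGauge m).pow_const r)
    (fun _ _ h => by rw [dependsOn_noiseGauge m h]) hϑ.measurable_bound).integrable_mul
    (hN.integrable_noiseGauge_pow m r) hϑ.integrable_bound

/-- The function `F` is adapted and bounded by `K * noiseGauge m ^ r * C`. -/
structure IsDominated (m : ℕ) (C : S → ℝ) (K : ℝ) (r : ℕ) (F : Noise → S → ℝ) : Prop where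
  isAdapted : IsAdapted m F
  abs_apply_le : ∀ x ∈ noiseDomain m, ∀ s, |F x s| ≤ K * noiseGauge m x ^ r * C s

namespace IsDominated

variable {K K' : ℝ} {r r' : ℕ}

lemma integrable (hF : IsDominated m C K r F) (hN : IsDrivingNoise P N)
    (hϑ : IsControlledParam P N m ϑ C) : Integrable (fun ω => F (N ω) (ϑ ω)) P := by
  refine ((hϑ.integrable_noiseGauge_pow_mul hN r).const_mul K).mono'
    (hF.isAdapted.aestronglyMeasurable hN hϑ.measurable) ?_
  filter_upwards [hN.ae_mem_noiseDomain m] with ω hω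
  exact (hF.abs_apply_le _ hω _).trans_eq (by ring)

lemma integral_resample [IsProbabilityMeasure P] (hF : IsDominated m C K r F)
    (hN : IsDrivingNoise P N) (hϑ : IsControlledParam P N m ϑ C) {l : NoiseIdx}
    (hl : l ∈ expIdx m) :
    ∫ ω, F (N ω) (ϑ ω) ∂P
      = ∫ ω, ∫ t, F (Function.update (N ω) l t) (ϑ ω) ∂(expMeasure 1) ∂P := by
  have hext := zeroExtend_ae_eq hN m F ϑ
  rw [← integral_congr_ae hext, hN.integral_resample hϑ.measurable hϑ.indep hl
    hF.isAdapted.measurable hF.isAdapted.dependsOn_zeroExtend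
    ((hF.integrable hN hϑ).congr hext.symm)]
  refine integral_congr_ae ?_
  filter_upwards [hN.ae_mem_noiseDomain m] with ω hω
  refine integral_congr_ae ?_
  filter_upwards [ae_pos_expMeasure 1] with t ht
  exact zeroExtend_of_mem (update_mem_noiseDomain hω hl ht) _ _

lemma congr (hF : IsDominated m C K r F) (h : ∀ x ∈ noiseDomain m, ∀ s, F x s = G x s) :
    IsDominated m C K r G :=
  ⟨hF.isAdapted.congr h, fun x hx s => by rw [← h x hx s]; exact hF.abs_apply_le x hx s⟩

lemma mono (hF : IsDominated m C K r F) (hC : ∀ s, 0 ≤ C s) (hK' : 0 ≤ K') (hK : K ≤ K')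
    (hr : r ≤ r') : IsDominated m C K' r' F :=
  ⟨hF.isAdapted, fun x hx s => (hF.abs_apply_le x hx s).trans <| by
    have hg := one_le_noiseGauge hx
    have hCs := hC s
    gcongr⟩

lemma add (hF : IsDominated m C K r F) (hG : IsDominated m C K' r G) :
    IsDominated m C (K + K') r (fun x s => F x s + G x s) :=
  ⟨hF.isAdapted.add hG.isAdapted, fun x hx s => (abs_add_le _ _).trans
    ((add_le_add (hF.abs_apply_le x hx s) (hG.abs_apply_le x hx s)).trans_eq (by ring))⟩

lemma const_mul (hF : IsDominated m C K r F) (c : ℝ) :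
    IsDominated m C (|c| * K) r (fun x s => c * F x s) :=
  ⟨(IsAdapted.const m c).mul hF.isAdapted, fun x hx s => by
    rw [abs_mul]
    exact (mul_le_mul_of_nonneg_left (hF.abs_apply_le x hx s) (abs_nonneg c)).trans_eq (by ring)⟩

lemma mul (hK : 0 ≤ K) (hG : IsDominated m (fun _ => 1) K r G)
    (hF : IsDominated m C K' r' F) :
    IsDominated m C (K * K') (r + r') (fun x s => G x s * F x s) := by
  refine ⟨hG.isAdapted.mul hF.isAdapted, fun x hx s => ?_⟩
  have hg := one_le_noiseGauge hx
  rw [abs_mul]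
  calc |G x s| * |F x s|
      ≤ (K * noiseGauge m x ^ r * 1) * (K' * noiseGauge m x ^ r' * C s) :=
        mul_le_mul (hG.abs_apply_le x hx s) (hF.abs_apply_le x hx s) (abs_nonneg _) (by positivity)
    _ = K * K' * noiseGauge m x ^ (r + r') * C s := by ring

lemma sum {ψ : NoiseIdx → Noise → S → ℝ} (hC : ∀ s, 0 ≤ C s) (hK : 0 ≤ K)
    (h : ∀ l ∈ expIdx m, IsDominated m C K r (ψ l)) :
    IsDominated m C K (r + 1) (fun x s => ∑ l ∈ expIdx m, ψ l x s) := by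
  refine ⟨IsAdapted.sum fun l hl => (h l hl).isAdapted, fun x hx s => ?_⟩
  have hg := one_le_noiseGauge hx
  have hCs := hC s
  calc |∑ l ∈ expIdx m, ψ l x s| ≤ ∑ l ∈ expIdx m, |ψ l x s| := Finset.abs_sum_le_sum_abs _ _
    _ ≤ ∑ _l ∈ expIdx m, K * noiseGauge m x ^ r * C s :=
        Finset.sum_le_sum fun l hl => (h l hl).abs_apply_le x hx s
    _ = ((m : ℝ) + 2) * (K * noiseGauge m x ^ r * C s) := by
        simp only [Finset.sum_const, card_expIdx, nsmul_eq_mul, Nat.cast_add, Nat.cast_ofNat]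
    _ ≤ noiseGauge m x * (K * noiseGauge m x ^ r * C s) := by
        gcongr
        exact add_two_le_noiseGauge hx
    _ = K * noiseGauge m x ^ (r + 1) * C s := by ring

lemma coord {l : NoiseIdx} (hl : l ∈ expIdx m) :
    IsDominated m (fun _ : S => 1) 1 1 (fun x _ => x l) :=
  ⟨IsAdapted.coord (expIdx_subset_levelIdx m hl), fun x hx _ => by
    have hpos := pos_of_mem_noiseDomain hx hl
    rw [abs_of_pos hpos]
    linarith [one_add_le_noiseGauge hx hl]⟩

lemma const {c : ℝ} (hc : |c| ≤ K) : IsDominated m (fun _ : S => 1) K 0 (fun _ _ => c) :=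
  ⟨IsAdapted.const m c, fun _ _ _ => by simpa using hc⟩

lemma coord_sub_one_mul (hF : IsDominated m C K r F) {l : NoiseIdx} (hl : l ∈ expIdx m) :
    IsDominated m C K (r + 1) (fun x s => (x l - 1) * F x s) := by
  refine ⟨?_, fun x hx s => ?_⟩
  · simpa only [sub_eq_add_neg] using
      ((IsAdapted.coord (expIdx_subset_levelIdx m hl)).add (IsAdapted.const m (-1))).mul
        hF.isAdapted
  have hle : |x l - 1| ≤ noiseGauge m x := abs_le.2 ⟨by
    linarith [one_le_noiseGauge hx, pos_of_mem_noiseDomain hx hl], by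
    linarith [one_add_le_noiseGauge hx hl]⟩
  calc |(x l - 1) * F x s| = |x l - 1| * |F x s| := abs_mul _ _
    _ ≤ noiseGauge m x * (K * noiseGauge m x ^ r * C s) :=
        mul_le_mul hle (hF.abs_apply_le x hx s) (abs_nonneg _)
          (zero_le_one.trans (one_le_noiseGauge hx))
    _ = K * noiseGauge m x ^ (r + 1) * C s := by ring

lemma integral_mul_pderiv [IsProbabilityMeasure P] (hF : IsDominated m C K r F)
    (hN : IsDrivingNoise P N) (hϑ : IsControlledParam P N m ϑ C) {l : NoiseIdx}
    (hl : l ∈ expIdx m)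
    (hd : ∀ x ∈ noiseDomain m, ∀ s,
      DifferentiableAt ℝ (fun t => F (Function.update x l t) s) (x l))
    (hF' : ∀ x ∈ noiseDomain m, ∀ s,
      |x l * pderiv l (fun y => F y s) x| ≤ K * noiseGauge m x ^ r * C s) :
    ∫ ω, N ω l * pderiv l (fun y => F y (ϑ ω)) (N ω) ∂P
      = ∫ ω, (N ω l - 1) * F (N ω) (ϑ ω) ∂P := by
  have hderiv : IsDominated m C K r (fun x s => x l * pderiv l (fun y => F y s) x) :=
    ⟨(IsAdapted.coord (expIdx_subset_levelIdx m hl)).mul (hF.isAdapted.pderiv hl hd), hF'⟩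
  rw [hderiv.integral_resample hN hϑ hl, (hF.coord_sub_one_mul hl).integral_resample hN hϑ hl]
  refine integral_congr_ae ?_
  filter_upwards [hN.ae_mem_noiseDomain m] with ω hω
  have hgauge : ∀ t, K * noiseGauge m (Function.update (N ω) l t) ^ r * C (ϑ ω)
      = K * C (ϑ ω) * (noiseGauge m (N ω) - N ω l + t) ^ r := fun t => by
    rw [noiseGauge_update _ hl]
    ring
  have hparts := integral_mul_deriv_expMeasure_of_le_pow one_pos
    (F := fun t => F (Function.update (N ω) l t) (ϑ ω)) (K := K * C (ϑ ω))
    (fun t ht => by simpa using hd _ (update_mem_noiseDomain hω hl ht) (ϑ ω))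
    (fun t ht => (hF.abs_apply_le _ (update_mem_noiseDomain hω hl ht) (ϑ ω)).trans_eq (hgauge t))
    (fun t ht => by
      have hle := hF' _ (update_mem_noiseDomain hω hl ht) (ϑ ω)
      rw [hgauge, pderiv_eq] at hle
      simpa only [Function.update_self, Function.update_idem] using hle)
  simpa only [pderiv_eq, Function.update_self, Function.update_idem, one_mul] using hparts

end IsDominated

end Adapted

section Regular

variable {S : Type*} [MeasurableSpace S] {m : ℕ} {C : S → ℝ} {K K' : ℝ} {r r' k : ℕ}
  {F G : Noise → S → ℝ}

/-- The function `F` is partially differentiable up to order `k` in the exponential variables of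
level `m`, and these derivatives are adapted and bounded by `K * noiseGauge m ^ r * C`. -/
def IsRegular (m : ℕ) (C : S → ℝ) (K : ℝ) (r : ℕ) : ℕ → (Noise → S → ℝ) → Prop
  | 0, F => IsDominated m C K r F
  | k + 1, F => IsDominated m C K r F ∧ ∀ l ∈ expIdx m,
      (∀ x ∈ noiseDomain m, ∀ s,
        DifferentiableAt ℝ (fun t => F (Function.update x l t) s) (x l)) ∧
      IsRegular m C K r k (fun x s => pderiv l (fun y => F y s) x)

namespace IsRegular

lemma isDominated (hF : IsRegular m C K r k F) : IsDominated m C K r F := by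
  cases k with
  | zero => exact hF
  | succ k => exact hF.1

lemma of_succ (hF : IsRegular m C K r (k + 1) F) : IsRegular m C K r k F := by
  induction k generalizing F with
  | zero => exact hF.1
  | succ k ih => exact ⟨hF.1, fun l hl => ⟨(hF.2 l hl).1, ih (hF.2 l hl).2⟩⟩

lemma congr (hF : IsRegular m C K r k F) (h : ∀ x ∈ noiseDomain m, ∀ s, F x s = G x s) :
    IsRegular m C K r k G := by
  induction k generalizing F G with
  | zero => exact IsDominated.congr hF h
  | succ k ih =>
    refine ⟨hF.1.congr h, fun l hl => ⟨fun x hx s => ?_, ih (hF.2 l hl).2 fun x hx s => ?_⟩⟩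
    · exact ((hF.2 l hl).1 x hx s).congr_of_eventuallyEq
        ((eventually_update_mem_noiseDomain hx hl).mono fun t ht => (h _ ht s).symm)
    · exact pderiv_congr hx hl fun y hy => h y hy s

lemma mono (hF : IsRegular m C K r k F) (hC : ∀ s, 0 ≤ C s) (hK' : 0 ≤ K') (hK : K ≤ K')
    (hr : r ≤ r') : IsRegular m C K' r' k F := by
  induction k generalizing F with
  | zero => exact IsDominated.mono hF hC hK' hK hr
  | succ k ih =>
    exact ⟨hF.1.mono hC hK' hK hr, fun l hl => ⟨(hF.2 l hl).1, ih (hF.2 l hl).2⟩⟩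

lemma add (hF : IsRegular m C K r k F) (hG : IsRegular m C K' r k G) :
    IsRegular m C (K + K') r k (fun x s => F x s + G x s) := by
  induction k generalizing F G with
  | zero => exact IsDominated.add hF hG
  | succ k ih =>
    refine ⟨hF.1.add hG.1, fun l hl => ⟨fun x hx s =>
      ((hF.2 l hl).1 x hx s).add ((hG.2 l hl).1 x hx s),
      (ih (hF.2 l hl).2 (hG.2 l hl).2).congr fun x hx s => ?_⟩⟩
    exact (deriv_fun_add ((hF.2 l hl).1 x hx s) ((hG.2 l hl).1 x hx s)).symm

lemma const_mul (hF : IsRegular m C K r k F) (c : ℝ) :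
    IsRegular m C (|c| * K) r k (fun x s => c * F x s) := by
  induction k generalizing F with
  | zero => exact IsDominated.const_mul hF c
  | succ k ih =>
    refine ⟨hF.1.const_mul c, fun l hl => ⟨fun x hx s => ((hF.2 l hl).1 x hx s).const_mul c,
      (ih (hF.2 l hl).2).congr fun x hx s => ?_⟩⟩
    exact (deriv_const_mul c ((hF.2 l hl).1 x hx s)).symm

/- By the product rule, each derivative doubles the number of terms, whence the factor `2 ^ k`. -/
lemma mul (hC : ∀ s, 0 ≤ C s) (hK : 0 ≤ K) (hK' : 0 ≤ K')
    (hG : IsRegular m (fun _ => 1) K r k G) (hF : IsRegular m C K' r' k F) :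
    IsRegular m C (2 ^ k * K * K') (r + r') k (fun x s => G x s * F x s) := by
  induction k generalizing F G with
  | zero => simpa only [pow_zero, one_mul, IsRegular] using IsDominated.mul hK hG hF
  | succ k ih =>
    have hconst : K * K' ≤ 2 ^ (k + 1) * K * K' := by
      rw [mul_assoc]
      exact le_mul_of_one_le_left (by positivity) (one_le_pow₀ one_le_two)
    refine ⟨(IsDominated.mul hK hG.1 hF.1).mono hC (by positivity) hconst le_rfl,
      fun l hl => ⟨fun x hx s => ((hG.2 l hl).1 x hx s).mul ((hF.2 l hl).1 x hx s), ?_⟩⟩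
    rw [show (2 : ℝ) ^ (k + 1) * K * K' = 2 ^ k * K * K' + 2 ^ k * K * K' by ring]
    refine ((ih (hG.2 l hl).2 hF.of_succ).add (ih hG.of_succ (hF.2 l hl).2)).congr
      fun x hx s => ?_
    have hprod := deriv_fun_mul ((hG.2 l hl).1 x hx s) ((hF.2 l hl).1 x hx s)
    simp only [Function.update_eq_self] at hprod
    exact hprod.symm

lemma sum {F : NoiseIdx → Noise → S → ℝ} (hC : ∀ s, 0 ≤ C s) (hK : 0 ≤ K)
    (hF : ∀ i ∈ expIdx m, IsRegular m C K r k (F i)) :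
    IsRegular m C K (r + 1) k (fun x s => ∑ i ∈ expIdx m, F i x s) := by
  induction k generalizing F with
  | zero => exact IsDominated.sum hC hK hF
  | succ k ih =>
    refine ⟨.sum hC hK fun i hi => (hF i hi).1, fun l hl => ⟨fun x hx s =>
      DifferentiableAt.fun_sum fun i hi => ((hF i hi).2 l hl).1 x hx s,
      (ih fun i hi => ((hF i hi).2 l hl).2).congr fun x hx s => ?_⟩⟩
    exact (deriv_fun_sum fun i hi => ((hF i hi).2 l hl).1 x hx s).symm

lemma zero (hK : 0 ≤ K) (k : ℕ) : IsRegular m (fun _ : S => 1) K 0 k (fun _ _ => 0) := by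
  have hdom : IsDominated m (fun _ : S => 1) K 0 (fun _ _ => 0) := .const (by simpa)
  induction k with
  | zero => exact hdom
  | succ k ih => exact ⟨hdom, fun l _ => ⟨by simp, by simpa only [pderiv_eq, deriv_const] using ih⟩⟩

lemma of_update_eq (hF : IsDominated m (fun _ => 1) K 0 F) (hK : 0 ≤ K)
    (h : ∀ l ∈ expIdx m, ∀ x t s, F (Function.update x l t) s = F x s) (k : ℕ) :
    IsRegular m (fun _ => 1) K 0 k F := by
  cases k with
  | zero => exact hF
  | succ k =>
    exact ⟨hF, fun l hl => ⟨fun x _ s => by simp [h l hl],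
      (IsRegular.zero hK k).congr fun x _ s => by simp [pderiv_eq, h l hl]⟩⟩

lemma const {c : ℝ} (hc : |c| ≤ K) (k : ℕ) :
    IsRegular m (fun _ : S => 1) K 0 k (fun _ _ => c) :=
  .of_update_eq (.const hc) ((abs_nonneg c).trans hc) (fun _ _ _ _ _ => rfl) k

lemma coord {l : NoiseIdx} (hl : l ∈ expIdx m) (k : ℕ) :
    IsRegular m (fun _ : S => 1) 1 1 k (fun x _ => x l) := by
  have hdom : IsDominated m (fun _ : S => 1) 1 1 (fun x _ => x l) := .coord hl
  cases k with
  | zero => exact hdom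
  | succ k =>
    refine ⟨hdom, fun l' _ => ?_⟩
    rcases eq_or_ne l l' with rfl | hne
    · exact ⟨by simp, ((IsRegular.const (c := 1) (by simp) k).mono (by simp) zero_le_one le_rfl
        zero_le_one).congr (by simp [pderiv_eq])⟩
    · exact ⟨by simp [hne], ((IsRegular.zero zero_le_one k).mono (by simp) zero_le_one le_rfl
        zero_le_one).congr (by simp [pderiv_eq, hne])⟩

end IsRegular

end Regular

section Weights

variable {S : Type*} [MeasurableSpace S] {m : ℕ} {C : S → ℝ} (α ρ : ℝ)

/-- The coefficient, `0` or `1`, with which the logarithmic derivative in the exponential variable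
`l` enters the operator `opD`. -/
def activeInd (σ : PM) (x : Noise) : NoiseIdx → ℝ
  | .E i => sgnInd α ρ σ x i
  | .eta σ' => if σ' = σ then 1 else 0
  | _ => 0

lemma opD_eq (m : ℕ) (σ : PM) (ψ : Noise → ℝ) (x : Noise) :
    opD α ρ m σ ψ x = ∑ l ∈ expIdx m, x l * activeInd α ρ σ x l * pderiv l ψ x := by
  rw [sum_expIdx, opD]
  cases σ <;> simp [activeInd]

lemma abs_activeInd_le_one (σ : PM) (x : Noise) (l : NoiseIdx) : |activeInd α ρ σ x l| ≤ 1 := by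
  have hite : ∀ (p : Prop) (_ : Decidable p), |if p then (1 : ℝ) else 0| ≤ 1 := fun p _ => by
    split_ifs <;> simp
  rcases l with i | i | i | σ'
  exacts [hite _ _, by simp [activeInd], by simp [activeInd], hite _ _]

lemma measurable_cms : Measurable (cms α ρ) := by
  unfold cms
  fun_prop

lemma measurable_part (σ : PM) : Measurable (part σ) := by
  cases σ
  · exact measurable_id.max measurable_const
  · exact measurable_neg.max measurable_const

lemma measurable_activeInd (σ : PM) (l : NoiseIdx) :
    Measurable fun x => activeInd α ρ σ x l := by
  classical
  rcases l with _ | _ | _ | _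
  · exact Measurable.ite (measurableSet_lt measurable_const ((measurable_part σ).comp
      ((measurable_cms α ρ).comp (measurable_pi_apply _)))) measurable_const measurable_const
  all_goals exact measurable_const

lemma activeInd_congr (σ : PM) {x y : Noise} {l : NoiseIdx}
    (h : ∀ i, l = .E i → x (.V i) = y (.V i)) : activeInd α ρ σ x l = activeInd α ρ σ y l := by
  rcases l with i | i | i | σ'
  · have hangular : angular α ρ x i = angular α ρ y i := by rw [angular, angular, h i rfl]
    simp only [activeInd, sgnInd, hangular]
  all_goals rfl

lemma activeInd_update (σ : PM) (x : Noise) {l : NoiseIdx} (hl : l ∈ expIdx m) (t : ℝ)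
    (l' : NoiseIdx) : activeInd α ρ σ (Function.update x l t) l' = activeInd α ρ σ x l' :=
  activeInd_congr α ρ σ fun i _ => Function.update_of_ne (by rintro rfl; simp at hl) _ _

lemma isRegular_activeInd (σ : PM) {l : NoiseIdx} (hl : l ∈ expIdx m) (k : ℕ) :
    IsRegular m (fun _ : S => 1) 1 0 k (fun x _ => activeInd α ρ σ x l) := by
  have hmeas : Measurable fun p : Noise × S => activeInd α ρ σ p.1 l :=
    (measurable_activeInd α ρ σ l).comp measurable_fst
  have hadapted : IsAdapted m (fun x (_ : S) => activeInd α ρ σ x l) :=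
    .of_measurable hmeas fun x _ y _ h => activeInd_congr α ρ σ <| by
      rintro i rfl
      exact h _ (by simpa using hl)
  exact .of_update_eq ⟨hadapted, fun x _ _ => by simpa using abs_activeInd_le_one α ρ σ x l⟩
    zero_le_one (fun l' hl' x t _ => activeInd_update α ρ σ x hl' t l) k

lemma isRegular_opD (hC : ∀ s, 0 ≤ C s) {K : ℝ} (hK : 0 ≤ K) {r k : ℕ} {F : Noise → S → ℝ}
    (hF : IsRegular m C K r (k + 1) F) (σ : PM) :
    IsRegular m C (4 ^ k * K) (r + 2) k (fun x s => opD α ρ m σ (fun y => F y s) x) := by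
  simp only [opD_eq]
  refine IsRegular.sum (r := r + 1) hC (by positivity) fun l hl => ?_
  have hcoeff := IsRegular.mul (S := S) (fun _ => zero_le_one) zero_le_one zero_le_one
    (.coord hl k) (isRegular_activeInd α ρ σ hl k)
  have hconst : (4 : ℝ) ^ k * K = 2 ^ k * (2 ^ k * 1 * 1) * K := by
    rw [show (4 : ℝ) = 2 * 2 by norm_num, mul_pow]
    ring
  rw [hconst, add_comm r]
  exact hcoeff.mul hC (by positivity) hK (hF.2 l hl).2

/-- The first-order coefficient `η_± - 1/α + ∑ (E_i - 1) 1_{[G_i]^± > 0}` of `opH`. -/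
def multiplier (m : ℕ) (σ : PM) (x : Noise) : ℝ :=
  x (.eta σ) - 1 / α + ∑ i ∈ Finset.range m, (x (.E i) - 1) * sgnInd α ρ σ x i

lemma multiplier_eq (m : ℕ) (σ : PM) (x : Noise) :
    multiplier α ρ m σ x = (1 - 1 / α) + ∑ l ∈ expIdx m, (x l - 1) * activeInd α ρ σ x l := by
  rw [sum_expIdx, multiplier]
  cases σ <;> simp only [activeInd, reduceCtorEq, ↓reduceIte] <;> ring

/-- The weight operator `opH` without its factor `1 / X_±`, conjugated by `X_± ^ (-j)`:
`H (X_± ^ (-j) ψ) = X_± ^ (-(j + 1)) coreH j ψ`. -/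
def coreH (m : ℕ) (σ : PM) (j : ℕ) (ψ : Noise → ℝ) (x : Noise) : ℝ :=
  α / (α - 1) * ((multiplier α ρ m σ x + j * (1 - 1 / α)) * ψ x - opD α ρ m σ ψ x)

/-- The factor by which `coreH` enlarges the bounds on the derivatives of order at most `k`. -/
def coreConst (α : ℝ) (k j : ℕ) : ℝ :=
  |α / (α - 1)| * (2 ^ k * (2 ^ k * 2 + |(1 - 1 / α) + j * (1 - 1 / α)|) + 4 ^ k)

lemma coreConst_nonneg (k j : ℕ) : 0 ≤ coreConst α k j := by
  unfold coreConst
  positivity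

lemma isRegular_multiplier_add (σ : PM) (k j : ℕ) :
    IsRegular m (fun _ : S => 1) (2 ^ k * 2 + |(1 - 1 / α) + j * (1 - 1 / α)|) 2 k
      (fun x _ => multiplier α ρ m σ x + j * (1 - 1 / α)) := by
  have hsub : ∀ l ∈ expIdx m, IsRegular m (fun _ : S => 1) 2 1 k (fun x _ => x l - 1) :=
    fun l hl => by
      simpa only [one_add_one_eq_two, sub_eq_add_neg] using
        (IsRegular.coord (S := S) hl k).add ((IsRegular.const (m := m) (S := S) (c := -1)
          (K := 1) (by simp) k).mono (by simp) zero_le_one le_rfl zero_le_one)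
  have hterm : ∀ l ∈ expIdx m, IsRegular m (fun _ : S => 1) (2 ^ k * 2) 1 k
      (fun x _ => (x l - 1) * activeInd α ρ σ x l) := fun l hl => by
    simpa only [mul_one] using (hsub l hl).mul (fun _ => zero_le_one) zero_le_two zero_le_one
      (isRegular_activeInd α ρ σ hl k)
  refine ((IsRegular.sum (fun _ => zero_le_one) (by positivity) hterm).add
    ((IsRegular.const (m := m) (S := S) le_rfl k).mono (by simp) (abs_nonneg _) le_rfl
      zero_le_two)).congr fun x _ _ => ?_
  rw [multiplier_eq]
  ring

lemma isRegular_coreH (hC : ∀ s, 0 ≤ C s) {K : ℝ} (hK : 0 ≤ K) {r k : ℕ} {F : Noise → S → ℝ}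
    (hF : IsRegular m C K r (k + 1) F) (σ : PM) (j : ℕ) :
    IsRegular m C (coreConst α k j * K) (r + 2) k
      (fun x s => coreH α ρ m σ j (fun y => F y s) x) := by
  have hmul := (isRegular_multiplier_add α ρ σ k j).mul hC (by positivity) hK hF.of_succ
  have hopD := (isRegular_opD α ρ hC hK hF σ).const_mul (-1)
  rw [add_comm 2 r] at hmul
  have hcore := (hmul.add hopD).const_mul (α / (α - 1))
  rw [abs_neg, abs_one, one_mul] at hcore
  rw [coreConst, mul_assoc, add_mul]
  exact hcore.congr fun x _ s => by rw [coreH, neg_one_mul, ← sub_eq_add_neg]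

end Weights

section Representation

variable {S : Type*} [MeasurableSpace S] {m : ℕ} {C : S → ℝ}

/-- The direction in `Coord m` in which the variable `l` varies. -/
def coordDir (m : ℕ) (l : NoiseIdx) : Coord m := trunc m (Pi.single l 1)

lemma trunc_update (x : Noise) (l : NoiseIdx) (t : ℝ) :
    trunc m (Function.update x l t) = trunc m x + (t - x l) • coordDir m l := by
  have hcoord : ∀ k, Function.update x l t k
      = x k + (t - x l) * Pi.single (M := fun _ => ℝ) l 1 k := fun k => by
    rcases eq_or_ne k l with rfl | h <;> simp_all
  simp only [coordDir, trunc, hcoord]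
  rfl

lemma hasDerivAt_trunc_update (x : Noise) (l : NoiseIdx) (t : ℝ) :
    HasDerivAt (fun t => trunc m (Function.update x l t)) (coordDir m l) t := by
  simp only [trunc_update]
  simpa using (((hasDerivAt_id t).sub_const (x l)).smul_const (coordDir m l)).const_add (trunc m x)

lemma norm_coordDir_le_one (l : NoiseIdx) : ‖coordDir m l‖ ≤ 1 := by
  have hcoord : ∀ k, ‖Pi.single (M := fun _ => ℝ) l 1 k‖ ≤ 1 := fun k => by
    rcases eq_or_ne k l with rfl | h <;> simp_all
  simp only [coordDir, trunc, norm_prod_le_iff, pi_norm_le_iff_of_nonneg zero_le_one]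
  exact ⟨fun i => hcoord _, fun i => hcoord _, fun i => hcoord _, hcoord _, hcoord _⟩

lemma isAdapted_comp_trunc [TopologicalSpace S] [OpensMeasurableSpace S] {φ : Coord m → S → ℝ}
    (hφ : ContinuousOn (fun p : Coord m × S => φ p.1 p.2) (coordDomain m ×ˢ univ)) :
    IsAdapted m (fun x s => φ (trunc m x) s) where
  measurable := by
    classical
    have hext : Measurable ((coordDomain m ×ˢ univ).indicator
        fun p : Coord m × S => φ p.1 p.2) := by
      rw [← piecewise_eq_indicator]
      exact hφ.measurable_piecewise continuousOn_const
        ((isOpen_coordDomain m).measurableSet.prod MeasurableSet.univ)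
    exact hext.comp (((measurable_trunc m).comp measurable_fst).prodMk measurable_snd)
  eq_of_level_eq x _ y s h := by rw [dependsOn_trunc m h]

lemma isRegular_comp_trunc {φ : Coord m → S → ℝ} {k : ℕ}
    (hφ : IsAdapted m (fun x s => φ (trunc m x) s))
    (hsmooth : ∀ s, ContDiffOn ℝ (⊤ : ℕ∞) (fun c => φ c s) (coordDomain m))
    (hC : ∀ i ≤ k, ∀ c ∈ coordDomain m, ∀ s, ‖iteratedFDeriv ℝ i (fun c' => φ c' s) c‖ ≤ C s) :
    IsRegular m C 1 0 k (fun x s => φ (trunc m x) s) := by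
  have hdom : IsDominated m C 1 0 (fun x s => φ (trunc m x) s) :=
    ⟨hφ, fun x hx s => by simpa using hC 0 zero_le _ hx s⟩
  induction k generalizing φ with
  | zero => exact hdom
  | succ k ih =>
    refine ⟨hdom, fun l hl => ?_⟩
    have hcd : ∀ s, ∀ c ∈ coordDomain m, ContDiffAt ℝ (⊤ : ℕ∞) (fun c => φ c s) c := fun s c hc =>
      (hsmooth s).contDiffAt ((isOpen_coordDomain m).mem_nhds hc)
    have hderiv : ∀ x ∈ noiseDomain m, ∀ s, HasDerivAt
        (fun t => φ (trunc m (Function.update x l t)) s)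
        (fderiv ℝ (fun c => φ c s) (trunc m x) (coordDir m l)) (x l) := fun x hx s => by
      have hfd := ((hcd s _ hx).differentiableAt (by simp)).hasFDerivAt
      rw [← Function.update_eq_self l x] at hfd
      have hchain := hfd.comp_hasDerivAt (x l) (hasDerivAt_trunc_update x l (x l))
      rwa [Function.update_eq_self] at hchain
    have hdiff := fun x hx s => (hderiv x hx s).differentiableAt
    refine ⟨hdiff, .congr ?_ fun x hx s => (hderiv x hx s).deriv.symm⟩
    have hfderiv : ∀ s, ∀ c ∈ coordDomain m,
        ContDiffAt ℝ (⊤ : ℕ∞) (fderiv ℝ fun c => φ c s) c := fun s c hc =>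
      (hcd s c hc).fderiv_right (by simp)
    have hbound : ∀ i ≤ k, ∀ c ∈ coordDomain m, ∀ s, ‖iteratedFDeriv ℝ i
        (fun c' => fderiv ℝ (fun c => φ c s) c' (coordDir m l)) c‖ ≤ C s := fun i hi c hc s =>
      calc _ ≤ ‖coordDir m l‖ * ‖iteratedFDeriv ℝ i (fderiv ℝ fun c => φ c s) c‖ :=
            norm_iteratedFDeriv_clm_apply_const (hfderiv s c hc) (by exact_mod_cast le_top)
        _ ≤ 1 * ‖iteratedFDeriv ℝ (i + 1) (fun c => φ c s) c‖ := by
            rw [norm_iteratedFDeriv_fderiv]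
            gcongr
            exact norm_coordDir_le_one l
        _ ≤ C s := by simpa using hC (i + 1) (by omega) c hc s
    have hadapted := (hφ.pderiv hl hdiff).congr fun x hx s => (hderiv x hx s).deriv
    refine ih (φ := fun c s => fderiv ℝ (fun c => φ c s) c (coordDir m l)) hadapted
      (fun s c hc => ((hfderiv s c hc).clm_apply contDiffAt_const).contDiffWithinAt) hbound ?_
    exact ⟨hadapted, fun x hx s => by simpa using hbound 0 zero_le _ hx s⟩

end Representation

section PlaneDerivatives

/-- The coordinate of sign `σ` of a point of the plane. -/
def signCoord : PM → ℝ × ℝ → ℝ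
  | .plus, p => p.1
  | .minus, p => p.2

/-- The unit vector of sign `σ` in the plane. -/
def signDir : PM → ℝ × ℝ
  | .plus => (1, 0)
  | .minus => (0, 1)

/-- The partial derivative of sign `σ` of a function on the plane. -/
def signDeriv (σ : PM) (g : ℝ × ℝ → ℝ) (p : ℝ × ℝ) : ℝ := fderiv ℝ g p (signDir σ)

lemma norm_signDir (σ : PM) : ‖signDir σ‖ = 1 := by cases σ <;> simp [signDir, Prod.norm_def]

lemma signDeriv_plus_eq_deriv {g : ℝ × ℝ → ℝ} {a b : ℝ} (hg : DifferentiableAt ℝ g (a, b)) :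
    signDeriv .plus g (a, b) = deriv (fun t => g (t, b)) a :=
  (hg.hasFDerivAt.comp_hasDerivAt a
    ((hasDerivAt_id a).prodMk (hasDerivAt_const a b))).deriv.symm

lemma signDeriv_minus_eq_deriv {g : ℝ × ℝ → ℝ} {a b : ℝ} (hg : DifferentiableAt ℝ g (a, b)) :
    signDeriv .minus g (a, b) = deriv (fun t => g (a, t)) b :=
  (hg.hasFDerivAt.comp_hasDerivAt b
    ((hasDerivAt_const b a).prodMk (hasDerivAt_id b))).deriv.symm

lemma signDeriv_mul {g h : ℝ × ℝ → ℝ} {p : ℝ × ℝ} (hg : DifferentiableAt ℝ g p)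
    (hh : DifferentiableAt ℝ h p) (σ : PM) :
    signDeriv σ (fun q => g q * h q) p = g p * signDeriv σ h p + h p * signDeriv σ g p := by
  simp only [signDeriv, fderiv_fun_mul hg hh, add_apply,
    smul_apply, smul_eq_mul]

lemma contDiff_signDeriv {k : ℕ} {g : ℝ × ℝ → ℝ} (hg : ContDiff ℝ (k + 1 : ℕ) g) (σ : PM) :
    ContDiff ℝ k (signDeriv σ g) :=
  (hg.fderiv_right (m := k) (by norm_cast)).clm_apply contDiff_const

lemma contDiff_iterate_signDeriv {j k : ℕ} {g : ℝ × ℝ → ℝ} (hg : ContDiff ℝ (k + j : ℕ) g)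
    (σ : PM) : ContDiff ℝ k ((signDeriv σ)^[j] g) := by
  induction j generalizing g with
  | zero => exact hg
  | succ j ih => exact ih (contDiff_signDeriv hg σ)

lemma signDeriv_comm {g : ℝ × ℝ → ℝ} (hg : ContDiff ℝ 2 g) (σ τ : PM) :
    signDeriv σ (signDeriv τ g) = signDeriv τ (signDeriv σ g) := by
  have hsnd : ∀ σ τ p, signDeriv σ (signDeriv τ g) p
      = fderiv ℝ (fderiv ℝ g) p (signDir σ) (signDir τ) := fun σ τ p => by
    have hd : DifferentiableAt ℝ (fderiv ℝ g) p :=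
      (hg.fderiv_right (m := 1) (by norm_num)).differentiable one_ne_zero p
    have hcomp := (ContinuousLinearMap.apply ℝ ℝ (signDir τ)).hasFDerivAt.comp p hd.hasFDerivAt
    exact congrArg (· (signDir σ)) hcomp.fderiv
  funext p
  rw [hsnd, hsnd]
  exact hg.contDiffAt.isSymmSndFDerivAt (by simp) _ _

lemma iterate_signDeriv_comm {a b : ℕ} {g : ℝ × ℝ → ℝ} (hg : ContDiff ℝ (a + b : ℕ) g)
    (σ τ : PM) :
    (signDeriv σ)^[a] ((signDeriv τ)^[b] g) = (signDeriv τ)^[b] ((signDeriv σ)^[a] g) := by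
  have hone : ∀ {b : ℕ} {g : ℝ × ℝ → ℝ}, ContDiff ℝ (b + 1 : ℕ) g →
      signDeriv σ ((signDeriv τ)^[b] g) = (signDeriv τ)^[b] (signDeriv σ g) := fun {b} => by
    induction b with
    | zero => exact fun _ => rfl
    | succ b ih =>
      intro g hg
      rw [Function.iterate_succ_apply, ih (contDiff_signDeriv hg τ),
        signDeriv_comm (hg.of_le (by norm_cast; omega)), ← Function.iterate_succ_apply]
  induction a generalizing g with
  | zero => rfl
  | succ a ih =>
    rw [Function.iterate_succ_apply, hone (hg.of_le (by norm_cast; omega)),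
      ih (contDiff_signDeriv (by rwa [add_right_comm] at hg) σ), ← Function.iterate_succ_apply]

lemma iteratedDeriv_fst_eq {k : ℕ} {g : ℝ × ℝ → ℝ} (hg : ContDiff ℝ k g) (b : ℝ) :
    iteratedDeriv k (fun a => g (a, b)) = fun a => (signDeriv .plus)^[k] g (a, b) := by
  induction k generalizing g with
  | zero => simp
  | succ k ih =>
    rw [iteratedDeriv_succ', Function.iterate_succ_apply, ← ih (contDiff_signDeriv hg _)]
    congr 1
    funext a
    exact (signDeriv_plus_eq_deriv (hg.differentiable (by simp) _)).symm

lemma iteratedDeriv_snd_eq {k : ℕ} {g : ℝ × ℝ → ℝ} (hg : ContDiff ℝ k g) (a : ℝ) :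
    iteratedDeriv k (fun b => g (a, b)) = fun b => (signDeriv .minus)^[k] g (a, b) := by
  induction k generalizing g with
  | zero => simp
  | succ k ih =>
    rw [iteratedDeriv_succ', Function.iterate_succ_apply, ← ih (contDiff_signDeriv hg _)]
    congr 1
    funext b
    exact (signDeriv_minus_eq_deriv (hg.differentiable (by simp) _)).symm

lemma mixedDeriv_eq_iterate {kp km : ℕ} {f : ℝ × ℝ → ℝ} (hf : ContDiff ℝ (kp + km : ℕ) f) :
    mixedDeriv kp km f = (signDeriv .minus)^[km] ((signDeriv .plus)^[kp] f) := by
  rw [← iterate_signDeriv_comm hf]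
  funext p
  have hinner : ∀ a, iteratedDeriv km (fun b => f (a, b)) p.2
      = (signDeriv .minus)^[km] f (a, p.2) := fun a => by
    rw [iteratedDeriv_snd_eq (hf.of_le (by norm_cast; omega))]
  simp only [mixedDeriv, hinner]
  rw [iteratedDeriv_fst_eq (contDiff_iterate_signDeriv hf _)]

end PlaneDerivatives

section InverseMonomials

/-- The open positive quadrant. -/
def quadrant : Set (ℝ × ℝ) := {p | ∀ σ, 0 < signCoord σ p}

/-- The inverse monomial `(x_+ ^ e_+ x_- ^ e_-)⁻¹`. The weights contain one factor `1 / X_±` for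
each derivative, and these factors are collected here. -/
def invMonom (e : PM → ℕ) (p : ℝ × ℝ) : ℝ := (p.1 ^ e .plus)⁻¹ * (p.2 ^ e .minus)⁻¹

lemma measurable_invMonom (e : PM → ℕ) : Measurable (invMonom e) := by
  unfold invMonom
  fun_prop

lemma signCoord_mul_invMonom_update_succ (e : PM → ℕ) (σ : PM) (j : ℕ) {p : ℝ × ℝ}
    (hp : p ∈ quadrant) :
    signCoord σ p * invMonom (Function.update e σ (j + 1)) p
      = invMonom (Function.update e σ j) p := by
  have hpos := hp σ
  cases σ <;> simp only [signCoord] at hpos ⊢ <;>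
    simp only [invMonom, Function.update_self, ne_eq, reduceCtorEq, not_false_eq_true,
      Function.update_of_ne, pow_succ] <;> field_simp

lemma differentiableAt_invMonom (e : PM → ℕ) {p : ℝ × ℝ} (hp : p ∈ quadrant) :
    DifferentiableAt ℝ (invMonom e) p :=
  ((differentiableAt_fst.pow _).inv (pow_ne_zero _ (hp .plus).ne')).mul
    ((differentiableAt_snd.pow _).inv (pow_ne_zero _ (hp .minus).ne'))

lemma mul_deriv_inv_pow (j : ℕ) {t : ℝ} (ht : t ≠ 0) :
    t * deriv (fun t : ℝ => (t ^ j)⁻¹) t = -(j * (t ^ j)⁻¹) := by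
  rw [((hasDerivAt_pow j t).fun_inv (pow_ne_zero _ ht)).deriv]
  cases j with
  | zero => simp
  | succ j =>
    rw [Nat.add_sub_cancel]
    field_simp
    ring

lemma signCoord_mul_signDeriv_invMonom (e : PM → ℕ) {p : ℝ × ℝ} (hp : p ∈ quadrant) (σ : PM) :
    signCoord σ p * signDeriv σ (invMonom e) p = -(e σ * invMonom e p) := by
  have hd := differentiableAt_invMonom e hp
  cases σ
  · rw [signDeriv_plus_eq_deriv hd]
    simp only [invMonom, signCoord, deriv_mul_const_field]
    have hfst := mul_deriv_inv_pow (e .plus) (t := p.1) (hp .plus).ne'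
    linear_combination (p.2 ^ e .minus)⁻¹ * hfst
  · rw [signDeriv_minus_eq_deriv hd]
    simp only [invMonom, signCoord, deriv_const_mul_field]
    have hsnd := mul_deriv_inv_pow (e .minus) (t := p.2) (hp .minus).ne'
    linear_combination (p.1 ^ e .plus)⁻¹ * hsnd

end InverseMonomials

section TestFunctions

variable {ε : ℝ} {k : ℕ} {g : ℝ × ℝ → ℝ}

namespace IsTestFunction

lemma of_le {j : ℕ} (hg : IsTestFunction k ε g) (h : j ≤ k) : IsTestFunction j ε g :=
  ⟨hg.contDiff.of_le (by exact_mod_cast h), fun i hi => hg.bounded i (hi.trans h),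
    hg.support_subset⟩

lemma measurable (hg : IsTestFunction k ε g) : Measurable g := hg.contDiff.continuous.measurable

lemma signDeriv (hg : IsTestFunction (k + 1) ε g) (σ : PM) :
    IsTestFunction k ε (signDeriv σ g) where
  contDiff := contDiff_signDeriv hg.contDiff σ
  bounded j hj := by
    obtain ⟨C, hC⟩ := hg.bounded (j + 1) (by omega)
    refine ⟨C, fun p => ?_⟩
    have hle := norm_iteratedFDeriv_clm_apply_const (𝕜 := ℝ) (f := fderiv ℝ g) (c := signDir σ)
      (x := p) (N := (k : ℕ∞)) (n := j) ((hg.contDiff.fderiv_right (by norm_cast)).contDiffAt)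
      (by exact_mod_cast hj)
    rw [norm_signDir, one_mul, norm_iteratedFDeriv_fderiv] at hle
    exact hle.trans (hC p)
  support_subset := by
    have htsupport : tsupport g ⊆ Ici ε ×ˢ Ici ε :=
      closure_minimal hg.support_subset (isClosed_Ici.prod isClosed_Ici)
    refine Subset.trans (fun p hp => support_fderiv_subset ℝ fun h => hp ?_) htsupport
    rw [StableIBP.signDeriv, h, zero_apply]

lemma iterate_signDeriv {j : ℕ} (hg : IsTestFunction (k + j) ε g) (σ : PM) :
    IsTestFunction k ε ((StableIBP.signDeriv σ)^[j] g) := by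
  induction j generalizing g with
  | zero => exact hg
  | succ j ih => exact ih (hg.signDeriv σ)

lemma mixedDeriv {kp km : ℕ} {f : ℝ × ℝ → ℝ} (hf : IsTestFunction (kp + km) ε f) :
    IsTestFunction 0 ε (mixedDeriv kp km f) := by
  rw [mixedDeriv_eq_iterate hf.contDiff]
  refine iterate_signDeriv (iterate_signDeriv ?_ .plus) .minus
  rwa [zero_add, add_comm]

lemma exists_bound (hg : IsTestFunction k ε g) : ∃ M, 0 ≤ M ∧ ∀ p, |g p| ≤ M := by
  obtain ⟨M, hM⟩ := hg.bounded 0 (by omega)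
  simp only [norm_iteratedFDeriv_zero, Real.norm_eq_abs] at hM
  exact ⟨M, (abs_nonneg _).trans (hM 0), hM⟩

lemma exists_bound_mul_invMonom (hε : 0 < ε) (hg : IsTestFunction k ε g) (e : PM → ℕ) :
    ∃ M, 0 ≤ M ∧ ∀ p, |g p * invMonom e p| ≤ M := by
  obtain ⟨M, hM0, hM⟩ := hg.exists_bound
  refine ⟨M * ((ε ^ e .plus)⁻¹ * (ε ^ e .minus)⁻¹), by positivity, fun p => ?_⟩
  by_cases hp : g p = 0
  · rw [hp, zero_mul, abs_zero]
    positivity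
  · obtain ⟨hplus : ε ≤ p.1, hminus : ε ≤ p.2⟩ := hg.support_subset hp
    have := hε.trans_le hplus
    have := hε.trans_le hminus
    rw [abs_mul, invMonom, abs_of_pos (a := (p.1 ^ e .plus)⁻¹ * _) (by positivity)]
    gcongr
    exact hM p

end IsTestFunction

end TestFunctions

section Approximation

variable {α ρ T κ : ℝ} {n m : ℕ} {x : Noise}

lemma part_nonneg (σ : PM) (y : ℝ) : 0 ≤ part σ y := by
  cases σ <;> exact le_max_right _ _

lemma part_mul (σ : PM) {a : ℝ} (ha : 0 ≤ a) (y : ℝ) : part σ (a * y) = a * part σ y := by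
  cases σ <;> simp only [part, mul_max_of_nonneg _ _ ha, mul_zero, mul_neg]

lemma part_eq_zero_of_pos {σ τ : PM} {y : ℝ} (hy : 0 < part σ y) (h : τ ≠ σ) : part τ y = 0 := by
  cases σ <;> cases τ <;> first
    | exact absurd rfl h
    | simp only [part, lt_max_iff, lt_self_iff_false, or_false, max_eq_right_iff] at hy ⊢
      linarith

lemma stick_nonneg (hT : 0 < T) (hx : x ∈ noiseDomain m) {i : ℕ} (hi : i < m) :
    0 ≤ stick T x i := by
  have hU := (mem_noiseDomain_iff.1 hx).2.1
  have hUi := (hU i hi).2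
  refine mul_nonneg (mul_nonneg hT.le (by linarith)) (Finset.prod_nonneg fun j hj => ?_)
  exact (hU j ((Finset.mem_range.1 hj).trans hi)).1.le

lemma jumpTerm_nonneg (α ρ : ℝ) (hT : 0 < T) (hx : x ∈ noiseDomain m) {i : ℕ} (hi : i < m)
    (σ : PM) : 0 ≤ jumpTerm α ρ T σ x i :=
  mul_nonneg (Real.rpow_nonneg (stick_nonneg hT hx hi) _) (part_nonneg _ _)

variable (α ρ T κ n) in
/-- The coefficient of `x l ^ (1 - 1 / α)` in `approxX`, for the exponential variables `l`. It
depends on the uniform variables only. -/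
def approxCoeff (σ : PM) (x : Noise) : NoiseIdx → ℝ
  | .E i => if i < n then stick T x i ^ (1 / α) * part σ (angular α ρ x i) else 0
  | .eta σ' => if σ' = σ then T ^ (1 / α) * κ ^ n else 0
  | _ => 0

lemma approxX_eq_sum (hnm : n ≤ m) (hx : x ∈ noiseDomain m) (σ : PM) :
    approxX α ρ T κ n σ x
      = ∑ l ∈ expIdx m, approxCoeff α ρ T κ n σ x l * x l ^ (1 - 1 / α) := by
  have hjump : ∑ i ∈ Finset.range m, approxCoeff α ρ T κ n σ x (.E i) * x (.E i) ^ (1 - 1 / α)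
      = ∑ i ∈ Finset.range n, jumpTerm α ρ T σ x i := by
    rw [← Finset.sum_subset (Finset.range_subset_range.2 hnm) fun i _ hi => by
      simp_all [approxCoeff]]
    refine Finset.sum_congr rfl fun i hi => ?_
    have hin := Finset.mem_range.1 hi
    have hE := pos_of_mem_noiseDomain hx (l := .E i) (by simpa using hin.trans_le hnm)
    rw [jumpTerm, stable, part_mul σ (Real.rpow_nonneg hE.le _), approxCoeff, if_pos hin]
    ring
  rw [sum_expIdx, hjump, approxX]
  cases σ <;> simp only [approxCoeff, reduceCtorEq, ↓reduceIte] <;> ring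

lemma approxCoeff_nonneg (hT : 0 < T) (hκ : 0 < κ) (hx : x ∈ noiseDomain m) {l : NoiseIdx}
    (hl : l ∈ expIdx m) (σ : PM) : 0 ≤ approxCoeff α ρ T κ n σ x l := by
  rcases l with i | i | i | σ'
  · rw [approxCoeff]
    split_ifs
    exacts [mul_nonneg (Real.rpow_nonneg (stick_nonneg hT hx (by simpa using hl)) _)
      (part_nonneg _ _), le_rfl]
  · exact le_rfl
  · exact le_rfl
  · rw [approxCoeff]
    split_ifs <;> positivity

lemma approxCoeff_mul_rpow_nonneg (hT : 0 < T) (hκ : 0 < κ) (hx : x ∈ noiseDomain m)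
    {l : NoiseIdx} (hl : l ∈ expIdx m) (σ : PM) :
    0 ≤ approxCoeff α ρ T κ n σ x l * x l ^ (1 - 1 / α) :=
  mul_nonneg (approxCoeff_nonneg hT hκ hx hl σ)
    (Real.rpow_nonneg (pos_of_mem_noiseDomain hx hl).le _)

lemma approxCoeff_mul_rpow_le_approxX (hT : 0 < T) (hκ : 0 < κ) (hnm : n ≤ m)
    (hx : x ∈ noiseDomain m) {l : NoiseIdx} (hl : l ∈ expIdx m) (σ : PM) :
    approxCoeff α ρ T κ n σ x l * x l ^ (1 - 1 / α) ≤ approxX α ρ T κ n σ x := by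
  rw [approxX_eq_sum hnm hx]
  exact Finset.single_le_sum
    (f := fun l => approxCoeff α ρ T κ n σ x l * x l ^ (1 - 1 / α))
    (fun l hl => approxCoeff_mul_rpow_nonneg hT hκ hx hl σ) hl

lemma approxX_pos (α ρ : ℝ) (hT : 0 < T) (hκ : 0 < κ) (hnm : n ≤ m) (hx : x ∈ noiseDomain m)
    (σ : PM) : 0 < approxX α ρ T κ n σ x := by
  have heta : NoiseIdx.eta σ ∈ expIdx m := by simp
  have := pos_of_mem_noiseDomain hx heta
  refine lt_of_lt_of_le ?_ (approxCoeff_mul_rpow_le_approxX hT hκ hnm hx heta σ)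
  rw [approxCoeff, if_pos rfl]
  positivity

lemma approxCoeff_update (σ : PM) {l : NoiseIdx} (hl : l ∈ expIdx m) (t : ℝ) :
    approxCoeff α ρ T κ n σ (Function.update x l t) = approxCoeff α ρ T κ n σ x := by
  have hU : ∀ i, Function.update x l t (.U i) = x (.U i) := fun i =>
    Function.update_of_ne (by rintro rfl; simp at hl) _ _
  have hV : ∀ i, Function.update x l t (.V i) = x (.V i) := fun i =>
    Function.update_of_ne (by rintro rfl; simp at hl) _ _
  funext l'
  cases l' <;> simp only [approxCoeff, stick, angular, hU, hV]

lemma activeInd_mul_approxCoeff (σ τ : PM) (l : NoiseIdx) :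
    activeInd α ρ σ x l * approxCoeff α ρ T κ n τ x l
      = if τ = σ then approxCoeff α ρ T κ n σ x l else 0 := by
  rcases l with i | i | i | σ'
  · simp only [activeInd, sgnInd, approxCoeff]
    rcases eq_or_ne τ σ with rfl | hne
    · rcases (part_nonneg τ (angular α ρ x i)).eq_or_lt with h | h
      · simp [← h]
      · simp [h]
    · by_cases h : 0 < part σ (angular α ρ x i)
      · simp [part_eq_zero_of_pos h hne, hne]
      · simp [h, hne]
  · simp [approxCoeff]
  · simp [approxCoeff]
  · simp only [activeInd, approxCoeff]
    split_ifs <;> simp_all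

lemma hasDerivAt_approxX (hnm : n ≤ m) (hx : x ∈ noiseDomain m) {l : NoiseIdx}
    (hl : l ∈ expIdx m) (σ : PM) :
    HasDerivAt (fun t => approxX α ρ T κ n σ (Function.update x l t))
      (approxCoeff α ρ T κ n σ x l * ((1 - 1 / α) * x l ^ (1 - 1 / α - 1))) (x l) := by
  refine (((Real.hasDerivAt_rpow_const (p := 1 - 1 / α)
    (.inl (pos_of_mem_noiseDomain hx hl).ne')).const_mul _).add_const
    (∑ l' ∈ (expIdx m).erase l, approxCoeff α ρ T κ n σ x l' * x l' ^ (1 - 1 / α)))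
    |>.congr_of_eventuallyEq ?_
  filter_upwards [eventually_update_mem_noiseDomain hx hl] with t ht
  rw [approxX_eq_sum hnm ht, ← Finset.add_sum_erase _ _ hl, approxCoeff_update σ hl,
    Function.update_self]
  congr 1
  exact Finset.sum_congr rfl fun l' hl' => by
    rw [Function.update_of_ne (Finset.ne_of_mem_erase hl')]

lemma signCoord_approxChi (σ : PM) (x : Noise) :
    signCoord σ (approxChi α ρ T κ n x) = approxX α ρ T κ n σ x := by cases σ <;> rfl

lemma approxChi_mem_quadrant (α ρ : ℝ) (hT : 0 < T) (hκ : 0 < κ) (hnm : n ≤ m)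
    (hx : x ∈ noiseDomain m) : approxChi α ρ T κ n x ∈ quadrant := fun σ => by
  rw [signCoord_approxChi]
  exact approxX_pos α ρ hT hκ hnm hx σ

lemma hasDerivAt_comp_approxChi (hnm : n ≤ m) (hx : x ∈ noiseDomain m) {l : NoiseIdx}
    (hl : l ∈ expIdx m) {G : ℝ × ℝ → ℝ} (hG : DifferentiableAt ℝ G (approxChi α ρ T κ n x)) :
    HasDerivAt (fun t => G (approxChi α ρ T κ n (Function.update x l t)))
      ((1 - 1 / α) * x l ^ (1 - 1 / α - 1) *
        (approxCoeff α ρ T κ n .plus x l * signDeriv .plus G (approxChi α ρ T κ n x)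
        + approxCoeff α ρ T κ n .minus x l * signDeriv .minus G (approxChi α ρ T κ n x)))
      (x l) := by
  rw [← Function.update_eq_self l x] at hG
  refine (hG.hasFDerivAt.comp_hasDerivAt (x l) ((hasDerivAt_approxX hnm hx hl .plus).prodMk
    (hasDerivAt_approxX hnm hx hl .minus))).congr_deriv ?_
  rw [Function.update_eq_self]
  have hbasis : ∀ a b : ℝ, (a, b) = a • signDir .plus + b • signDir .minus := fun a b => by
    simp [signDir]
  rw [hbasis, map_add, map_smul, map_smul]
  simp only [signDeriv, smul_eq_mul]
  ring

lemma mul_activeInd_mul_pderiv_comp_approxChi (hnm : n ≤ m) (hx : x ∈ noiseDomain m)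
    {l : NoiseIdx} (hl : l ∈ expIdx m) {G : ℝ × ℝ → ℝ}
    (hG : DifferentiableAt ℝ G (approxChi α ρ T κ n x)) (σ : PM) :
    x l * activeInd α ρ σ x l * pderiv l (fun y => G (approxChi α ρ T κ n y)) x
      = (1 - 1 / α) * (approxCoeff α ρ T κ n σ x l * x l ^ (1 - 1 / α))
        * signDeriv σ G (approxChi α ρ T κ n x) := by
  have hpos := pos_of_mem_noiseDomain hx hl
  have hselect := fun τ => activeInd_mul_approxCoeff (α := α) (ρ := ρ) (T := T) (κ := κ) (n := n)
    (x := x) σ τ l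
  rw [pderiv_eq, (hasDerivAt_comp_approxChi hnm hx hl hG).deriv, Real.rpow_sub_one hpos.ne']
  have hplus := hselect .plus
  have hminus := hselect .minus
  generalize 1 - 1 / α = b at *
  cases σ <;> simp only [reduceCtorEq, ↓reduceIte] at hplus hminus <;> field_simp <;>
    linear_combination (b * signDeriv .plus G (approxChi α ρ T κ n x)) * hplus
      + (b * signDeriv .minus G (approxChi α ρ T κ n x)) * hminus

end Approximation

section WeightOperator

variable {α ρ T κ : ℝ} {n m : ℕ} {x : Noise}

lemma opD_mul {F W : Noise → ℝ}
    (hF : ∀ l ∈ expIdx m, DifferentiableAt ℝ (fun t => F (Function.update x l t)) (x l))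
    (hW : ∀ l ∈ expIdx m, DifferentiableAt ℝ (fun t => W (Function.update x l t)) (x l)) (σ : PM) :
    opD α ρ m σ (fun y => F y * W y) x
      = opD α ρ m σ F x * W x + F x * opD α ρ m σ W x := by
  simp only [opD_eq, Finset.sum_mul, Finset.mul_sum, ← Finset.sum_add_distrib]
  refine Finset.sum_congr rfl fun l hl => ?_
  rw [pderiv_eq, deriv_fun_mul (hF l hl) (hW l hl), Function.update_eq_self, ← pderiv_eq,
    ← pderiv_eq]
  ring

lemma opD_comp_approxChi (hnm : n ≤ m) (hx : x ∈ noiseDomain m) {G : ℝ × ℝ → ℝ}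
    (hG : DifferentiableAt ℝ G (approxChi α ρ T κ n x)) (σ : PM) :
    opD α ρ m σ (fun y => G (approxChi α ρ T κ n y)) x
      = (1 - 1 / α) * (signCoord σ (approxChi α ρ T κ n x)
        * signDeriv σ G (approxChi α ρ T κ n x)) := by
  rw [opD_eq, signCoord_approxChi, approxX_eq_sum hnm hx, Finset.sum_mul, Finset.mul_sum]
  refine Finset.sum_congr rfl fun l hl => ?_
  rw [mul_activeInd_mul_pderiv_comp_approxChi hnm hx hl hG, mul_assoc]

lemma opH_congr (hx : x ∈ noiseDomain m) {ψ ψ' : Noise → ℝ} (h : ∀ y ∈ noiseDomain m, ψ y = ψ' y)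
    (σ : PM) : opH α ρ T κ n m σ ψ x = opH α ρ T κ n m σ ψ' x := by
  have hopD : opD α ρ m σ ψ x = opD α ρ m σ ψ' x := by
    rw [opD_eq, opD_eq]
    exact Finset.sum_congr rfl fun l hl => by rw [pderiv_congr hx hl h]
  rw [opH, opH, h x hx, hopD]

lemma opH_invMonom_mul (hT : 0 < T) (hκ : 0 < κ) (hnm : n ≤ m) (hx : x ∈ noiseDomain m)
    {W : Noise → ℝ}
    (hW : ∀ l ∈ expIdx m, DifferentiableAt ℝ (fun t => W (Function.update x l t)) (x l))
    (e : PM → ℕ) (σ : PM) (j : ℕ) :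
    opH α ρ T κ n m σ
        (fun y => invMonom (Function.update e σ j) (approxChi α ρ T κ n y) * W y) x
      = invMonom (Function.update e σ (j + 1)) (approxChi α ρ T κ n x)
        * coreH α ρ m σ j W x := by
  have hq := approxChi_mem_quadrant α ρ hT hκ hnm hx
  have hpos := approxX_pos α ρ hT hκ hnm hx σ
  have hmonom := differentiableAt_invMonom (Function.update e σ j) hq
  have hsucc := signCoord_mul_invMonom_update_succ e σ j hq
  rw [signCoord_approxChi] at hsucc
  rw [opH, opD_mul (fun l hl => (hasDerivAt_comp_approxChi hnm hx hl hmonom).differentiableAt) hW,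
    opD_comp_approxChi hnm hx hmonom, signCoord_mul_signDeriv_invMonom _ hq, coreH, multiplier,
    ← hsucc, Function.update_self]
  field_simp
  ring

variable (α ρ) in
/-- The `j`-fold iterate of the weight operator, after removal of all factors `1 / X_±`. -/
def coreIter (m : ℕ) (σ : PM) : ℕ → (Noise → ℝ) → Noise → ℝ
  | 0, ψ => ψ
  | j + 1, ψ => coreH α ρ m σ j (coreIter m σ j ψ)

/-- The factor by which `coreIter` with `j` steps enlarges the bounds on the derivatives of order
at most `k`. -/
def iterConst (α : ℝ) : ℕ → ℕ → ℝ
  | _, 0 => 1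
  | k, j + 1 => coreConst α k j * iterConst α (k + 1) j

lemma iterConst_nonneg (α : ℝ) (k j : ℕ) : 0 ≤ iterConst α k j := by
  induction j generalizing k with
  | zero => exact zero_le_one
  | succ j ih => exact mul_nonneg (coreConst_nonneg α k j) (ih _)

variable {S : Type*} [MeasurableSpace S] {C : S → ℝ} {K : ℝ} {r : ℕ} {W : Noise → S → ℝ}

lemma isRegular_coreIter (hC : ∀ s, 0 ≤ C s) (hK : 0 ≤ K) (σ : PM) (j : ℕ) {k : ℕ}
    (hW : IsRegular m C K r (k + j) W) :
    IsRegular m C (iterConst α k j * K) (r + 2 * j) k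
      (fun x s => coreIter α ρ m σ j (fun y => W y s) x) := by
  induction j generalizing k with
  | zero => simpa [iterConst, coreIter] using hW
  | succ j ih =>
    rw [iterConst, mul_assoc]
    exact isRegular_coreH α ρ hC (mul_nonneg (iterConst_nonneg _ _ _) hK)
      (ih (by rwa [add_right_comm k 1 j])) σ j

lemma iterate_opH_eq (hC : ∀ s, 0 ≤ C s) (hT : 0 < T) (hκ : 0 < κ) (hnm : n ≤ m) (hK : 0 ≤ K)
    {σ : PM} {e : PM → ℕ} {s : S} {ψ : Noise → ℝ}
    (hψ : ∀ x ∈ noiseDomain m,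
      ψ x = invMonom (Function.update e σ 0) (approxChi α ρ T κ n x) * W x s)
    {j : ℕ} (hW : IsRegular m C K r j W) (hx : x ∈ noiseDomain m) :
    (opH α ρ T κ n m σ)^[j] ψ x = invMonom (Function.update e σ j) (approxChi α ρ T κ n x)
      * coreIter α ρ m σ j (fun y => W y s) x := by
  induction j generalizing x with
  | zero => exact hψ x hx
  | succ j ih =>
    rw [Function.iterate_succ_apply', opH_congr hx fun y hy => ih hW.of_succ hy,
      opH_invMonom_mul hT hκ hnm hx fun l hl => ?_]
    · rfl
    · rw [add_comm] at hW
      exact ((isRegular_coreIter hC hK σ j hW).2 l hl).1 x hx s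

end WeightOperator

section Measurability

variable {α ρ T κ : ℝ} {n m : ℕ}

lemma measurable_jumpTerm (σ : PM) (i : ℕ) : Measurable fun x => jumpTerm α ρ T σ x i := by
  have hstable : Measurable fun x => stable α ρ x i :=
    ((measurable_pi_apply _).pow_const _).mul
      ((measurable_cms α ρ).comp (measurable_pi_apply _))
  have hstick : Measurable fun x => stick T x i := by
    unfold stick
    fun_prop
  exact (hstick.pow_const _).mul ((measurable_part σ).comp hstable)

lemma measurable_approxX (σ : PM) : Measurable fun x => approxX α ρ T κ n σ x :=
  (Finset.measurable_sum _ fun i _ => measurable_jumpTerm σ i).add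
    (((measurable_pi_apply _).pow_const _).const_mul _)

lemma measurable_approxChi : Measurable fun x => approxChi α ρ T κ n x :=
  (measurable_approxX _).prodMk (measurable_approxX _)

lemma dependsOn_jumpTerm {i : ℕ} (hi : i < m) (σ : PM) :
    DependsOn (fun x => jumpTerm α ρ T σ x i) (levelIdx m) := fun x y h => by
  have hprod : ∏ j ∈ Finset.range i, x (.U j) = ∏ j ∈ Finset.range i, y (.U j) :=
    Finset.prod_congr rfl fun j hj => h _ (by simpa using (Finset.mem_range.1 hj).trans hi)
  simp only [jumpTerm, stick, stable, angular, hprod, h (.E i) (by simpa), h (.U i) (by simpa),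
    h (.V i) (by simpa)]

lemma dependsOn_approxX (hnm : n ≤ m) (σ : PM) :
    DependsOn (fun x => approxX α ρ T κ n σ x) (levelIdx m) := fun x y h => by
  have hsum : ∑ i ∈ Finset.range n, jumpTerm α ρ T σ x i
      = ∑ i ∈ Finset.range n, jumpTerm α ρ T σ y i :=
    Finset.sum_congr rfl fun i hi =>
      dependsOn_jumpTerm ((Finset.mem_range.1 hi).trans_le hnm) σ h
  simp only [approxX, hsum, h (.eta σ) (by simp)]

lemma dependsOn_approxChi (hnm : n ≤ m) :
    DependsOn (fun x => approxChi α ρ T κ n x) (levelIdx m) := fun _ _ h =>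
  Prod.ext (dependsOn_approxX hnm .plus h) (dependsOn_approxX hnm .minus h)

end Measurability

section IntegrationByParts

variable {α ρ T κ : ℝ} {n m : ℕ} {S : Type*} [MeasurableSpace S] {C : S → ℝ} {K : ℝ} {r : ℕ}
  {Ω : Type*} [MeasurableSpace Ω] {P : Measure Ω} [IsProbabilityMeasure P] {N : Ω → Noise}
  {ϑ : Ω → S}

lemma integral_opD_sub_eq_zero {F : Noise → S → ℝ} (hF : IsDominated m C K r F)
    (hN : IsDrivingNoise P N) (hϑ : IsControlledParam P N m ϑ C) (σ : PM)
    (hd : ∀ l ∈ expIdx m, ∀ x ∈ noiseDomain m, ∀ s,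
      DifferentiableAt ℝ (fun t => F (Function.update x l t) s) (x l))
    (hF' : ∀ l ∈ expIdx m, ∀ x ∈ noiseDomain m, ∀ s,
      |x l * activeInd α ρ σ x l * pderiv l (fun y => F y s) x|
        ≤ K * noiseGauge m x ^ r * C s) :
    ∫ ω, (opD α ρ m σ (fun y => F y (ϑ ω)) (N ω)
      - (∑ l ∈ expIdx m, (N ω l - 1) * activeInd α ρ σ (N ω) l) * F (N ω) (ϑ ω)) ∂P = 0 := by
  let A : NoiseIdx → Noise → S → ℝ := fun l x s => activeInd α ρ σ x l * F x s
  have hA : ∀ l ∈ expIdx m, IsDominated m C K r (A l) := fun l hl => by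
    simpa only [one_mul, zero_add] using
      IsDominated.mul zero_le_one (isRegular_activeInd α ρ σ hl 0).isDominated hF
  have hAd : ∀ l ∈ expIdx m, ∀ x ∈ noiseDomain m, ∀ s,
      DifferentiableAt ℝ (fun t => A l (Function.update x l t) s) (x l) := fun l hl x hx s => by
    simp only [A, activeInd_update α ρ σ x hl]
    exact (hd l hl x hx s).const_mul _
  have hApderiv : ∀ l ∈ expIdx m, ∀ x s, x l * pderiv l (fun y => A l y s) x
      = x l * activeInd α ρ σ x l * pderiv l (fun y => F y s) x := fun l hl x s => by
    simp only [A, pderiv_eq, activeInd_update α ρ σ x hl, deriv_const_mul_field, mul_assoc]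
  have hAderiv : ∀ l ∈ expIdx m,
      IsDominated m C K r (fun x s => x l * pderiv l (fun y => A l y s) x) := fun l hl =>
    ⟨(IsAdapted.coord (expIdx_subset_levelIdx m hl)).mul ((hA l hl).isAdapted.pderiv hl (hAd l hl)),
      fun x hx s => (hApderiv l hl x s).symm ▸ hF' l hl x hx s⟩
  have hderivInt := fun l hl => (hAderiv l hl).integrable hN hϑ
  have hcoordInt := fun l hl => ((hA l hl).coord_sub_one_mul hl).integrable hN hϑ
  calc ∫ ω, (opD α ρ m σ (fun y => F y (ϑ ω)) (N ω)
        - (∑ l ∈ expIdx m, (N ω l - 1) * activeInd α ρ σ (N ω) l) * F (N ω) (ϑ ω)) ∂P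
      = ∫ ω, (∑ l ∈ expIdx m, N ω l * pderiv l (fun y => A l y (ϑ ω)) (N ω)
        - ∑ l ∈ expIdx m, (N ω l - 1) * A l (N ω) (ϑ ω)) ∂P := by
        refine integral_congr_ae (.of_forall fun ω => ?_)
        simp only [opD_eq, Finset.sum_mul, mul_assoc, A]
        congr 1
        exact Finset.sum_congr rfl fun l hl => by rw [← mul_assoc, ← hApderiv l hl]
    _ = 0 := by
        rw [integral_sub (integrable_finsetSum _ hderivInt) (integrable_finsetSum _ hcoordInt),
          integral_finsetSum _ hderivInt, integral_finsetSum _ hcoordInt, sub_eq_zero]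
        refine Finset.sum_congr rfl fun l hl => ?_
        exact (hA l hl).integral_mul_pderiv hN hϑ hl (hAd l hl) (hAderiv l hl).abs_apply_le

lemma isAdapted_comp_approxChi (hnm : n ≤ m) {G : ℝ × ℝ → ℝ} (hG : Measurable G) :
    IsAdapted m (fun x (_ : S) => G (approxChi α ρ T κ n x)) :=
  .of_measurable (hG.comp (measurable_approxChi.comp measurable_fst)) fun _ _ _ _ h =>
    congrArg G (dependsOn_approxChi hnm h)

variable {G : ℝ × ℝ → ℝ} {M M' : ℝ} {W : Noise → S → ℝ}

lemma isDominated_comp_approxChi_mul (hT : 0 < T) (hκ : 0 < κ) (hnm : n ≤ m) (hG : Measurable G)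
    (hM0 : 0 ≤ M) (hM : ∀ p ∈ quadrant, |G p| ≤ M) (hW : IsDominated m C K r W) :
    IsDominated m C (M * K) r (fun x s => G (approxChi α ρ T κ n x) * W x s) := by
  have hcomp : IsDominated m (fun _ : S => 1) M 0 (fun x _ => G (approxChi α ρ T κ n x)) :=
    ⟨isAdapted_comp_approxChi hnm hG, fun x hx _ => by
      simpa only [pow_zero, mul_one] using hM _ (approxChi_mem_quadrant α ρ hT hκ hnm hx)⟩
  simpa only [zero_add] using IsDominated.mul hM0 hcomp hW

lemma abs_logDeriv_comp_approxChi_le (hT : 0 < T) (hκ : 0 < κ) (hnm : n ≤ m) {x : Noise}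
    (hx : x ∈ noiseDomain m) {l : NoiseIdx} (hl : l ∈ expIdx m)
    (hG : DifferentiableAt ℝ G (approxChi α ρ T κ n x)) (σ : PM)
    (hM : |signCoord σ (approxChi α ρ T κ n x) * signDeriv σ G (approxChi α ρ T κ n x)| ≤ M) :
    |x l * activeInd α ρ σ x l * pderiv l (fun y => G (approxChi α ρ T κ n y)) x|
      ≤ |1 - 1 / α| * M := by
  have hpos := approxX_pos α ρ hT hκ hnm hx σ
  rw [signCoord_approxChi, abs_mul, abs_of_pos hpos] at hM
  rw [mul_activeInd_mul_pderiv_comp_approxChi hnm hx hl hG, mul_assoc, abs_mul, abs_mul (_ * _),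
    abs_of_nonneg (approxCoeff_mul_rpow_nonneg hT hκ hx hl σ)]
  gcongr
  exact (mul_le_mul_of_nonneg_right (approxCoeff_mul_rpow_le_approxX hT hκ hnm hx hl σ)
    (abs_nonneg _)).trans hM

lemma abs_logDeriv_comp_approxChi_mul_le (hT : 0 < T) (hκ : 0 < κ) (hnm : n ≤ m)
    (hGd : ∀ p ∈ quadrant, DifferentiableAt ℝ G p) (σ : PM)
    (hM0 : 0 ≤ M) (hM : ∀ p ∈ quadrant, |G p| ≤ M)
    (hM0' : 0 ≤ M') (hM' : ∀ p ∈ quadrant, |signCoord σ p * signDeriv σ G p| ≤ M')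
    (hC : ∀ s, 0 ≤ C s) (hK : 0 ≤ K) (hW : IsRegular m C K r 1 W) {l : NoiseIdx}
    (hl : l ∈ expIdx m) {x : Noise} (hx : x ∈ noiseDomain m) (s : S) :
    |x l * activeInd α ρ σ x l * pderiv l (fun y => G (approxChi α ρ T κ n y) * W y s) x|
      ≤ (|1 - 1 / α| * M' + M) * K * noiseGauge m x ^ (r + 1) * C s := by
  have hq := approxChi_mem_quadrant α ρ hT hκ hnm hx
  have hlog := abs_logDeriv_comp_approxChi_le hT hκ hnm hx hl (hGd _ hq) σ (hM' _ hq)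
  have hW1 := (hW.2 l hl).2.isDominated.abs_apply_le x hx s
  have hpos := pos_of_mem_noiseDomain hx hl
  have hgauge := one_le_noiseGauge hx
  have hCs := hC s
  have hcoeff : |x l * activeInd α ρ σ x l| ≤ noiseGauge m x := by
    rw [abs_mul, abs_of_pos hpos]
    exact (mul_le_of_le_one_right hpos.le (abs_activeInd_le_one α ρ σ x l)).trans
      (by linarith [one_add_le_noiseGauge hx hl])
  have hprod : pderiv l (fun y => G (approxChi α ρ T κ n y) * W y s) x
      = pderiv l (fun y => G (approxChi α ρ T κ n y)) x * W x s
        + G (approxChi α ρ T κ n x) * pderiv l (fun y => W y s) x := by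
    simp only [pderiv_eq]
    rw [deriv_fun_mul (hasDerivAt_comp_approxChi hnm hx hl (hGd _ hq)).differentiableAt
      ((hW.2 l hl).1 x hx s)]
    simp only [Function.update_eq_self]
  rw [hprod, mul_add, mul_left_comm _ (G _), ← mul_assoc]
  calc _ ≤ |1 - 1 / α| * M' * (K * noiseGauge m x ^ (r + 1) * C s)
        + M * (noiseGauge m x * (K * noiseGauge m x ^ r * C s)) := by
        refine (abs_add_le _ _).trans (add_le_add ?_ ?_)
        · rw [abs_mul]
          refine mul_le_mul hlog ((hW.isDominated.abs_apply_le x hx s).trans ?_) (abs_nonneg _)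
            (by positivity)
          gcongr
          omega
        · rw [abs_mul, abs_mul (x l * _)]
          exact mul_le_mul (hM _ hq) (mul_le_mul hcoeff hW1 (abs_nonneg _) (by positivity))
            (by positivity) hM0
    _ = _ := by ring

lemma integral_opD_comp_approxChi_mul_sub_eq_zero (hN : IsDrivingNoise P N)
    (hϑ : IsControlledParam P N m ϑ C) (hT : 0 < T) (hκ : 0 < κ) (hnm : n ≤ m)
    (hG : Measurable G) (hGd : ∀ p ∈ quadrant, DifferentiableAt ℝ G p) (σ : PM)
    (hM0 : 0 ≤ M) (hM : ∀ p ∈ quadrant, |G p| ≤ M)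
    (hM0' : 0 ≤ M') (hM' : ∀ p ∈ quadrant, |signCoord σ p * signDeriv σ G p| ≤ M')
    (hK : 0 ≤ K) (hW : IsRegular m C K r 1 W) :
    ∫ ω, (opD α ρ m σ (fun y => G (approxChi α ρ T κ n y) * W y (ϑ ω)) (N ω)
      - (∑ l ∈ expIdx m, (N ω l - 1) * activeInd α ρ σ (N ω) l)
        * (G (approxChi α ρ T κ n (N ω)) * W (N ω) (ϑ ω))) ∂P = 0 := by
  have hq := fun x hx => approxChi_mem_quadrant (x := x) α ρ hT hκ hnm hx
  have hdom := (isDominated_comp_approxChi_mul (α := α) (ρ := ρ) hT hκ hnm hG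
    (by positivity : 0 ≤ |1 - 1 / α| * M' + M)
    (fun p hp => (hM p hp).trans (le_add_of_nonneg_left (by positivity)))
    hW.isDominated).mono hϑ.bound_nonneg (by positivity) le_rfl r.le_succ
  refine integral_opD_sub_eq_zero hdom hN hϑ σ (fun l hl x hx s => ?_) fun l hl x hx s => ?_
  · exact (hasDerivAt_comp_approxChi hnm hx hl (hGd _ (hq x hx))).differentiableAt.mul
      ((hW.2 l hl).1 x hx s)
  · exact abs_logDeriv_comp_approxChi_mul_le hT hκ hnm hGd σ hM0 hM hM0' hM' hϑ.bound_nonneg hK hW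
      hl hx s

lemma signCoord_mul_signDeriv_mul_invMonom {g : ℝ × ℝ → ℝ} {p : ℝ × ℝ} (hp : p ∈ quadrant)
    (hg : DifferentiableAt ℝ g p) (e : PM → ℕ) (σ : PM) (j : ℕ) :
    signCoord σ p * signDeriv σ (fun q => g q * invMonom (Function.update e σ (j + 1)) q) p
      = signDeriv σ g p * invMonom (Function.update e σ j) p
        - (j + 1) * (g p * invMonom (Function.update e σ (j + 1)) p) := by
  have hmonom := signCoord_mul_signDeriv_invMonom (Function.update e σ (j + 1)) hp σ
  rw [Function.update_self, Nat.cast_add_one] at hmonom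
  rw [signDeriv_mul hg (differentiableAt_invMonom _ hp),
    ← signCoord_mul_invMonom_update_succ e σ j hp]
  linear_combination g p * hmonom

variable {ε : ℝ} {g : ℝ × ℝ → ℝ}

lemma mul_opD_mul_invMonom_sub (hα : α ≠ 0) (hα1 : α ≠ 1) (hT : 0 < T) (hκ : 0 < κ)
    (hnm : n ≤ m) (hg : Differentiable ℝ g) (e : PM → ℕ) (σ : PM) (j : ℕ)
    (hW : IsRegular m C K r 1 W) {x : Noise} (hx : x ∈ noiseDomain m) (s : S) :
    α / (α - 1) * (opD α ρ m σ (fun y => g (approxChi α ρ T κ n y)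
        * invMonom (Function.update e σ (j + 1)) (approxChi α ρ T κ n y) * W y s) x
      - (∑ l ∈ expIdx m, (x l - 1) * activeInd α ρ σ x l)
        * (g (approxChi α ρ T κ n x)
          * invMonom (Function.update e σ (j + 1)) (approxChi α ρ T κ n x) * W x s))
      = signDeriv σ g (approxChi α ρ T κ n x)
          * invMonom (Function.update e σ j) (approxChi α ρ T κ n x) * W x s
        - g (approxChi α ρ T κ n x)
          * invMonom (Function.update e σ (j + 1)) (approxChi α ρ T κ n x)
          * coreH α ρ m σ j (fun y => W y s) x := by
  have hq := approxChi_mem_quadrant α ρ hT hκ hnm hx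
  have hG : DifferentiableAt ℝ (fun p => g p * invMonom (Function.update e σ (j + 1)) p)
      (approxChi α ρ T κ n x) := (hg _).mul (differentiableAt_invMonom _ hq)
  have hα' : α - 1 ≠ 0 := sub_ne_zero.2 hα1
  rw [opD_mul (fun l hl => (hasDerivAt_comp_approxChi hnm hx hl hG).differentiableAt)
    fun l hl => (hW.2 l hl).1 x hx s, opD_comp_approxChi hnm hx hG,
    signCoord_mul_signDeriv_mul_invMonom hq (hg _), coreH, multiplier_eq]
  field_simp
  ring

lemma integral_signDeriv_mul_eq (hα : α ≠ 0) (hα1 : α ≠ 1) (hN : IsDrivingNoise P N)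
    (hϑ : IsControlledParam P N m ϑ C) (hT : 0 < T) (hκ : 0 < κ) (hnm : n ≤ m) (hε : 0 < ε)
    (hg : IsTestFunction 1 ε g) (e : PM → ℕ) (σ : PM) (j : ℕ) (hK : 0 ≤ K)
    (hW : IsRegular m C K r 1 W) :
    ∫ ω, signDeriv σ g (approxChi α ρ T κ n (N ω))
        * invMonom (Function.update e σ j) (approxChi α ρ T κ n (N ω)) * W (N ω) (ϑ ω) ∂P
      = ∫ ω, g (approxChi α ρ T κ n (N ω))
        * invMonom (Function.update e σ (j + 1)) (approxChi α ρ T κ n (N ω))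
        * coreH α ρ m σ j (fun y => W y (ϑ ω)) (N ω) ∂P := by
  obtain ⟨M, hM0, hM⟩ := hg.exists_bound_mul_invMonom hε (Function.update e σ (j + 1))
  obtain ⟨M', hM0', hM'⟩ := (hg.signDeriv σ).exists_bound_mul_invMonom hε (Function.update e σ j)
  set G : ℝ × ℝ → ℝ := fun p => g p * invMonom (Function.update e σ (j + 1)) p with hG
  have hgd : Differentiable ℝ g := hg.contDiff.differentiable (by simp)
  have hGd : ∀ p ∈ quadrant, DifferentiableAt ℝ G p := fun p hp =>
    (hgd p).mul (differentiableAt_invMonom _ hp)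
  have hGm : Measurable G := hg.measurable.mul (measurable_invMonom _)
  have hlogM : ∀ p ∈ quadrant, |signCoord σ p * signDeriv σ G p| ≤ M' + (j + 1) * M :=
    fun p hp => by
      rw [hG, signCoord_mul_signDeriv_mul_invMonom hp (hgd p)]
      refine (abs_sub _ _).trans (add_le_add (hM' p) ?_)
      rw [abs_mul, abs_of_nonneg (by positivity : (0 : ℝ) ≤ j + 1)]
      exact mul_le_mul_of_nonneg_left (hM p) (by positivity)
  have hleft := (isDominated_comp_approxChi_mul (α := α) (ρ := ρ)
    (G := fun p => signDeriv σ g p * invMonom (Function.update e σ j) p) hT hκ hnm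
    ((hg.signDeriv σ).measurable.mul (measurable_invMonom _)) hM0' (fun p _ => hM' p)
    hW.isDominated).integrable hN hϑ
  have hright := (isDominated_comp_approxChi_mul (α := α) (ρ := ρ) hT hκ hnm hGm hM0
    (fun p _ => hM p) (isRegular_coreH α ρ hϑ.bound_nonneg hK hW σ j).isDominated).integrable hN hϑ
  rw [← sub_eq_zero, ← integral_sub hleft hright, ← mul_zero (α / (α - 1)),
    ← integral_opD_comp_approxChi_mul_sub_eq_zero (α := α) (ρ := ρ) (T := T) (κ := κ) hN hϑ hT hκ
      hnm hGm hGd σ hM0 (fun p _ => hM p) (by positivity) hlogM hK hW, ← integral_const_mul]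
  refine integral_congr_ae ?_
  filter_upwards [hN.ae_mem_noiseDomain m] with ω hω
  exact (mul_opD_mul_invMonom_sub hα hα1 hT hκ hnm hgd e σ j hW hω (ϑ ω)).symm

lemma integral_iterate_signDeriv_mul_eq (hα : α ≠ 0) (hα1 : α ≠ 1) (hN : IsDrivingNoise P N)
    (hϑ : IsControlledParam P N m ϑ C) (hT : 0 < T) (hκ : 0 < κ) (hnm : n ≤ m) (hε : 0 < ε)
    (e : PM → ℕ) (σ : PM) (hK : 0 ≤ K) {j : ℕ} (hg : IsTestFunction j ε g)
    (hW : IsRegular m C K r j W) :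
    ∫ ω, (signDeriv σ)^[j] g (approxChi α ρ T κ n (N ω))
        * invMonom (Function.update e σ 0) (approxChi α ρ T κ n (N ω)) * W (N ω) (ϑ ω) ∂P
      = ∫ ω, g (approxChi α ρ T κ n (N ω))
        * invMonom (Function.update e σ j) (approxChi α ρ T κ n (N ω))
        * coreIter α ρ m σ j (fun y => W y (ϑ ω)) (N ω) ∂P := by
  induction j generalizing g with
  | zero => rfl
  | succ j ih =>
    rw [Function.iterate_succ_apply, ih (hg.signDeriv σ) hW.of_succ]
    rw [add_comm] at hW
    exact integral_signDeriv_mul_eq hα hα1 hN hϑ hT hκ hnm hε (hg.of_le (by omega)) e σ j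
      (mul_nonneg (iterConst_nonneg _ _ _) hK) (isRegular_coreIter hϑ.bound_nonneg hK σ j hW)

end IntegrationByParts

section Series

variable {Ω : Type*} [MeasurableSpace Ω] {P : Measure Ω} {F : ℕ → Ω → ℝ}

lemma lintegral_tsum_enorm_ne_top (hF : ∀ i, Integrable (F i) P)
    (hs : Summable fun i => ∫ ω, |F i ω| ∂P) : ∫⁻ ω, ∑' i, ‖F i ω‖ₑ ∂P ≠ ⊤ := by
  have hnorm : ∀ i, ∫⁻ ω, ‖F i ω‖ₑ ∂P = ENNReal.ofReal (∫ ω, |F i ω| ∂P) := fun i => by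
    simpa only [Real.norm_eq_abs] using (ofReal_integral_norm_eq_lintegral_enorm (hF i)).symm
  simp only [lintegral_tsum fun i => (hF i).1.enorm, hnorm]
  exact hs.tsum_ofReal_ne_top

lemma ae_summable_of_summable_integral (hF : ∀ i, Integrable (F i) P)
    (hs : Summable fun i => ∫ ω, |F i ω| ∂P) : ∀ᵐ ω ∂P, Summable fun i => F i ω := by
  filter_upwards [ae_lt_top' (AEMeasurable.tsum fun i => (hF i).1.enorm)
    (lintegral_tsum_enorm_ne_top hF hs)] with ω hω
  refine Summable.of_norm ?_
  simpa using ENNReal.summable_toReal hω.ne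

lemma integrable_tsum_of_summable_integral (hF : ∀ i, Integrable (F i) P)
    (hs : Summable fun i => ∫ ω, |F i ω| ∂P) : Integrable (fun ω => ∑' i, F i ω) P := by
  refine ⟨aestronglyMeasurable_of_tendsto_ae atTop
    (fun n => (integrable_finsetSum (Finset.range n) fun i _ => hF i).1) ?_, ?_⟩
  · filter_upwards [ae_summable_of_summable_integral hF hs] with ω hω
      using hω.hasSum.tendsto_sum_nat
  · exact (lintegral_mono fun ω => enorm_tsum_le_tsum_enorm).trans_lt
      (lintegral_tsum_enorm_ne_top hF hs).lt_top

end Series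

section AngularSingularity

variable {α ρ : ℝ}

lemma integrableOn_pi_div_two_sub_abs_rpow {s : ℝ} (hs : -1 < s) :
    IntegrableOn (fun v => (Real.pi / 2 - |v|) ^ s) (Ioo (-(Real.pi / 2)) (Real.pi / 2)) := by
  have hint := (intervalIntegral.intervalIntegrable_rpow' (a := 0) (b := Real.pi / 2)
    hs).comp_sub_left (Real.pi / 2)
  rw [sub_zero, sub_self] at hint
  replace hint := (intervalIntegrable_iff_integrableOn_Ioo_of_le (by positivity)).1 hint.symm
  have hright : IntegrableOn (fun v => (Real.pi / 2 - |v|) ^ s) (Ioo 0 (Real.pi / 2)) :=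
    hint.congr_fun (fun v hv => by simp only [abs_of_pos hv.1]) measurableSet_Ioo
  have hleft : IntegrableOn (fun v => (Real.pi / 2 - |v|) ^ s) (Ioo (-(Real.pi / 2)) 0) := by
    simpa using hright.comp_neg
  refine ((hleft.union hright).union (t := {0}) (by simp)).mono_set fun v hv => ?_
  rcases lt_trichotomy v 0 with h | h | h
  · exact Or.inl (Or.inl ⟨hv.1, h⟩)
  · exact Or.inr h
  · exact Or.inl (Or.inr ⟨h, hv.2⟩)

lemma two_div_pi_mul_le_cos {d θ : ℝ} (hd : 0 ≤ d) (hθ : |θ| ≤ Real.pi / 2 - d) :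
    2 / Real.pi * d ≤ Real.cos θ := by
  have hsin := Real.mul_le_sin (x := Real.pi / 2 - |θ|) (by linarith)
    (by linarith [abs_nonneg θ])
  rw [Real.sin_pi_div_two_sub, Real.cos_abs] at hsin
  refine le_trans ?_ hsin
  gcongr
  linarith

lemma abs_angle_le (hα : α ∈ Ioo (0 : ℝ) 2)
    (hρ : ρ ∈ Icc (1 - 1 / α) (1 / α) ∩ Ioo (0 : ℝ) 1) (v : ℝ) :
    |(1 - α) * v - α * (Real.pi * (ρ - 1 / 2))|
      ≤ Real.pi / 2 - |1 - α| * (Real.pi / 2 - |v|) := by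
  obtain ⟨⟨hρl, hρu⟩, hρ0, hρ1⟩ := hρ
  have hα0 := hα.1
  have hπ := Real.pi_pos
  have htriangle : |(1 - α) * v - α * (Real.pi * (ρ - 1 / 2))|
      ≤ |1 - α| * |v| + α * (Real.pi * |ρ - 1 / 2|) := by
    refine (abs_sub _ _).trans_eq ?_
    rw [abs_mul, abs_mul, abs_mul, abs_of_pos hα0, abs_of_pos hπ]
  have hskew : α * |ρ - 1 / 2| ≤ (1 - |1 - α|) / 2 := by
    rcases le_total α 1 with h | h
    · have hρ' : |ρ - 1 / 2| ≤ 1 / 2 := abs_le.2 ⟨by linarith, by linarith⟩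
      rw [abs_of_nonneg (by linarith : 0 ≤ 1 - α)]
      nlinarith
    · have hρ' : |ρ - 1 / 2| ≤ 1 / α - 1 / 2 := abs_le.2 ⟨by linarith, by linarith⟩
      rw [abs_of_nonpos (by linarith : 1 - α ≤ 0)]
      calc α * |ρ - 1 / 2| ≤ α * (1 / α - 1 / 2) := by gcongr
        _ = _ := by
          field_simp
          ring
  nlinarith

lemma rpow_abs_le_rpow {y c q : ℝ} (hy : 0 < y) (hyc : y ≤ c) (hc : c ≤ 1) :
    y ^ |q| ≤ c ^ q := by
  rcases le_total 0 q with h | h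
  · rw [abs_of_nonneg h]
    exact Real.rpow_le_rpow hy.le hyc h
  · exact (Real.rpow_le_one hy.le (hyc.trans hc) (abs_nonneg q)).trans
      (Real.one_le_rpow_of_pos_of_le_one_of_nonpos (hy.trans_le hyc) hc h)

lemma exists_abs_cms_le (hα : α ∈ Ioo (0 : ℝ) 2) (hα1 : α ≠ 1)
    (hρ : ρ ∈ Icc (1 - 1 / α) (1 / α) ∩ Ioo (0 : ℝ) 1) :
    ∃ K, 0 ≤ K ∧ ∀ v ∈ Ioo (-(Real.pi / 2)) (Real.pi / 2),
      |cms α ρ v| ≤ K * (Real.pi / 2 - |v|) ^ (-(1 / α + |1 - 1 / α|)) := by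
  have hα0 := hα.1
  have _ : 0 < |1 - α| := abs_pos.2 (sub_ne_zero.2 hα1.symm)
  refine ⟨((2 / Real.pi) ^ (1 / α) * (2 / Real.pi * |1 - α|) ^ |1 - 1 / α|)⁻¹, by positivity,
    fun v hv => ?_⟩
  have hdist : 0 < Real.pi / 2 - |v| := sub_pos.2 (abs_lt.2 hv)
  set d := Real.pi / 2 - |v| with hd
  have hcos : 2 / Real.pi * d ≤ Real.cos v :=
    two_div_pi_mul_le_cos hdist.le (by rw [hd, sub_sub_cancel])
  have hcos' : 2 / Real.pi * |1 - α| * d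
      ≤ Real.cos ((1 - α) * v - α * (Real.pi * (ρ - 1 / 2))) := by
    rw [mul_assoc]
    exact two_div_pi_mul_le_cos (by positivity) (abs_angle_le hα hρ v)
  have hdenom := mul_le_mul
    (Real.rpow_le_rpow (by positivity) hcos (by positivity : 0 ≤ 1 / α))
    (rpow_abs_le_rpow (q := 1 - 1 / α) (by positivity) hcos' (Real.cos_le_one _))
    (by positivity) (Real.rpow_nonneg (le_trans (by positivity) hcos) _)
  have hpos : 0 < (2 / Real.pi * d) ^ (1 / α) * (2 / Real.pi * |1 - α| * d) ^ |1 - 1 / α| := by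
    positivity
  rw [cms, abs_div, abs_of_pos (hpos.trans_le hdenom)]
  calc _ ≤ 1 / ((2 / Real.pi * d) ^ (1 / α) * (2 / Real.pi * |1 - α| * d) ^ |1 - 1 / α|) :=
        div_le_div₀ zero_le_one (Real.abs_sin_le_one _) hpos hdenom
    _ = _ := by
        rw [Real.mul_rpow (by positivity) hdist.le, Real.mul_rpow (by positivity) hdist.le,
          Real.rpow_neg hdist.le, Real.rpow_add hdist, ← mul_inv, one_div, mul_mul_mul_comm]

end AngularSingularity

section MomentDecay

variable {α ρ T : ℝ}

variable (α) in
/-- An exponent `p ∈ (0, 1]` for which the jump terms have finite `p`-th moments: the function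
`cms` has singularities of order at most `1/α + |1 - 1/α|`, and `p` times that order is less
than `1`. -/
def smallExp : ℝ := 1 / (2 * (1 + 1 / α + |1 - 1 / α|))

lemma smallExp_pos (hα : 0 < α) : 0 < smallExp α := by
  rw [smallExp]
  positivity

lemma smallExp_mul_lt_one (hα : 0 < α) : smallExp α * (1 / α + |1 - 1 / α|) < 1 := by
  have horder : 0 < 1 / α + |1 - 1 / α| := by positivity
  rw [smallExp, div_mul_eq_mul_div, div_lt_one (by positivity)]
  linarith

lemma smallExp_le_one (hα : 0 < α) : smallExp α ≤ 1 := by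
  have horder : 0 < 1 / α + |1 - 1 / α| := by positivity
  rw [smallExp, div_le_one (by positivity)]
  linarith

lemma neg_one_lt_smallExp_mul (hα : 0 < α) : -1 < smallExp α * (1 - 1 / α) := by
  have hinv : 0 < 1 / α := by positivity
  nlinarith [smallExp_mul_lt_one hα, smallExp_pos hα, neg_abs_le (1 - 1 / α)]

lemma lintegral_abs_cms_rpow_ne_top (hα : α ∈ Ioo (0 : ℝ) 2) (hα1 : α ≠ 1)
    (hρ : ρ ∈ Icc (1 - 1 / α) (1 / α) ∩ Ioo (0 : ℝ) 1) :
    ∫⁻ v, ENNReal.ofReal (|cms α ρ v| ^ smallExp α)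
      ∂(ProbabilityTheory.cond volume (Ioo (-(Real.pi / 2)) (Real.pi / 2))) ≠ ⊤ := by
  obtain ⟨K, hK, hcms⟩ := exists_abs_cms_le hα hα1 hρ
  have hexp : -1 < -(1 / α + |1 - 1 / α|) * smallExp α := by
    linarith [smallExp_mul_lt_one hα.1]
  rw [ProbabilityTheory.cond, lintegral_smul_measure]
  refine ENNReal.mul_ne_top ?_ (ne_top_of_le_ne_top
    ((integrableOn_pi_div_two_sub_abs_rpow hexp).const_mul (K ^ smallExp α)).lintegral_lt_top.ne
    (setLIntegral_mono' measurableSet_Ioo fun v hv => ENNReal.ofReal_le_ofReal ?_))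
  · rw [ENNReal.inv_ne_top, Real.volume_Ioo, ENNReal.ofReal_ne_zero_iff]
    linarith [Real.pi_pos]
  · have hdist : 0 ≤ Real.pi / 2 - |v| := sub_nonneg.2 (abs_lt.2 hv).le
    rw [Real.rpow_mul hdist, ← Real.mul_rpow hK (Real.rpow_nonneg hdist _)]
    exact Real.rpow_le_rpow (abs_nonneg _) (hcms v hv) (smallExp_pos hα.1).le

lemma lintegral_rpow_unitInterval {s : ℝ} (hs : 0 < s) :
    ∫⁻ u, ENNReal.ofReal (u ^ s) ∂(ProbabilityTheory.cond volume (Ioo (0 : ℝ) 1))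
      = ENNReal.ofReal (1 / (s + 1)) := by
  have hint : IntervalIntegrable (fun u : ℝ => u ^ s) volume 0 1 :=
    intervalIntegral.intervalIntegrable_rpow' (by linarith)
  rw [intervalIntegrable_iff_integrableOn_Ioo_of_le zero_le_one] at hint
  rw [ProbabilityTheory.cond, lintegral_smul_measure, Real.volume_Ioo, sub_zero,
    ENNReal.ofReal_one, inv_one, one_smul, ← ofReal_integral_eq_lintegral_ofReal hint,
    ← integral_Ioc_eq_integral_Ioo, ← intervalIntegral.integral_of_le zero_le_one,
    integral_rpow (Or.inl (by linarith)),
    Real.one_rpow, Real.zero_rpow (by linarith), sub_zero]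
  filter_upwards [ae_restrict_mem measurableSet_Ioo] with u hu using Real.rpow_nonneg hu.1.le _

lemma part_le_abs (σ : PM) (y : ℝ) : part σ y ≤ |y| := by
  cases σ
  · exact max_le (le_abs_self y) (abs_nonneg y)
  · exact max_le (neg_le_abs y) (abs_nonneg y)

variable (α ρ) in
/-- The contribution of one driving variable to the bound `jumpTerm_rpow_smallExp_le` for the
`smallExp α`-th power of a jump term. -/
def momentFactor : NoiseIdx → ℝ → ℝ
  | .E _, t => t ^ (smallExp α * (1 - 1 / α))
  | .U _, u => u ^ (smallExp α * (1 / α))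
  | .V _, v => |cms α ρ v| ^ smallExp α
  | .eta _, _ => 1

lemma measurable_momentFactor (k : NoiseIdx) : Measurable (momentFactor α ρ k) := by
  cases k
  · exact measurable_id.pow_const _
  · exact measurable_id.pow_const _
  · exact (measurable_cms α ρ).abs.pow_const _
  · exact measurable_const

lemma jumpTerm_le (hα : 0 < α) (hT : 0 < T) {i m : ℕ} (hi : i < m) {x : Noise}
    (hx : x ∈ noiseDomain m) (σ : PM) :
    jumpTerm α ρ T σ x i ≤ (T * ∏ j ∈ Finset.range i, x (.U j)) ^ (1 / α) *
      (x (.E i) ^ (1 - 1 / α) * |cms α ρ (x (.V i))|) := by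
  obtain ⟨hE, hU, -, -⟩ := mem_noiseDomain_iff.1 hx
  have hE0 : 0 ≤ x (.E i) ^ (1 - 1 / α) := Real.rpow_nonneg (hE i hi).le _
  have hprod : 0 ≤ ∏ j ∈ Finset.range i, x (.U j) :=
    Finset.prod_nonneg fun j hj => (hU j ((Finset.mem_range.1 hj).trans hi)).1.le
  have hstick : stick T x i ≤ T * ∏ j ∈ Finset.range i, x (.U j) := by
    rw [stick]
    gcongr
    exact mul_le_of_le_one_right hT.le (by linarith [(hU i hi).1])
  have hpart : part σ (stable α ρ x i) ≤ x (.E i) ^ (1 - 1 / α) * |cms α ρ (x (.V i))| := by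
    rw [stable, part_mul σ hE0]
    exact mul_le_mul_of_nonneg_left (part_le_abs _ _) hE0
  exact mul_le_mul (Real.rpow_le_rpow (stick_nonneg hT hx hi) hstick (by positivity)) hpart
    (part_nonneg _ _) (Real.rpow_nonneg (mul_nonneg hT.le hprod) _)

lemma jumpTerm_rpow_smallExp_le (hα : 0 < α) (hT : 0 < T) {i m : ℕ} (hi : i < m) {x : Noise}
    (hx : x ∈ noiseDomain m) (σ : PM) :
    jumpTerm α ρ T σ x i ^ smallExp α ≤ T ^ (smallExp α * (1 / α)) *
      ((∏ j ∈ Finset.range i, momentFactor α ρ (.U j) (x (.U j))) *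
        (momentFactor α ρ (.E i) (x (.E i)) * momentFactor α ρ (.V i) (x (.V i)))) := by
  obtain ⟨hE, hU, -, -⟩ := mem_noiseDomain_iff.1 hx
  have hEi := (hE i hi).le
  have hU0 : ∀ j ∈ Finset.range i, 0 ≤ x (.U j) := fun j hj =>
    (hU j ((Finset.mem_range.1 hj).trans hi)).1.le
  have hprod : 0 ≤ ∏ j ∈ Finset.range i, x (.U j) := Finset.prod_nonneg hU0
  refine (Real.rpow_le_rpow (jumpTerm_nonneg α ρ hT hx hi σ) (jumpTerm_le hα hT hi hx σ)
    (smallExp_pos hα).le).trans_eq ?_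
  simp only [momentFactor]
  rw [Real.mul_rpow (by positivity) (by positivity), Real.mul_rpow (by positivity) (abs_nonneg _),
    ← Real.rpow_mul (by positivity), ← Real.rpow_mul hEi, Real.mul_rpow hT.le hprod,
    Real.finsetProd_rpow _ _ hU0, mul_comm (1 / α), mul_comm (1 - 1 / α), mul_assoc]

variable {Ω : Type*} [MeasurableSpace Ω] {P : Measure Ω} {N : Ω → Noise}

lemma IsDrivingNoise.lintegral_prod_momentFactor (hN : IsDrivingNoise P N) (i : ℕ) :
    ∫⁻ ω, ENNReal.ofReal ((∏ j ∈ Finset.range i, momentFactor α ρ (.U j) (N ω (.U j))) *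
        (momentFactor α ρ (.E i) (N ω (.E i)) * momentFactor α ρ (.V i) (N ω (.V i)))) ∂P
      = (∏ j ∈ Finset.range i, ∫⁻ ω, ENNReal.ofReal (momentFactor α ρ (.U j) (N ω (.U j))) ∂P) *
        ((∫⁻ ω, ENNReal.ofReal (momentFactor α ρ (.E i) (N ω (.E i))) ∂P) *
          ∫⁻ ω, ENNReal.ofReal (momentFactor α ρ (.V i) (N ω (.V i))) ∂P) := by
  classical
  have hmeas : ∀ k, Measurable fun t => ENNReal.ofReal (momentFactor α ρ k t) := fun k =>
    (measurable_momentFactor k).ennreal_ofReal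
  have hprod : ∀ h : NoiseIdx → ENNReal,
      ∏ k ∈ insert (.E i) (insert (.V i) ((Finset.range i).image NoiseIdx.U)), h k
      = (∏ j ∈ Finset.range i, h (.U j)) * (h (.E i) * h (.V i)) := by
    intro h
    rw [Finset.prod_insert (by simp), Finset.prod_insert (by simp),
      Finset.prod_image fun a _ b _ hab => NoiseIdx.U.inj hab]
    ring
  have hindep := lintegral_prod_eq_prod_lintegral_of_indepFun
    (insert (.E i) (insert (.V i) ((Finset.range i).image NoiseIdx.U))) _
    (hN.indep.comp _ hmeas) fun k => (hmeas k).comp (hN.measurable k)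
  simp only [hprod, Function.comp_apply] at hindep
  rw [← hindep]
  refine lintegral_congr_ae ?_
  filter_upwards [hN.ae_mem_noiseDomain (i + 1)] with ω hω
  obtain ⟨hE, hU, -, -⟩ := mem_noiseDomain_iff.1 hω
  have hU0 : ∀ j ∈ Finset.range i, 0 ≤ momentFactor α ρ (.U j) (N ω (.U j)) := fun j hj =>
    Real.rpow_nonneg (hU j ((Finset.mem_range.1 hj).trans i.lt_succ_self)).1.le _
  have hE0 : 0 ≤ momentFactor α ρ (.E i) (N ω (.E i)) :=
    Real.rpow_nonneg (hE i i.lt_succ_self).le _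
  rw [ENNReal.ofReal_mul (Finset.prod_nonneg hU0), ENNReal.ofReal_mul hE0,
    ENNReal.ofReal_prod_of_nonneg hU0]

lemma IsDrivingNoise.lintegral_jumpTerm_rpow_le (hN : IsDrivingNoise P N) (hα : 0 < α)
    (hT : 0 < T) (σ : PM) (i : ℕ) :
    ∫⁻ ω, ENNReal.ofReal (jumpTerm α ρ T σ (N ω) i ^ smallExp α) ∂P
      ≤ ENNReal.ofReal (T ^ (smallExp α * (1 / α)))
        * (ENNReal.ofReal (1 / (smallExp α * (1 / α) + 1)) ^ i
          * ((∫⁻ t, ENNReal.ofReal (t ^ (smallExp α * (1 - 1 / α))) ∂(expMeasure 1))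
            * ∫⁻ v, ENNReal.ofReal (|cms α ρ v| ^ smallExp α)
              ∂(ProbabilityTheory.cond volume (Ioo (-(Real.pi / 2)) (Real.pi / 2))))) := by
  have hexp : 0 < smallExp α * (1 / α) := mul_pos (smallExp_pos hα) (by positivity)
  have hmap : ∀ k, ∫⁻ ω, ENNReal.ofReal (momentFactor α ρ k (N ω k)) ∂P
      = ∫⁻ t, ENNReal.ofReal (momentFactor α ρ k t) ∂(P.map fun ω => N ω k) := fun k =>
    (lintegral_map (measurable_momentFactor k).ennreal_ofReal (hN.measurable k)).symm
  have hU : ∀ j, ∫⁻ ω, ENNReal.ofReal (momentFactor α ρ (.U j) (N ω (.U j))) ∂P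
      = ENNReal.ofReal (1 / (smallExp α * (1 / α) + 1)) := fun j =>
    ((hmap _).trans (congrArg (lintegral · _) (hN.law_U j))).trans
      (lintegral_rpow_unitInterval hexp)
  have hE := (hmap (.E i)).trans (congrArg (lintegral · _) (hN.law_E i))
  have hV := (hmap (.V i)).trans (congrArg (lintegral · _) (hN.law_V i))
  have hprod := hN.lintegral_prod_momentFactor (α := α) (ρ := ρ) i
  rw [Finset.prod_congr rfl fun j _ => hU j, hE, hV, Finset.prod_const, Finset.card_range] at hprod
  refine le_of_le_of_eq ?_ (congrArg (ENNReal.ofReal (T ^ (smallExp α * (1 / α))) * ·) hprod)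
  rw [← lintegral_const_mul' _ _ ENNReal.ofReal_ne_top]
  refine lintegral_mono_ae ?_
  filter_upwards [hN.ae_mem_noiseDomain (i + 1)] with ω hω
  rw [← ENNReal.ofReal_mul (by positivity)]
  exact ENNReal.ofReal_le_ofReal (jumpTerm_rpow_smallExp_le hα hT i.lt_succ_self hω σ)

lemma IsDrivingNoise.exists_integral_jumpTerm_rpow_le (hN : IsDrivingNoise P N)
    (hα : α ∈ Ioo (0 : ℝ) 2) (hα1 : α ≠ 1)
    (hρ : ρ ∈ Icc (1 - 1 / α) (1 / α) ∩ Ioo (0 : ℝ) 1) (hT : 0 < T) :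
    ∃ B, 0 ≤ B ∧ ∃ θ ∈ Ioo (0 : ℝ) 1, ∀ i σ,
      Integrable (fun ω => jumpTerm α ρ T σ (N ω) i ^ smallExp α) P ∧
      ∫ ω, jumpTerm α ρ T σ (N ω) i ^ smallExp α ∂P ≤ B * θ ^ i := by
  have hexp : 0 < smallExp α * (1 / α) :=
    mul_pos (smallExp_pos hα.1) (one_div_pos.2 hα.1)
  set A := (∫⁻ t, ENNReal.ofReal (t ^ (smallExp α * (1 - 1 / α))) ∂(expMeasure 1))
    * ∫⁻ v, ENNReal.ofReal (|cms α ρ v| ^ smallExp α)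
      ∂(ProbabilityTheory.cond volume (Ioo (-(Real.pi / 2)) (Real.pi / 2))) with hA
  have hAtop : A ≠ ⊤ := ENNReal.mul_ne_top
    (integrable_rpow_expMeasure one_pos (neg_one_lt_smallExp_mul hα.1)).lintegral_lt_top.ne
    (lintegral_abs_cms_rpow_ne_top hα hα1 hρ)
  refine ⟨T ^ (smallExp α * (1 / α)) * A.toReal, by positivity,
    1 / (smallExp α * (1 / α) + 1), ⟨by positivity, ?_⟩, fun i σ => ?_⟩
  · rw [div_lt_one (by positivity)]
    linarith
  have hbound := hN.lintegral_jumpTerm_rpow_le (ρ := ρ) hα.1 hT σ i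
  rw [← hA] at hbound
  have htop : ENNReal.ofReal (T ^ (smallExp α * (1 / α)))
      * (ENNReal.ofReal (1 / (smallExp α * (1 / α) + 1)) ^ i * A) ≠ ⊤ :=
    ENNReal.mul_ne_top ENNReal.ofReal_ne_top
      (ENNReal.mul_ne_top (ENNReal.pow_ne_top ENNReal.ofReal_ne_top) hAtop)
  have hnonneg : ∀ᵐ ω ∂P, 0 ≤ jumpTerm α ρ T σ (N ω) i ^ smallExp α := by
    filter_upwards [hN.ae_mem_noiseDomain (i + 1)] with ω hω
    exact Real.rpow_nonneg (jumpTerm_nonneg α ρ hT hω i.lt_succ_self σ) _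
  have hmeas : AEStronglyMeasurable (fun ω => jumpTerm α ρ T σ (N ω) i ^ smallExp α) P :=
    (((measurable_jumpTerm σ i).comp hN.measurable_noise).pow_const _).aestronglyMeasurable
  refine ⟨⟨hmeas, ?_⟩, ?_⟩
  · rw [hasFiniteIntegral_iff_ofReal hnonneg]
    exact hbound.trans_lt htop.lt_top
  · rw [integral_eq_lintegral_of_nonneg_ae hnonneg hmeas]
    refine (ENNReal.toReal_mono htop hbound).trans_eq ?_
    rw [ENNReal.toReal_mul, ENNReal.toReal_mul, ENNReal.toReal_pow,
      ENNReal.toReal_ofReal (by positivity), ENNReal.toReal_ofReal (by positivity)]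
    ring

lemma summable_of_summable_rpow {a : ℕ → ℝ} (ha : ∀ i, 0 ≤ a i) {p : ℝ} (hp : 0 < p)
    (hp1 : p ≤ 1) (h : Summable fun i => a i ^ p) : Summable a := by
  refine h.of_norm_bounded_eventually_nat ?_
  filter_upwards [h.tendsto_atTop_zero.eventually (gt_mem_nhds one_pos)] with i hi
  rw [Real.norm_of_nonneg (ha i)]
  have hle : a i ≤ 1 := le_of_not_gt fun hgt =>
    hi.not_ge (Real.one_le_rpow hgt.le hp.le)
  exact Real.self_le_rpow_of_le_one (ha i) hle hp1

lemma IsDrivingNoise.ae_summable_jumpTerm (hN : IsDrivingNoise P N) (hα : α ∈ Ioo (0 : ℝ) 2)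
    (hα1 : α ≠ 1) (hρ : ρ ∈ Icc (1 - 1 / α) (1 / α) ∩ Ioo (0 : ℝ) 1) (hT : 0 < T) (σ : PM) :
    ∀ᵐ ω ∂P, Summable (jumpTerm α ρ T σ (N ω)) := by
  obtain ⟨B, -, θ, hθ, hmoment⟩ := hN.exists_integral_jumpTerm_rpow_le hα hα1 hρ hT
  have hnonneg : ∀ᵐ ω ∂P, ∀ i, 0 ≤ jumpTerm α ρ T σ (N ω) i := by
    filter_upwards [ae_all_iff.2 fun i => hN.ae_mem_noiseDomain (i + 1)] with ω hω i
    exact jumpTerm_nonneg α ρ hT (hω i) i.lt_succ_self σ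
  have hs : Summable fun i => ∫ ω, |jumpTerm α ρ T σ (N ω) i ^ smallExp α| ∂P := by
    refine Summable.of_nonneg_of_le (fun i => integral_nonneg fun ω => abs_nonneg _) (fun i => ?_)
      ((summable_geometric_of_lt_one hθ.1.le hθ.2).mul_left B)
    refine (integral_congr_ae ?_).trans_le (hmoment i σ).2
    filter_upwards [hnonneg] with ω hω
    exact abs_of_nonneg (Real.rpow_nonneg (hω i) _)
  filter_upwards [hnonneg, ae_summable_of_summable_integral (fun i => (hmoment i σ).1) hs]
    with ω hω hsum
  exact summable_of_summable_rpow hω (smallExp_pos hα.1) (smallExp_le_one hα.1) hsum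

end MomentDecay

section MixedWeights

lemma IsRegular.of_le {S : Type*} [MeasurableSpace S] {m : ℕ} {C : S → ℝ} {K : ℝ} {r j k : ℕ}
    {F : Noise → S → ℝ} (hF : IsRegular m C K r k F) (hjk : j ≤ k) : IsRegular m C K r j F := by
  induction k, hjk using Nat.le_induction with
  | base => exact hF
  | succ k _ ih => exact ih hF.of_succ

/-- The pair of exponents `a` for the sign `+` and `b` for the sign `-`. -/
def signExp (a b : ℕ) : PM → ℕ
  | .plus => a
  | .minus => b

lemma update_signExp_plus (a b c : ℕ) : Function.update (signExp a b) .plus c = signExp c b := by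
  funext σ
  cases σ <;> simp [signExp]

lemma update_signExp_minus (a b c : ℕ) : Function.update (signExp a b) .minus c = signExp a c := by
  funext σ
  cases σ <;> simp [signExp]

lemma invMonom_signExp_zero (p : ℝ × ℝ) : invMonom (signExp 0 0) p = 1 := by
  simp [invMonom, signExp]

variable {S : Type*} [MeasurableSpace S] {m n kp km : ℕ} {α ρ T κ ε K : ℝ} {C : S → ℝ} {r : ℕ}
  {W : Noise → S → ℝ} {φ : Coord m → S → ℝ} {f : ℝ × ℝ → ℝ}

variable (α ρ) in
/-- The weight `H^{+,kp} (H^{-,km} ψ)` after removal of all factors `1 / X_±`. In contrast to the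
weight itself, it does not depend on the index `n` of the approximation `χ_n`. -/
def weightCore (m kp km : ℕ) (ψ : Noise → ℝ) : Noise → ℝ :=
  coreIter α ρ m .plus kp (coreIter α ρ m .minus km ψ)

/-- The factor by which `weightCore` enlarges bounds. -/
def weightConst (α : ℝ) (kp km : ℕ) : ℝ := iterConst α 0 kp * iterConst α kp km

lemma weightConst_nonneg (α : ℝ) (kp km : ℕ) : 0 ≤ weightConst α kp km :=
  mul_nonneg (iterConst_nonneg _ _ _) (iterConst_nonneg _ _ _)

lemma isDominated_weightCore (hC : ∀ s, 0 ≤ C s) (hK : 0 ≤ K)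
    (hW : IsRegular m C K r (kp + km) W) :
    IsDominated m C (weightConst α kp km * K) (r + 2 * km + 2 * kp)
      (fun x s => weightCore α ρ m kp km (fun y => W y s) x) := by
  have hminus := isRegular_coreIter (α := α) (ρ := ρ) hC hK .minus km hW
  rw [← zero_add kp] at hminus
  rw [weightConst, mul_assoc]
  have hplus := isRegular_coreIter (α := α) (ρ := ρ) hC (mul_nonneg (iterConst_nonneg _ _ _) hK)
    .plus kp hminus
  simp only [zero_add] at hplus
  exact hplus.isDominated

lemma Theta_eq {Ω : Type*} {N : Ω → Noise} {ϑ : Ω → S} (hC : ∀ s, 0 ≤ C s) (hT : 0 < T)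
    (hκ : 0 < κ) (hnm : n ≤ m) (hK : 0 ≤ K)
    (hφ : IsRegular m C K r (kp + km) (fun x s => φ (trunc m x) s)) {ω : Ω}
    (hω : N ω ∈ noiseDomain m) :
    Theta α ρ T κ N f kp km n m φ ϑ ω
      = f (approxChi α ρ T κ n (N ω)) * invMonom (signExp kp km) (approxChi α ρ T κ n (N ω))
        * weightCore α ρ m kp km (fun x => φ (trunc m x) (ϑ ω)) (N ω) := by
  have hminus : ∀ x ∈ noiseDomain m, (opH α ρ T κ n m .minus)^[km] (fun y => φ (trunc m y) (ϑ ω)) x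
      = invMonom (signExp 0 km) (approxChi α ρ T κ n x)
        * coreIter α ρ m .minus km (fun y => φ (trunc m y) (ϑ ω)) x := fun x hx => by
    rw [iterate_opH_eq (e := signExp 0 0) hC hT hκ hnm hK (s := ϑ ω) (fun y _ => ?_)
      (hφ.of_le (Nat.le_add_left km kp)) hx, update_signExp_minus]
    rw [update_signExp_minus, invMonom_signExp_zero, one_mul]
  rw [← update_signExp_plus 0 km 0] at hminus
  have hplus := iterate_opH_eq hC hT hκ hnm (mul_nonneg (iterConst_nonneg α _ _) hK) hminus
    (isRegular_coreIter (α := α) (ρ := ρ) hC hK .minus km hφ) hω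
  rw [Theta, hplus, update_signExp_plus, weightCore, mul_assoc]

variable {Ω : Type*} [MeasurableSpace Ω] {P : Measure Ω} {N : Ω → Noise} {ϑ : Ω → S}

lemma integrable_Theta (hN : IsDrivingNoise P N) (hϑ : IsControlledParam P N m ϑ C) (hT : 0 < T)
    (hκ : 0 < κ) (hnm : n ≤ m) (hε : 0 < ε) (hK : 0 ≤ K)
    (hφ : IsRegular m C K r (kp + km) (fun x s => φ (trunc m x) s))
    (hf : IsTestFunction (kp + km) ε f) :
    Integrable (Theta α ρ T κ N f kp km n m φ ϑ) P := by
  obtain ⟨M, hM0, hM⟩ := hf.exists_bound_mul_invMonom hε (signExp kp km)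
  have hdom := isDominated_comp_approxChi_mul (α := α) (ρ := ρ) hT hκ hnm
    (hf.measurable.mul (measurable_invMonom _)) hM0 (fun p _ => hM p)
    (isDominated_weightCore (α := α) (ρ := ρ) hϑ.bound_nonneg hK hφ)
  refine (hdom.integrable hN hϑ).congr ?_
  filter_upwards [hN.ae_mem_noiseDomain m] with ω hω
  exact (Theta_eq hϑ.bound_nonneg hT hκ hnm hK hφ hω).symm

lemma integral_Theta [IsProbabilityMeasure P] (hα : α ≠ 0) (hα1 : α ≠ 1) (hN : IsDrivingNoise P N)
    (hϑ : IsControlledParam P N m ϑ C) (hT : 0 < T) (hκ : 0 < κ) (hnm : n ≤ m) (hε : 0 < ε)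
    (hK : 0 ≤ K) (hφ : IsRegular m C K r (kp + km) (fun x s => φ (trunc m x) s))
    (hf : IsTestFunction (kp + km) ε f) :
    ∫ ω, Theta α ρ T κ N f kp km n m φ ϑ ω ∂P
      = ∫ ω, mixedDeriv kp km f (approxChi α ρ T κ n (N ω)) * φ (trunc m (N ω)) (ϑ ω) ∂P := by
  have hminus := integral_iterate_signDeriv_mul_eq (ρ := ρ) hα hα1 hN hϑ hT hκ hnm hε
    (signExp 0 0) .minus hK (g := (signDeriv .plus)^[kp] f)
    (IsTestFunction.iterate_signDeriv (by rwa [add_comm] at hf) .plus)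
    (hφ.of_le (Nat.le_add_left km kp))
  have hplus := integral_iterate_signDeriv_mul_eq (ρ := ρ) hα hα1 hN hϑ hT hκ hnm hε
    (signExp 0 km) .plus (mul_nonneg (iterConst_nonneg α _ _) hK)
    (hf.of_le (Nat.le_add_right kp km))
    (isRegular_coreIter (α := α) (ρ := ρ) hϑ.bound_nonneg hK .minus km hφ)
  simp only [update_signExp_minus, invMonom_signExp_zero, mul_one] at hminus
  simp only [update_signExp_plus] at hplus
  rw [mixedDeriv_eq_iterate hf.contDiff, hminus, hplus]
  refine integral_congr_ae ?_
  filter_upwards [hN.ae_mem_noiseDomain m] with ω hω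
  exact Theta_eq hϑ.bound_nonneg hT hκ hnm hK hφ hω

end MixedWeights

section SmoothRepresentations

lemma coordDomain_nonempty (m : ℕ) : (coordDomain m).Nonempty :=
  ⟨(fun _ => 1, fun _ => 1 / 2, fun _ => 0, 1, 1), by
    simp [coordDomain, Real.pi_pos, inv_lt_one_of_one_lt₀]⟩

variable {α ρ T κ ε : ℝ} {Ω S : Type*} [MeasurableSpace Ω] {P : Measure Ω} {N : Ω → Noise}
  [MetricSpace S] [MeasurableSpace S] [OpensMeasurableSpace S] {m n kp km : ℕ}
  {φ : Coord m → S → ℝ} {ϑ : Ω → S} {Φ : Ω → ℝ} {f : ℝ × ℝ → ℝ}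

namespace IsSmoothRep

lemma exists_isControlledParam (h : IsSmoothRep P N m φ ϑ Φ)
    {K : ℕ → ℝ} (hK : ∀ j, DerivBoundedInMean P m φ ϑ j (K j)) (k : ℕ) :
    ∃ C : S → ℝ, IsControlledParam P N m ϑ C ∧
      ∫ ω, C (ϑ ω) ∂P ≤ ∑ j ∈ Finset.range (k + 1), K j ∧
      IsRegular m C 1 0 k (fun x s => φ (trunc m x) s) := by
  choose C hmeas hbound hint hle using hK
  obtain ⟨c₀, hc₀⟩ := coordDomain_nonempty m
  have hC : ∀ j s, 0 ≤ C j s := fun j s => (norm_nonneg _).trans (hbound j c₀ hc₀ s)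
  refine ⟨fun s => ∑ j ∈ Finset.range (k + 1), C j s,
    ⟨h.measurable, h.indep, Finset.measurable_sum _ fun j _ => hmeas j,
      fun s => Finset.sum_nonneg fun j _ => hC j s, integrable_finsetSum _ fun j _ => hint j⟩, ?_,
    isRegular_comp_trunc (isAdapted_comp_trunc h.continuousOn) h.contDiffOn
      fun i hi c hc s => (hbound i c hc s).trans ?_⟩
  · rw [integral_finsetSum _ fun j _ => hint j]
    exact Finset.sum_le_sum fun j _ => hle j
  · exact Finset.single_le_sum (f := fun j => C j s) (fun j _ => hC j s)
      (Finset.mem_range.2 (by omega))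

lemma integrable (h : IsSmoothRep P N m φ ϑ Φ) (hN : IsDrivingNoise P N) :
    Integrable Φ P := by
  choose K hK using h.bounded
  obtain ⟨C, hϑ, -, hφ⟩ := h.exists_isControlledParam hK 0
  exact (hφ.isDominated.integrable hN hϑ).congr h.eq_rep.symm

lemma integrable_Theta (h : IsSmoothRep P N m φ ϑ Φ) (hN : IsDrivingNoise P N)
    (hT : 0 < T) (hκ : 0 < κ) (hnm : n ≤ m) (hε : 0 < ε) (hf : IsTestFunction (kp + km) ε f) :
    Integrable (Theta α ρ T κ N f kp km n m φ ϑ) P := by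
  choose K hK using h.bounded
  obtain ⟨C, hϑ, -, hφ⟩ := h.exists_isControlledParam hK (kp + km)
  exact StableIBP.integrable_Theta hN hϑ hT hκ hnm hε zero_le_one hφ hf

lemma integral_Theta [IsProbabilityMeasure P] (h : IsSmoothRep P N m φ ϑ Φ)
    (hN : IsDrivingNoise P N) (hα : α ≠ 0) (hα1 : α ≠ 1) (hT : 0 < T)
    (hκ : 0 < κ) (hnm : n ≤ m) (hε : 0 < ε) (hf : IsTestFunction (kp + km) ε f) :
    ∫ ω, Theta α ρ T κ N f kp km n m φ ϑ ω ∂P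
      = ∫ ω, mixedDeriv kp km f (approxChi α ρ T κ n (N ω)) * Φ ω ∂P := by
  choose K hK using h.bounded
  obtain ⟨C, hϑ, -, hφ⟩ := h.exists_isControlledParam hK (kp + km)
  rw [StableIBP.integral_Theta hα hα1 hN hϑ hT hκ hnm hε zero_le_one hφ hf]
  exact integral_congr_ae (h.eq_rep.mono fun ω hω => congrArg (_ * ·) hω.symm)

end IsSmoothRep

end SmoothRepresentations

section Lipschitz

/-- Bounded Lipschitz functions on the plane, with a common constant for both properties. -/
def IsBoundedLipschitz (h : ℝ × ℝ → ℝ) : Prop :=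
  ∃ M, 0 ≤ M ∧ (∀ p, |h p| ≤ M) ∧ ∀ p p', |h p - h p'| ≤ M * ‖p - p'‖

namespace IsBoundedLipschitz

variable {g h : ℝ × ℝ → ℝ}

lemma mul (hg : IsBoundedLipschitz g) (hh : IsBoundedLipschitz h) :
    IsBoundedLipschitz fun p => g p * h p := by
  obtain ⟨A, hA, hgA, hgLip⟩ := hg
  obtain ⟨B, hB, hhB, hhLip⟩ := hh
  refine ⟨2 * (A * B), by positivity, fun p => ?_, fun p p' => ?_⟩
  · calc |g p * h p| = |g p| * |h p| := abs_mul _ _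
      _ ≤ A * B := mul_le_mul (hgA p) (hhB p) (abs_nonneg _) hA
      _ ≤ 2 * (A * B) := le_mul_of_one_le_left (by positivity) one_le_two
  · calc |g p * h p - g p' * h p'| = |g p * (h p - h p') + (g p - g p') * h p'| := by ring_nf
      _ ≤ |g p| * |h p - h p'| + |g p - g p'| * |h p'| :=
        (abs_add_le _ _).trans_eq (by rw [abs_mul, abs_mul])
      _ ≤ A * (B * ‖p - p'‖) + A * ‖p - p'‖ * B :=
        add_le_add (mul_le_mul (hgA p) (hhLip p p') (abs_nonneg _) hA)
          (mul_le_mul (hgLip p p') (hhB p') (abs_nonneg _) (by positivity))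
      _ = 2 * (A * B) * ‖p - p'‖ := by ring

lemma pow (hg : IsBoundedLipschitz g) (j : ℕ) : IsBoundedLipschitz fun p => g p ^ j := by
  induction j with
  | zero => exact ⟨1, zero_le_one, by simp, by simp⟩
  | succ j ih => simpa only [pow_succ] using ih.mul hg

lemma exists_abs_sub_le_mul_min (hh : IsBoundedLipschitz h) :
    ∃ M, 0 ≤ M ∧ ∀ p p', |h p - h p'| ≤ M * min 1 ‖p - p'‖ := by
  obtain ⟨M, hM, hbound, hLip⟩ := hh
  refine ⟨2 * M, by positivity, fun p p' => ?_⟩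
  rw [mul_min_of_nonneg _ _ (by positivity)]
  refine le_min ?_ ((hLip p p').trans ?_)
  · linarith [abs_sub (h p) (h p'), hbound p, hbound p']
  · gcongr
    linarith

end IsBoundedLipschitz

lemma isBoundedLipschitz_inv_max {ε : ℝ} (hε : 0 < ε) {c : ℝ × ℝ → ℝ}
    (hc : ∀ p p', |c p - c p'| ≤ ‖p - p'‖) :
    IsBoundedLipschitz fun p => (max (c p) ε)⁻¹ := by
  have hpos : ∀ p, 0 < max (c p) ε := fun p => lt_max_of_lt_right hε
  have hinv : ∀ p, (max (c p) ε)⁻¹ ≤ ε⁻¹ := fun p => inv_anti₀ hε (le_max_right _ _)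
  refine ⟨ε⁻¹ + ε⁻¹ * ε⁻¹, by positivity, fun p => ?_, fun p p' => ?_⟩
  · rw [abs_of_pos (inv_pos.2 (hpos p))]
    exact (hinv p).trans (le_add_of_nonneg_right (by positivity))
  · calc |(max (c p) ε)⁻¹ - (max (c p') ε)⁻¹|
        = (max (c p) ε)⁻¹ * (max (c p') ε)⁻¹ * |max (c p') ε - max (c p) ε| := by
          rw [inv_sub_inv (hpos p).ne' (hpos p').ne', abs_div,
            abs_of_pos (mul_pos (hpos p) (hpos p')), div_eq_inv_mul, mul_inv]
      _ ≤ ε⁻¹ * ε⁻¹ * ‖p - p'‖ := by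
          refine mul_le_mul (mul_le_mul (hinv p) (hinv p') (inv_pos.2 (hpos p')).le
            (by positivity)) ((abs_max_sub_max_le_abs _ _ _).trans ?_) (abs_nonneg _)
            (by positivity)
          rw [abs_sub_comm]
          exact hc p p'
      _ ≤ (ε⁻¹ + ε⁻¹ * ε⁻¹) * ‖p - p'‖ := by
          gcongr
          exact le_add_of_nonneg_left (by positivity)

namespace IsTestFunction

variable {ε : ℝ} {f : ℝ × ℝ → ℝ}

lemma isBoundedLipschitz (hf : IsTestFunction 1 ε f) : IsBoundedLipschitz f := by
  obtain ⟨A, hA, hfA⟩ := hf.exists_bound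
  obtain ⟨B, hB⟩ := hf.bounded 1 le_rfl
  have hfderiv : ∀ p, ‖fderiv ℝ f p‖ ≤ B := fun p => by
    rw [← norm_iteratedFDeriv_one]
    exact hB p
  have hB0 : 0 ≤ B := (norm_nonneg _).trans (hB 0)
  refine ⟨A + B, by positivity, fun p => (hfA p).trans (by linarith), fun p p' => ?_⟩
  calc |f p - f p'| ≤ B * ‖p - p'‖ :=
        convex_univ.norm_image_sub_le_of_norm_fderiv_le (𝕜 := ℝ)
          (fun x _ => hf.contDiff.differentiable (by simp) x) (fun x _ => hfderiv x)
          (mem_univ _) (mem_univ _)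
    _ ≤ (A + B) * ‖p - p'‖ := by
        gcongr
        linarith

lemma isBoundedLipschitz_mul_invMonom (hε : 0 < ε) (hf : IsTestFunction 1 ε f) (e : PM → ℕ) :
    IsBoundedLipschitz fun p => f p * invMonom e p := by
  have hfst : IsBoundedLipschitz fun p : ℝ × ℝ => (max p.1 ε)⁻¹ :=
    isBoundedLipschitz_inv_max hε fun p p' => norm_fst_le (p - p')
  have hsnd : IsBoundedLipschitz fun p : ℝ × ℝ => (max p.2 ε)⁻¹ :=
    isBoundedLipschitz_inv_max hε fun p p' => norm_snd_le (p - p')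
  have heq : (fun p => f p * invMonom e p) = fun p =>
      f p * ((max p.1 ε)⁻¹ ^ e .plus * (max p.2 ε)⁻¹ ^ e .minus) := by
    funext p
    by_cases hp : f p = 0
    · simp [hp]
    · obtain ⟨hp₁, hp₂⟩ : ε ≤ p.1 ∧ ε ≤ p.2 := hf.support_subset hp
      rw [max_eq_left hp₁, max_eq_left hp₂, invMonom, inv_pow, inv_pow]
  rw [heq]
  exact hf.isBoundedLipschitz.mul ((hfst.pow _).mul (hsnd.pow _))

end IsTestFunction

end Lipschitz

section Increments

variable {α ρ T κ : ℝ}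

lemma min_one_add_le {a b : ℝ} (ha : 0 ≤ a) (hb : 0 ≤ b) :
    min 1 (a + b) ≤ min 1 a + min 1 b := by
  rcases le_total 1 a with h | h
  · rw [min_eq_left h]
    exact (min_le_left _ _).trans (le_add_of_nonneg_right (le_min zero_le_one hb))
  · rcases le_total 1 b with h' | h'
    · rw [min_eq_left h']
      exact (min_le_left _ _).trans (le_add_of_nonneg_left (le_min zero_le_one ha))
    · rw [min_eq_right h, min_eq_right h']
      exact min_le_right _ _

lemma min_one_le_rpow {a p : ℝ} (ha : 0 ≤ a) (hp : 0 ≤ p) (hp1 : p ≤ 1) : min 1 a ≤ a ^ p := by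
  rcases le_total 1 a with h | h
  · exact (min_le_left _ _).trans (Real.one_le_rpow h hp)
  · exact (min_le_right _ _).trans (Real.self_le_rpow_of_le_one ha h hp1)

variable (α T κ) in
/-- The term `T^{1/α} κ^i η_±^{1-1/α}` which replaces the tail of the series in `X_{±,i}`. -/
def tailTerm (i : ℕ) (σ : PM) (x : Noise) : ℝ :=
  T ^ (1 / α) * κ ^ i * x (.eta σ) ^ (1 - 1 / α)

lemma tailTerm_nonneg (hT : 0 < T) (hκ : 0 < κ) (i : ℕ) (σ : PM) {x : Noise} {m : ℕ}
    (hx : x ∈ noiseDomain m) : 0 ≤ tailTerm α T κ i σ x := by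
  have := pos_of_mem_noiseDomain hx (l := .eta σ) (by simp)
  unfold tailTerm
  positivity

variable (α ρ T κ) in
/-- The increment `χ_{i+1} - χ_i`, measured by the bounded distance `min 1 ‖p - p'‖`. -/
def truncIncrement (i : ℕ) (x : Noise) : ℝ :=
  min 1 ‖approxChi α ρ T κ (i + 1) x - approxChi α ρ T κ i x‖

lemma truncIncrement_nonneg (i : ℕ) (x : Noise) : 0 ≤ truncIncrement α ρ T κ i x :=
  le_min zero_le_one (norm_nonneg _)

lemma truncIncrement_le_one (i : ℕ) (x : Noise) : truncIncrement α ρ T κ i x ≤ 1 :=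
  min_le_left _ _

lemma norm_truncIncrement_le_one (i : ℕ) (x : Noise) : ‖truncIncrement α ρ T κ i x‖ ≤ 1 := by
  rw [Real.norm_of_nonneg (truncIncrement_nonneg i x)]
  exact truncIncrement_le_one i x

lemma measurable_truncIncrement (i : ℕ) : Measurable (truncIncrement α ρ T κ i) :=
  measurable_const.min (measurable_approxChi.sub measurable_approxChi).norm

lemma dependsOn_truncIncrement (i : ℕ) :
    DependsOn (truncIncrement α ρ T κ i) (levelIdx (i + 1)) := fun _ _ h =>
  congrArg (min 1 ‖·‖)
    (congrArg₂ (· - ·) (dependsOn_approxChi le_rfl h) (dependsOn_approxChi i.le_succ h))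

lemma abs_approxX_succ_sub_le (hT : 0 < T) (hκ : κ ∈ Ioo (0 : ℝ) 1) (i : ℕ) (σ : PM) {x : Noise}
    (hx : x ∈ noiseDomain (i + 1)) :
    |approxX α ρ T κ (i + 1) σ x - approxX α ρ T κ i σ x|
      ≤ jumpTerm α ρ T σ x i + tailTerm α T κ i σ x := by
  have hincrement : approxX α ρ T κ (i + 1) σ x - approxX α ρ T κ i σ x
      = jumpTerm α ρ T σ x i - (1 - κ) * tailTerm α T κ i σ x := by
    simp only [approxX, Finset.sum_range_succ, tailTerm, pow_succ]
    ring
  have hjump := jumpTerm_nonneg α ρ hT hx i.lt_succ_self σ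
  have htail := tailTerm_nonneg (α := α) hT hκ.1 i σ hx
  rw [hincrement]
  refine (abs_sub _ _).trans (add_le_add (abs_of_nonneg hjump).le ?_)
  rw [abs_of_nonneg (mul_nonneg (sub_nonneg.2 hκ.2.le) htail)]
  exact mul_le_of_le_one_left htail (by linarith [hκ.1])

lemma truncIncrement_le (hα : 0 < α) (hT : 0 < T) (hκ : κ ∈ Ioo (0 : ℝ) 1) (i : ℕ) {x : Noise}
    (hx : x ∈ noiseDomain (i + 1)) :
    truncIncrement α ρ T κ i x
      ≤ (jumpTerm α ρ T .plus x i ^ smallExp α + tailTerm α T κ i .plus x ^ smallExp α)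
        + (jumpTerm α ρ T .minus x i ^ smallExp α + tailTerm α T κ i .minus x ^ smallExp α) := by
  have hcomponent : ∀ σ, min 1 |approxX α ρ T κ (i + 1) σ x - approxX α ρ T κ i σ x|
      ≤ jumpTerm α ρ T σ x i ^ smallExp α + tailTerm α T κ i σ x ^ smallExp α := fun σ => by
    have hjump := jumpTerm_nonneg α ρ hT hx i.lt_succ_self σ
    have htail := tailTerm_nonneg (α := α) hT hκ.1 i σ hx
    have hpow := fun a (ha : (0 : ℝ) ≤ a) =>
      min_one_le_rpow ha (smallExp_pos hα).le (smallExp_le_one hα)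
    exact (min_le_min_left 1 (abs_approxX_succ_sub_le hT hκ i σ hx)).trans
      ((min_one_add_le hjump htail).trans (add_le_add (hpow _ hjump) (hpow _ htail)))
  have hnorm : ‖approxChi α ρ T κ (i + 1) x - approxChi α ρ T κ i x‖
      ≤ |approxX α ρ T κ (i + 1) .plus x - approxX α ρ T κ i .plus x|
        + |approxX α ρ T κ (i + 1) .minus x - approxX α ρ T κ i .minus x| :=
    max_le_add_of_nonneg (abs_nonneg _) (abs_nonneg _)
  exact (min_le_min_left 1 hnorm).trans ((min_one_add_le (abs_nonneg _) (abs_nonneg _)).trans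
    (add_le_add (hcomponent .plus) (hcomponent .minus)))

end Increments

section LevelDifferences

variable {α ρ T κ : ℝ} {Ω : Type*} [MeasurableSpace Ω] {P : Measure Ω} {N : Ω → Noise}

lemma IsDrivingNoise.exists_integral_tailTerm_rpow_le (hN : IsDrivingNoise P N) (hα : 0 < α)
    (hT : 0 < T) (hκ : 0 < κ) :
    ∃ B, 0 ≤ B ∧ ∀ i σ, Integrable (fun ω => tailTerm α T κ i σ (N ω) ^ smallExp α) P ∧
      ∫ ω, tailTerm α T κ i σ (N ω) ^ smallExp α ∂P ≤ B * (κ ^ smallExp α) ^ i := by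
  set s := smallExp α * (1 - 1 / α) with hs
  have hint : Integrable (fun t => t ^ s) (expMeasure 1) :=
    integrable_rpow_expMeasure one_pos (neg_one_lt_smallExp_mul hα)
  have hmoment : 0 ≤ ∫ t, t ^ s ∂(expMeasure 1) := integral_nonneg_of_ae
    ((ae_pos_expMeasure 1).mono fun t ht => Real.rpow_nonneg ht.le _)
  refine ⟨(T ^ (1 / α)) ^ smallExp α * ∫ t, t ^ s ∂(expMeasure 1), by positivity, fun i σ => ?_⟩
  have hlaw : P.map (fun ω => N ω (.eta σ)) = expMeasure 1 := hN.law_eta σ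
  have heq : (fun ω => tailTerm α T κ i σ (N ω) ^ smallExp α) =ᵐ[P] fun ω =>
      (T ^ (1 / α)) ^ smallExp α * (κ ^ smallExp α) ^ i * N ω (.eta σ) ^ s := by
    filter_upwards [hN.ae_mem_noiseDomain 0] with ω hω
    have hη := pos_of_mem_noiseDomain hω (l := .eta σ) (by simp)
    rw [tailTerm, Real.mul_rpow (by positivity) (by positivity),
      Real.mul_rpow (by positivity) (by positivity), ← Real.rpow_mul hη.le, hs,
      mul_comm (1 - 1 / α), ← Real.rpow_natCast, ← Real.rpow_natCast, ← Real.rpow_mul hκ.le,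
      ← Real.rpow_mul hκ.le, mul_comm (i : ℝ)]
  rw [← hlaw] at hint
  refine ⟨((hint.comp_measurable (hN.measurable _)).const_mul _).congr heq.symm, ?_⟩
  rw [integral_congr_ae heq, integral_const_mul, ← hlaw,
    integral_map (hN.measurable _).aemeasurable hint.1]
  exact (mul_right_comm _ _ _).le

lemma IsDrivingNoise.exists_integral_truncIncrement_le (hN : IsDrivingNoise P N)
    (hα : α ∈ Ioo (0 : ℝ) 2) (hα1 : α ≠ 1)
    (hρ : ρ ∈ Icc (1 - 1 / α) (1 / α) ∩ Ioo (0 : ℝ) 1) (hT : 0 < T) (hκ : κ ∈ Ioo (0 : ℝ) 1) :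
    ∃ B, ∃ θ ∈ Ioo (0 : ℝ) 1, ∀ i,
      ∫ ω, truncIncrement α ρ T κ i (N ω) ∂P ≤ B * θ ^ i := by
  obtain ⟨B, hB, θ, hθ, hjump⟩ := hN.exists_integral_jumpTerm_rpow_le hα hα1 hρ hT
  obtain ⟨B', hB', htail⟩ := hN.exists_integral_tailTerm_rpow_le hα.1 hT hκ.1
  have hκ0 := hκ.1
  have hθ0 := hθ.1
  set ζ := max θ (κ ^ smallExp α)
  refine ⟨2 * (B + B'), ζ, ⟨lt_max_of_lt_left hθ0,
    max_lt hθ.2 (Real.rpow_lt_one hκ0.le hκ.2 (smallExp_pos hα.1))⟩, fun i => ?_⟩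
  have hint := fun σ => (hjump i σ).1.add (htail i σ).1
  have hsign : ∀ σ, ∫ ω, (jumpTerm α ρ T σ (N ω) i ^ smallExp α
      + tailTerm α T κ i σ (N ω) ^ smallExp α) ∂P ≤ (B + B') * ζ ^ i := fun σ => by
    rw [integral_add (hjump i σ).1 (htail i σ).1, add_mul]
    refine add_le_add ((hjump i σ).2.trans ?_) ((htail i σ).2.trans ?_)
    · gcongr
      exact le_max_left _ _
    · gcongr
      exact le_max_right _ _
  calc ∫ ω, truncIncrement α ρ T κ i (N ω) ∂P
      ≤ ∫ ω, ((jumpTerm α ρ T .plus (N ω) i ^ smallExp α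
            + tailTerm α T κ i .plus (N ω) ^ smallExp α)
          + (jumpTerm α ρ T .minus (N ω) i ^ smallExp α
            + tailTerm α T κ i .minus (N ω) ^ smallExp α)) ∂P := by
        refine integral_mono_of_nonneg (Eventually.of_forall fun ω =>
          truncIncrement_nonneg i (N ω)) ((hint .plus).add (hint .minus)) ?_
        filter_upwards [hN.ae_mem_noiseDomain (i + 1)] with ω hω
        exact truncIncrement_le hα.1 hT hκ i hω
    _ ≤ (B + B') * ζ ^ i + (B + B') * ζ ^ i :=
        (integral_add (hint .plus) (hint .minus)).trans_le
          (add_le_add (hsign .plus) (hsign .minus))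
    _ = 2 * (B + B') * ζ ^ i := by ring

lemma mul_le_inv_mul_sq_add {a b c : ℝ} (hc : 0 < c) : a * b ≤ c⁻¹ * a ^ 2 + c * b ^ 2 := by
  have hsq : 2 * (a * b) ≤ c⁻¹ * a ^ 2 + c * b ^ 2 := by
    have hexpand : c⁻¹ * (a - c * b) ^ 2 = c⁻¹ * a ^ 2 + c * b ^ 2 - 2 * (a * b) := by
      field_simp
      ring
    linarith [mul_nonneg (inv_pos.2 hc).le (sq_nonneg (a - c * b))]
  have hsum : 0 ≤ c⁻¹ * a ^ 2 + c * b ^ 2 := by positivity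
  linarith

variable (α ρ T κ) in
/-- The expectation of the increment `χ_{i+1} - χ_i`, weighted by the growth of the weights. -/
def weightedIncrement (P : Measure Ω) (N : Ω → Noise) (r i : ℕ) : ℝ :=
  ∫ ω, truncIncrement α ρ T κ i (N ω) * noiseGauge (i + 1) (N ω) ^ r ∂P

lemma IsDrivingNoise.weightedIncrement_nonneg (hN : IsDrivingNoise P N) (r i : ℕ) :
    0 ≤ weightedIncrement α ρ T κ P N r i := by
  refine integral_nonneg_of_ae ?_
  filter_upwards [hN.ae_mem_noiseDomain (i + 1)] with ω hω
  have := zero_le_one.trans (one_le_noiseGauge hω)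
  exact mul_nonneg (truncIncrement_nonneg i _) (by positivity)

lemma IsDrivingNoise.integrable_truncIncrement_mul_pow (hN : IsDrivingNoise P N) (r i : ℕ) :
    Integrable (fun ω => truncIncrement α ρ T κ i (N ω) * noiseGauge (i + 1) (N ω) ^ r) P :=
  (hN.integrable_noiseGauge_pow (i + 1) r).bdd_mul (c := 1)
    ((measurable_truncIncrement i).comp hN.measurable_noise).aestronglyMeasurable
    (Eventually.of_forall fun _ => norm_truncIncrement_le_one i _)

-- The weight `c` balances the small increment against the large moment of the gauge.
lemma IsDrivingNoise.weightedIncrement_le [IsProbabilityMeasure P] (hN : IsDrivingNoise P N)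
    (r i : ℕ) {c : ℝ} (hc : 0 < c) :
    weightedIncrement α ρ T κ P N r i ≤ c⁻¹ * ∫ ω, truncIncrement α ρ T κ i (N ω) ∂P
      + c * (((i : ℝ) + 3) ^ (r * 2 + 1) * expMoment (r * 2)) := by
  have hgauge := hN.integrable_noiseGauge_pow (i + 1) (r * 2)
  have hincrement : Integrable (fun ω => truncIncrement α ρ T κ i (N ω)) P :=
    .of_bound ((measurable_truncIncrement i).comp hN.measurable_noise).aestronglyMeasurable 1
      (Eventually.of_forall fun _ => norm_truncIncrement_le_one i _)
  calc weightedIncrement α ρ T κ P N r i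
      ≤ ∫ ω, (c⁻¹ * truncIncrement α ρ T κ i (N ω)
          + c * noiseGauge (i + 1) (N ω) ^ (r * 2)) ∂P := by
        refine integral_mono (hN.integrable_truncIncrement_mul_pow r i)
          ((hincrement.const_mul _).add (hgauge.const_mul _)) fun ω => ?_
        refine (mul_le_inv_mul_sq_add hc).trans ?_
        rw [← pow_mul]
        gcongr
        exact pow_le_of_le_one (truncIncrement_nonneg i _) (truncIncrement_le_one i _) two_ne_zero
    _ = c⁻¹ * ∫ ω, truncIncrement α ρ T κ i (N ω) ∂P
          + c * ∫ ω, noiseGauge (i + 1) (N ω) ^ (r * 2) ∂P := by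
        rw [integral_add (hincrement.const_mul _) (hgauge.const_mul _), integral_const_mul,
          integral_const_mul]
    _ ≤ _ := by
        gcongr
        refine (hN.integral_noiseGauge_pow_le (i + 1) (r * 2)).trans_eq ?_
        push_cast
        ring

lemma summable_pow_mul_add_pow {β : ℝ} (hβ : β ∈ Ioo (0 : ℝ) 1) (k d : ℕ) :
    Summable fun i : ℕ => β ^ i * ((i : ℝ) + k) ^ d := by
  have hpow : Summable fun i : ℕ => (i : ℝ) ^ d * β ^ i :=
    summable_pow_mul_geometric_of_norm_lt_one _ (by rw [Real.norm_of_nonneg hβ.1.le]; exact hβ.2)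
  refine (((summable_nat_add_iff k).2 hpow).mul_left (β ^ k)⁻¹).congr fun i => ?_
  have hβk : β ^ k ≠ 0 := (pow_pos hβ.1 k).ne'
  rw [pow_add]
  push_cast
  field_simp

lemma IsDrivingNoise.summable_weightedIncrement [IsProbabilityMeasure P]
    (hN : IsDrivingNoise P N) (hα : α ∈ Ioo (0 : ℝ) 2) (hα1 : α ≠ 1)
    (hρ : ρ ∈ Icc (1 - 1 / α) (1 / α) ∩ Ioo (0 : ℝ) 1) (hT : 0 < T)
    (hκ : κ ∈ Ioo (0 : ℝ) 1) (r : ℕ) : Summable (weightedIncrement α ρ T κ P N r) := by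
  obtain ⟨B, θ, hθ, hdecay⟩ := hN.exists_integral_truncIncrement_le hα hα1 hρ hT hκ
  set β := √θ with hβ_def
  have hβ : β ∈ Ioo (0 : ℝ) 1 :=
    ⟨Real.sqrt_pos.2 hθ.1, by rw [hβ_def, Real.sqrt_lt' one_pos, one_pow]; exact hθ.2⟩
  have hβθ : β * β = θ := Real.mul_self_sqrt hθ.1.le
  refine .of_nonneg_of_le (hN.weightedIncrement_nonneg r) (f := fun i : ℕ =>
      B * β ^ i + β ^ i * ((i : ℝ) + (3 : ℕ)) ^ (r * 2 + 1) * expMoment (r * 2))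
    (fun i => ?_) (((summable_geometric_of_lt_one hβ.1.le hβ.2).mul_left B).add
      ((summable_pow_mul_add_pow hβ 3 _).mul_right _))
  have hβi : 0 < β ^ i := pow_pos hβ.1 i
  calc weightedIncrement α ρ T κ P N r i
      ≤ (β ^ i)⁻¹ * ∫ ω, truncIncrement α ρ T κ i (N ω) ∂P
        + β ^ i * (((i : ℝ) + 3) ^ (r * 2 + 1) * expMoment (r * 2)) :=
        hN.weightedIncrement_le r i hβi
    _ ≤ (β ^ i)⁻¹ * (B * θ ^ i)
        + β ^ i * (((i : ℝ) + 3) ^ (r * 2 + 1) * expMoment (r * 2)) := by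
        gcongr
        exact hdecay i
    _ = B * β ^ i + β ^ i * ((i : ℝ) + (3 : ℕ)) ^ (r * 2 + 1) * expMoment (r * 2) := by
        rw [← hβθ, mul_pow]
        push_cast
        field_simp

variable {S : Type*} [MeasurableSpace S] {i kp km : ℕ} {φ : Coord (i + 1) → S → ℝ}
  {C : S → ℝ} {f : ℝ × ℝ → ℝ} {M : ℝ}

lemma abs_Theta_sub_le {Ω : Type*} {N : Ω → Noise} {ϑ : Ω → S} (hC : ∀ s, 0 ≤ C s)
    (hT : 0 < T) (hκ : 0 < κ)
    (hφ : IsRegular (i + 1) C 1 0 (kp + km) (fun x s => φ (trunc (i + 1) x) s)) (hM : 0 ≤ M)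
    (hfM : ∀ p p', |f p * invMonom (signExp kp km) p - f p' * invMonom (signExp kp km) p'|
      ≤ M * min 1 ‖p - p'‖) {ω : Ω} (hω : N ω ∈ noiseDomain (i + 1)) :
    |Theta α ρ T κ N f kp km (i + 1) (i + 1) φ ϑ ω - Theta α ρ T κ N f kp km i (i + 1) φ ϑ ω|
      ≤ M * weightConst α kp km * (truncIncrement α ρ T κ i (N ω)
        * noiseGauge (i + 1) (N ω) ^ (2 * km + 2 * kp) * C (ϑ ω)) := by
  rw [Theta_eq hC hT hκ le_rfl zero_le_one hφ hω, Theta_eq hC hT hκ i.le_succ zero_le_one hφ hω,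
    ← sub_mul, abs_mul]
  refine (mul_le_mul (hfM _ _)
    ((isDominated_weightCore hC zero_le_one hφ).abs_apply_le _ hω (ϑ ω)) (abs_nonneg _)
    (mul_nonneg hM (truncIncrement_nonneg i _))).trans_eq ?_
  rw [mul_one, zero_add, ← truncIncrement]
  ring

lemma integral_abs_Theta_sub_le {ϑ : Ω → S} (hN : IsDrivingNoise P N)
    (hϑ : IsControlledParam P N (i + 1) ϑ C) (hT : 0 < T) (hκ : 0 < κ)
    (hφ : IsRegular (i + 1) C 1 0 (kp + km) (fun x s => φ (trunc (i + 1) x) s)) (hM : 0 ≤ M)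
    (hfM : ∀ p p', |f p * invMonom (signExp kp km) p - f p' * invMonom (signExp kp km) p'|
      ≤ M * min 1 ‖p - p'‖) :
    ∫ ω, |Theta α ρ T κ N f kp km (i + 1) (i + 1) φ ϑ ω
        - Theta α ρ T κ N f kp km i (i + 1) φ ϑ ω| ∂P
      ≤ M * weightConst α kp km * (weightedIncrement α ρ T κ P N (2 * km + 2 * kp) i
        * ∫ ω, C (ϑ ω) ∂P) := by
  have hint := hN.integrable_truncIncrement_mul_pow (α := α) (ρ := ρ) (T := T) (κ := κ)
    (2 * km + 2 * kp) i
  have hindep := indepFun_of_dependsOn hϑ.indep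
    (F := fun x => truncIncrement α ρ T κ i x * noiseGauge (i + 1) x ^ (2 * km + 2 * kp))
    ((measurable_truncIncrement i).mul ((measurable_noiseGauge _).pow_const _))
    (fun x y h => by simp only [dependsOn_truncIncrement i h, dependsOn_noiseGauge _ h])
    hϑ.measurable_bound
  rw [weightedIncrement, ← hindep.integral_fun_mul_eq_mul_integral hint.1 hϑ.integrable_bound.1,
    ← integral_const_mul]
  refine integral_mono_of_nonneg (Eventually.of_forall fun ω => abs_nonneg _)
    ((hindep.integrable_mul hint hϑ.integrable_bound).const_mul _) ?_
  filter_upwards [hN.ae_mem_noiseDomain (i + 1)] with ω hω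
  exact abs_Theta_sub_le hϑ.bound_nonneg hT hκ hφ hM hfM hω

end LevelDifferences

section Limits

variable {α ρ T κ : ℝ} {Ω : Type*} [MeasurableSpace Ω] {P : Measure Ω} {N : Ω → Noise}

lemma tendsto_approxX (hκ : κ ∈ Ioo (0 : ℝ) 1) {σ : PM} {x : Noise}
    (h : Summable (jumpTerm α ρ T σ x)) :
    Tendsto (fun n => approxX α ρ T κ n σ x) atTop (𝓝 (limX α ρ T σ x)) := by
  have htail : Tendsto (fun n => tailTerm α T κ n σ x) atTop (𝓝 0) := by
    have hpow := ((tendsto_pow_atTop_nhds_zero_of_lt_one hκ.1.le hκ.2).const_mul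
      (T ^ (1 / α))).mul_const (x (.eta σ) ^ (1 - 1 / α))
    rwa [mul_zero, zero_mul] at hpow
  have hlim := h.hasSum.tendsto_sum_nat.add htail
  rwa [add_zero] at hlim

lemma tendsto_approxChi (hκ : κ ∈ Ioo (0 : ℝ) 1) {x : Noise}
    (h : ∀ σ, Summable (jumpTerm α ρ T σ x)) :
    Tendsto (fun n => approxChi α ρ T κ n x) atTop (𝓝 (limChi α ρ T x)) :=
  (tendsto_approxX hκ (h .plus)).prodMk_nhds (tendsto_approxX hκ (h .minus))

lemma IsDrivingNoise.tendsto_integral_comp_approxChi (hN : IsDrivingNoise P N)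
    (hκ : κ ∈ Ioo (0 : ℝ) 1) (hsum : ∀ᵐ ω ∂P, ∀ σ, Summable (jumpTerm α ρ T σ (N ω)))
    {g : ℝ × ℝ → ℝ} (hg : Continuous g) {M : ℝ} (hM : ∀ p, |g p| ≤ M) {Φ : Ω → ℝ}
    (hΦ : Integrable Φ P) :
    Integrable (fun ω => g (limChi α ρ T (N ω)) * Φ ω) P ∧
    Tendsto (fun n => ∫ ω, g (approxChi α ρ T κ n (N ω)) * Φ ω ∂P) atTop
      (𝓝 (∫ ω, g (limChi α ρ T (N ω)) * Φ ω ∂P)) := by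
  have hmeas : ∀ n, AEStronglyMeasurable (fun ω => g (approxChi α ρ T κ n (N ω)) * Φ ω) P :=
    fun n => (hg.measurable.comp
      (measurable_approxChi.comp hN.measurable_noise)).aestronglyMeasurable.mul hΦ.1
  have hlim : ∀ᵐ ω ∂P, Tendsto (fun n => g (approxChi α ρ T κ n (N ω)) * Φ ω) atTop
      (𝓝 (g (limChi α ρ T (N ω)) * Φ ω)) := by
    filter_upwards [hsum] with ω hω
    exact ((hg.tendsto _).comp (tendsto_approxChi hκ hω)).mul_const _
  have hbound : ∀ p ω, ‖g p * Φ ω‖ ≤ M * ‖Φ ω‖ := fun p ω => by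
    rw [norm_mul]
    exact mul_le_mul_of_nonneg_right (hM p) (norm_nonneg _)
  have hint : Integrable (fun ω => M * ‖Φ ω‖) P := hΦ.norm.const_mul M
  exact ⟨hint.mono' (aestronglyMeasurable_of_tendsto_ae atTop hmeas hlim)
      (Eventually.of_forall fun ω => hbound _ ω),
    tendsto_integral_of_dominated_convergence _ hmeas hint
      (fun n => Eventually.of_forall fun ω => hbound _ ω) hlim⟩

lemma tendsto_add_sum_Ico_of_hasSum {d : ℕ → ℝ} {n : ℕ} {s : ℝ} (a : ℝ)
    (h : HasSum (fun i => d (n + i)) s) :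
    Tendsto (fun M => a + ∑ i ∈ Finset.Ico n M, d i) atTop (𝓝 (a + s)) := by
  refine Tendsto.const_add a ((tendsto_add_atTop_iff_nat n).1 ?_)
  refine h.tendsto_sum_nat.congr fun M => ?_
  rw [Finset.sum_Ico_eq_sum_range, Nat.add_sub_cancel]

lemma exists_ae_tendsto_of_summable {A : Ω → ℝ} {D : ℕ → Ω → ℝ} {n : ℕ} {L : ℝ}
    (hA : Integrable A P) (hD : ∀ i, Integrable (D (n + i)) P)
    (hs : Summable fun i => ∫ ω, |D (n + i) ω| ∂P)
    (hL : Tendsto (fun M => (∫ ω, A ω ∂P) + ∑ i ∈ Finset.Ico n M, ∫ ω, D i ω ∂P) atTop (𝓝 L)) :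
    ∃ Z : Ω → ℝ, Integrable Z P ∧
      (∀ᵐ ω ∂P, Tendsto (fun M => A ω + ∑ i ∈ Finset.Ico n M, D i ω) atTop (𝓝 (Z ω))) ∧
      L = ∫ ω, Z ω ∂P := by
  have htsum := integrable_tsum_of_summable_integral hD hs
  refine ⟨fun ω => A ω + ∑' i, D (n + i) ω, hA.add htsum, ?_, ?_⟩
  · filter_upwards [ae_summable_of_summable_integral hD hs] with ω hω
    exact tendsto_add_sum_Ico_of_hasSum _ hω.hasSum
  · rw [integral_add hA htsum]
    exact tendsto_nhds_unique hL
      (tendsto_add_sum_Ico_of_hasSum _ (hasSum_integral_of_summable_integral_norm hD hs))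

lemma add_sum_Ico_eq_of_telescoping {n M : ℕ} (h : n ≤ M) {a d : ℕ → ℝ}
    (hd : ∀ i, n ≤ i → d i = a (i + 1) - a i) : a n + ∑ i ∈ Finset.Ico n M, d i = a M := by
  rw [Finset.sum_congr rfl fun i hi => hd i (Finset.mem_Ico.1 hi).1, Finset.sum_Ico_sub a h,
    add_sub_cancel]

end Limits

section Multilevel

variable {α ρ T κ ε : ℝ} {Ω : Type*} [MeasurableSpace Ω] {P : Measure Ω} {N : Ω → Noise}
  {S : ℕ → Type*} [∀ m, MetricSpace (S m)] [∀ m, MeasurableSpace (S m)]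
  {Φ : Ω → ℝ} {φ : ∀ m, Coord m → S m → ℝ} {ϑ : ∀ m, Ω → S m} {n kp km : ℕ} {f : ℝ × ℝ → ℝ}

lemma ae_tendsto_Theta_zero_add_sum_levelDiff
    (hΦ : ∀ m, 1 ≤ m → IsSmoothRep P N m (φ m) (ϑ m) Φ) (hn : 1 ≤ n) (hκ : κ ∈ Ioo (0 : ℝ) 1)
    (hsum : ∀ᵐ ω ∂P, ∀ σ, Summable (jumpTerm α ρ T σ (N ω))) (hf : Continuous f) :
    ∀ᵐ ω ∂P, Tendsto (fun M => Theta α ρ T κ N f 0 0 n n (φ n) (ϑ n) ω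
      + ∑ i ∈ Finset.Ico n M, levelDiff α ρ T κ N f 0 0 φ ϑ i ω) atTop
        (𝓝 (f (limChi α ρ T (N ω)) * Φ ω)) := by
  have hrep : ∀ᵐ ω ∂P, ∀ m, 1 ≤ m → Φ ω = φ m (trunc m (N ω)) (ϑ m ω) :=
    ae_all_iff.2 fun m => eventually_imp_distrib_left.2 fun hm => (hΦ m hm).eq_rep
  filter_upwards [hrep, hsum] with ω hω hsummable
  have hTheta : ∀ i m, 1 ≤ m → Theta α ρ T κ N f 0 0 i m (φ m) (ϑ m) ω
      = f (approxChi α ρ T κ i (N ω)) * Φ ω := fun i m hm => by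
    rw [hω m hm]
    rfl
  refine (((hf.tendsto _).comp (tendsto_approxChi hκ hsummable)).mul_const (Φ ω)).congr' ?_
  filter_upwards [eventually_ge_atTop n] with M hM
  rw [hTheta n n hn]
  refine (add_sum_Ico_eq_of_telescoping hM
    (a := fun i => f (approxChi α ρ T κ i (N ω)) * Φ ω) fun i _ => ?_).symm
  rw [levelDiff, hTheta _ _ i.succ_pos, hTheta _ _ i.succ_pos]

variable [∀ m, BorelSpace (S m)]

lemma integrable_levelDiff (hN : IsDrivingNoise P N) (hT : 0 < T) (hκ : 0 < κ) (hε : 0 < ε)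
    (hf : IsTestFunction (kp + km) ε f) {i : ℕ}
    (hΦ : IsSmoothRep P N (i + 1) (φ (i + 1)) (ϑ (i + 1)) Φ) :
    Integrable (levelDiff α ρ T κ N f kp km φ ϑ i) P :=
  (hΦ.integrable_Theta hN hT hκ le_rfl hε hf).sub (hΦ.integrable_Theta hN hT hκ i.le_succ hε hf)

lemma integral_levelDiff [IsProbabilityMeasure P] (hN : IsDrivingNoise P N) (hα : α ≠ 0)
    (hα1 : α ≠ 1) (hT : 0 < T) (hκ : 0 < κ) (hε : 0 < ε) (hf : IsTestFunction (kp + km) ε f) {i : ℕ}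
    (hΦ : IsSmoothRep P N (i + 1) (φ (i + 1)) (ϑ (i + 1)) Φ) :
    ∫ ω, levelDiff α ρ T κ N f kp km φ ϑ i ω ∂P
      = (∫ ω, mixedDeriv kp km f (approxChi α ρ T κ (i + 1) (N ω)) * Φ ω ∂P)
        - ∫ ω, mixedDeriv kp km f (approxChi α ρ T κ i (N ω)) * Φ ω ∂P := by
  rw [← hΦ.integral_Theta hN hα hα1 hT hκ le_rfl hε hf,
    ← hΦ.integral_Theta hN hα hα1 hT hκ i.le_succ hε hf]
  exact integral_sub (hΦ.integrable_Theta hN hT hκ le_rfl hε hf)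
    (hΦ.integrable_Theta hN hT hκ i.le_succ hε hf)

lemma tendsto_integral_Theta_add_sum_levelDiff [IsProbabilityMeasure P]
    (hN : IsDrivingNoise P N) (hα : α ≠ 0) (hα1 : α ≠ 1) (hT : 0 < T)
    (hκ : κ ∈ Ioo (0 : ℝ) 1) (hε : 0 < ε)
    (hsum : ∀ᵐ ω ∂P, ∀ σ, Summable (jumpTerm α ρ T σ (N ω)))
    (hΦ : ∀ m, 1 ≤ m → IsSmoothRep P N m (φ m) (ϑ m) Φ) (hn : 1 ≤ n)
    (hf : IsTestFunction (kp + km) ε f) :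
    Integrable (fun ω => mixedDeriv kp km f (limChi α ρ T (N ω)) * Φ ω) P ∧
    Tendsto (fun M => (∫ ω, Theta α ρ T κ N f kp km n n (φ n) (ϑ n) ω ∂P)
        + ∑ i ∈ Finset.Ico n M, ∫ ω, levelDiff α ρ T κ N f kp km φ ϑ i ω ∂P)
      atTop (𝓝 (∫ ω, mixedDeriv kp km f (limChi α ρ T (N ω)) * Φ ω ∂P)) := by
  obtain ⟨M, -, hM⟩ := hf.mixedDeriv.exists_bound
  obtain ⟨hint, hlim⟩ := hN.tendsto_integral_comp_approxChi hκ hsum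
    hf.mixedDeriv.contDiff.continuous hM ((hΦ n hn).integrable hN)
  refine ⟨hint, hlim.congr' ?_⟩
  filter_upwards [eventually_ge_atTop n] with M hM
  rw [(hΦ n hn).integral_Theta hN hα hα1 hT hκ.1 le_rfl hε hf]
  exact (add_sum_Ico_eq_of_telescoping hM
    (a := fun i => ∫ ω, mixedDeriv kp km f (approxChi α ρ T κ i (N ω)) * Φ ω ∂P) fun i _ =>
    integral_levelDiff hN hα hα1 hT hκ.1 hε hf (hΦ _ i.succ_pos)).symm

lemma summable_integral_abs_levelDiff [IsProbabilityMeasure P] (hN : IsDrivingNoise P N)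
    (hα : α ∈ Ioo (0 : ℝ) 2) (hα1 : α ≠ 1)
    (hρ : ρ ∈ Icc (1 - 1 / α) (1 / α) ∩ Ioo (0 : ℝ) 1) (hT : 0 < T) (hκ : κ ∈ Ioo (0 : ℝ) 1)
    (hε : 0 < ε) (hΦ : ∀ m, 1 ≤ m → IsSmoothRep P N m (φ m) (ϑ m) Φ)
    (hunif : ∀ j, ∃ K, ∀ m, 1 ≤ m → DerivBoundedInMean P m (φ m) (ϑ m) j K)
    (hf : IsTestFunction (kp + km) ε f) (hpos : 1 ≤ kp + km) :
    Summable fun i => ∫ ω, |levelDiff α ρ T κ N f kp km φ ϑ i ω| ∂P := by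
  choose K hK using hunif
  obtain ⟨M, hM, hfM⟩ := ((hf.of_le hpos).isBoundedLipschitz_mul_invMonom hε
    (signExp kp km)).exists_abs_sub_le_mul_min
  refine .of_nonneg_of_le (fun i => integral_nonneg fun ω => abs_nonneg _) (fun i => ?_)
    (((hN.summable_weightedIncrement hα hα1 hρ hT hκ (2 * km + 2 * kp)).mul_right
      (∑ j ∈ Finset.range (kp + km + 1), K j)).mul_left (M * weightConst α kp km))
  obtain ⟨C, hϑ, hCK, hφ⟩ := (hΦ _ i.succ_pos).exists_isControlledParam
    (fun j => hK j _ i.succ_pos) (kp + km)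
  refine (integral_abs_Theta_sub_le hN hϑ hT hκ.1 hφ hM hfM).trans ?_
  have := weightConst_nonneg α kp km
  have := hN.weightedIncrement_nonneg (α := α) (ρ := ρ) (T := T) (κ := κ) (2 * km + 2 * kp) i
  gcongr

end Multilevel

end StableIBP

end

theorem theorem3p5
    (α ρ T κ ε : ℝ) (hα : α ∈ Ioo (0 : ℝ) 2) (hα1 : α ≠ 1)
    (hρ : ρ ∈ Icc (1 - 1 / α) (1 / α) ∩ Ioo (0 : ℝ) 1)
    (hT : 0 < T) (hκ : κ ∈ Ioo (0 : ℝ) 1) (hε : 0 < ε)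
    {Ω : Type*} [MeasurableSpace Ω] (P : Measure Ω) [IsProbabilityMeasure P]
    (N : Ω → Noise) (hN : IsDrivingNoise P N)
    {S : ℕ → Type*} [∀ m, MetricSpace (S m)] [∀ m, MeasurableSpace (S m)]
    [∀ m, BorelSpace (S m)]
    (Φ : Ω → ℝ) (φ : ∀ m, Coord m → S m → ℝ) (ϑ : ∀ m, Ω → S m)
    (hΦ : ∀ m, 1 ≤ m → IsSmoothRep P N m (φ m) (ϑ m) Φ)
    (n : ℕ) (hn : 1 ≤ n) (kp km : ℕ)
    (f : ℝ × ℝ → ℝ) (hf : IsTestFunction (kp + km) ε f) :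
    -- the series defining `χ` converge, and every expectation below exists
    (∀ σ, ∀ᵐ ω ∂P, Summable (jumpTerm α ρ T σ (N ω))) ∧
    Integrable (fun ω => mixedDeriv kp km f (limChi α ρ T (N ω)) * Φ ω) P ∧
    (∀ i m, 1 ≤ i → i ≤ m → Integrable (Theta α ρ T κ N f kp km i m (φ m) (ϑ m)) P) ∧
    -- the multilevel formula, as a convergent series of expectations
    Tendsto (fun M => (∫ ω, Theta α ρ T κ N f kp km n n (φ n) (ϑ n) ω ∂P)
        + ∑ i ∈ Finset.Ico n M, ∫ ω, levelDiff α ρ T κ N f kp km φ ϑ i ω ∂P)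
      atTop (𝓝 (∫ ω, mixedDeriv kp km f (limChi α ρ T (N ω)) * Φ ω ∂P)) ∧
    -- the multilevel formula, as the expectation of a series that converges almost surely
    (((∀ j, ∃ K, ∀ m, 1 ≤ m → DerivBoundedInMean P m (φ m) (ϑ m) j K) ∨
        Summable (fun i => ∫ ω, |levelDiff α ρ T κ N f kp km φ ϑ (n + i) ω| ∂P)) →
      ∃ Z : Ω → ℝ, Integrable Z P ∧
        (∀ᵐ ω ∂P, Tendsto (fun M => Theta α ρ T κ N f kp km n n (φ n) (ϑ n) ω
            + ∑ i ∈ Finset.Ico n M, levelDiff α ρ T κ N f kp km φ ϑ i ω) atTop (𝓝 (Z ω))) ∧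
        (∫ ω, mixedDeriv kp km f (limChi α ρ T (N ω)) * Φ ω ∂P) = ∫ ω, Z ω ∂P) := by
  have hsum : ∀ σ, ∀ᵐ ω ∂P, Summable (jumpTerm α ρ T σ (N ω)) :=
    hN.ae_summable_jumpTerm hα hα1 hρ hT
  have hsum_both : ∀ᵐ ω ∂P, ∀ σ, Summable (jumpTerm α ρ T σ (N ω)) := by
    filter_upwards [hsum .plus, hsum .minus] with ω hplus hminus
    rintro (_ | _)
    exacts [hplus, hminus]
  have hTheta : ∀ i m, 1 ≤ i → i ≤ m →
      Integrable (Theta α ρ T κ N f kp km i m (φ m) (ϑ m)) P := fun i m hi him =>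
    (hΦ m (hi.trans him)).integrable_Theta hN hT hκ.1 him hε hf
  obtain ⟨hint, hseries⟩ := tendsto_integral_Theta_add_sum_levelDiff hN hα.1.ne' hα1 hT hκ hε
    hsum_both hΦ hn hf
  refine ⟨hsum, hint, hTheta, hseries, fun hcontrol => ?_⟩
  obtain ⟨rfl, rfl⟩ | hsummable : (kp = 0 ∧ km = 0) ∨
      Summable fun i => ∫ ω, |levelDiff α ρ T κ N f kp km φ ϑ (n + i) ω| ∂P := by
    refine hcontrol.elim (fun hunif => ?_) .inr
    by_cases hpos : 1 ≤ kp + km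
    · exact .inr ((summable_integral_abs_levelDiff hN hα hα1 hρ hT hκ hε hΦ hunif hf
        hpos).comp_injective (add_right_injective n))
    · exact .inl (by omega)
  · refine ⟨_, hint, ?_, rfl⟩
    simpa [mixedDeriv] using
      ae_tendsto_Theta_zero_add_sum_levelDiff hΦ hn hκ hsum_both hf.contDiff.continuous
  · exact exists_ae_tendsto_of_summable (hTheta n n hn le_rfl)
      (fun i => integrable_levelDiff hN hT hκ.1 hε hf (hΦ _ (n + i).succ_pos)) hsummable hseries
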